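/- **Theorem.** For $n\ge 2$, let $B_n$ be the group of permutations $w$ of $[\pm n]=\{-n,\dots,-1,1,\dots,n\}$ with $w(-i)=-w(i)$ for all $i$, and let $D_n$ be the subgroup of those $w\in B_n$ that send an even number of positive integers to negative integers. Let $S=\{s_0,s_1,\dots,s_{n-1}\}\subset D_n$, where $s_i=(i\ \ i{+}1)(-i\ \ {-i{-}1})$ for $1\le i\le n-1$ and $s_0=(-1\ \ 2)(1\ \ {-2})$. For $w\in D_n$ let $\ell(w)$ be the least number of factors in an expression of $w$ as a product of elements of $S$, let $\operatorname{des}(w)=|\{s\in S:\ell(ws)<\ell(w)\}|$, and say that a random element $w$ of $D_n$ is Mallows distributed with parameter $q\in(0,\infty)$ if $$\mathbb P(w=w_0)=\frac{q^{\ell(w_0)}}{\sum_{v\in D_n}q^{\ell(v)}}\qquad\text{for all } w_0\in D_n .$$ Let $n\ge 30$, let $w\in D_n$ be Mallows distributed with parameter $q\in(0,\infty)$, and let $\mu$ and $\sigma^2$ ($\sigma\ge 0$) denote the mean and the variance of $\operatorname{des}(w)+\operatorname{des}(w^{-1})$. Let $Z$ be a standard normal random variable. Then for every continuous, piecewise continuously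 differentiable function $h:\mathbb R\to\mathbb R$ (that is, $h$ is continuous on $\mathbb R$ and continuously differentiable off a set that has only finitely many points in each bounded interval), $$\left|\mathbb E\,h\!\left(\frac{\operatorname{des}(w)+\operatorname{des}(w^{-1})-\mu}{\sigma}\right)-\mathbb E\,h(Z)\right|\le\left(768\,\|h\|_\infty+666\,\|h'\|_\infty\max\left(q^{-1/2},q^{1/2}\right)\right)n^{-1/2}.$$ Here $\|h\|_\infty=\sup_x|h(x)|$ and $\|h'\|_\infty$ is the supremum of $|h'|$ over the points where $h$ is differentiable; the right-hand side is $+\infty$, and nothing is asserted, if one of these is infinite. -/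

import Mathlib

open MeasureTheory ProbabilityTheory
open scoped ENNReal

/-! ### Length, descents and the Mallows measure of a finite group with a generating set -/

section Coxeter

variable {W : Type*} [Group W]

/-- The length of `w` with respect to `S`: the least number of factors in an expression of `w` as
a product of elements of `S`. -/
noncomputable def coxeterLength (S : Set W) (w : W) : ℕ :=
  sInf {k : ℕ | ∃ l : List W, (∀ s ∈ l, s ∈ S) ∧ l.prod = w ∧ l.length = k}

/-- `des w`: the number of generators `s ∈ S` at which `w` has a (right) descent, that is,
`ℓ (w s) < ℓ w`. -/
noncomputable def descentCount (S : Set W) (w : W) : ℕ :=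
  {s ∈ S | coxeterLength S (w * s) < coxeterLength S w}.ncard

/-- The two-sided descent statistic `des w + des w⁻¹`. -/
noncomputable def twoSidedDescent (S : Set W) (w : W) : ℕ :=
  descentCount S w + descentCount S w⁻¹

/-- The Mallows measure with parameter `q`: the mass of `w` is `q ^ ℓ w / ∑ v, q ^ ℓ v`. -/
noncomputable def mallowsMeasure [Fintype W] [MeasurableSpace W] (S : Set W) (q : ℝ) :
    Measure W :=
  ∑ w : W, ENNReal.ofReal (q ^ coxeterLength S w / ∑ v : W, q ^ coxeterLength S v) •
    Measure.dirac w

end Coxeter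

/-! ### The even signed permutation group `D_n` -/

/-- The set `[±n] = {-n, …, -1, 1, …, n}`. -/
abbrev SignedIndex (n : ℕ) : Type := {x : ℤ // x ∈ (Finset.Icc (-(n : ℤ)) n).erase 0}

/-- The negation `x ↦ -x` on `[±n]`. -/
def SignedIndex.neg {n : ℕ} (x : SignedIndex n) : SignedIndex n :=
  ⟨-x.1, by
    have hx := x.2
    simp only [Finset.mem_erase, Finset.mem_Icc] at hx ⊢
    omega⟩

/-- The group `B_n` of signed permutations: the permutations of `[±n]` that commute with
negation. -/
def signedPerm (n : ℕ) : Subgroup (Equiv.Perm (SignedIndex n)) where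
  carrier := {w | ∀ x, w x.neg = (w x).neg}
  one_mem' := fun _ => rfl
  mul_mem' := by
    intro a b ha hb x
    simp only [Equiv.Perm.mul_apply]
    rw [hb, ha]
  inv_mem' := by
    intro a ha x
    rw [Equiv.Perm.inv_eq_iff_eq, ha]
    simp

/-- The number of positive elements of `[±n]` that `w` sends to negative ones. -/
noncomputable def negCount {n : ℕ} (w : Equiv.Perm (SignedIndex n)) : ℕ :=
  (Finset.univ.filter fun x : SignedIndex n => 0 < x.1 ∧ (w x).1 < 0).card

theorem SignedIndex.ne_zero {n : ℕ} (x : SignedIndex n) : x.1 ≠ 0 :=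
  (Finset.mem_erase.1 x.2).1

theorem neg_one_pow_negCount {n : ℕ} (w : Equiv.Perm (SignedIndex n)) :
    (-1 : ℤ) ^ negCount w =
      ∏ x ∈ Finset.univ.filter (fun x : SignedIndex n => 0 < x.1), (w x).1.sign := by
  have h : ∀ x : SignedIndex n, (w x).1.sign = if (w x).1 < 0 then -1 else 1 := by
    intro x
    have := (w x).ne_zero
    split_ifs with hx
    · exact Int.sign_eq_neg_one_of_neg hx
    · exact Int.sign_eq_one_of_pos (by omega)
  simp only [h, Finset.prod_ite, Finset.prod_const, Finset.filter_filter, negCount, one_pow,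
    mul_one]

theorem prod_comp_signedPerm {n : ℕ} {v : Equiv.Perm (SignedIndex n)} (hv : v ∈ signedPerm n)
    (f : SignedIndex n → ℤ) (hf : ∀ x, f x.neg = f x) :
    ∏ x ∈ Finset.univ.filter (fun x : SignedIndex n => 0 < x.1), f (v x) =
      ∏ x ∈ Finset.univ.filter (fun x : SignedIndex n => 0 < x.1), f x := by
  have hnn : ∀ x : SignedIndex n, x.neg.neg = x := fun x => Subtype.ext (neg_neg x.1)
  have hv' : ∀ x, v x.neg = (v x).neg := hv
  let r : SignedIndex n → SignedIndex n := fun x => if 0 < x.1 then x else x.neg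
  have hr : ∀ x, r x = x ∨ r x = x.neg := by
    intro x
    by_cases h : 0 < x.1 <;> simp [r, h]
  have hrpos : ∀ x, 0 < (r x).1 := by
    intro x
    have := x.ne_zero
    by_cases h : 0 < x.1
    · simp [r, h]
    · simp only [r, h, if_false, SignedIndex.neg]
      omega
  have key : ∀ x y : SignedIndex n, 0 < x.1 → 0 < y.1 → (x = y ∨ x = y.neg) → x = y := by
    rintro x y hx hy (h | h)
    · exact h
    · have h1 : x.1 = -y.1 := congrArg Subtype.val h
      omega
  refine Finset.prod_bij (fun x _ => r (v x)) ?_ ?_ ?_ ?_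
  · intro x _
    simp [hrpos (v x)]
  · intro x hx y hy hxy
    simp only [Finset.mem_filter, Finset.mem_univ, true_and] at hx hy
    refine key x y hx hy ?_
    have h2 : v x = v y ∨ v x = (v y).neg := by
      rcases hr (v x) with h | h <;> rcases hr (v y) with h' | h' <;> simp only [h, h'] at hxy
      · exact Or.inl hxy
      · exact Or.inr hxy
      · exact Or.inr (by rw [← hxy, hnn])
      · exact Or.inl (by rw [← hnn (v x), hxy, hnn])
    rcases h2 with h | h
    · exact Or.inl (v.injective h)
    · exact Or.inr (v.injective (by rw [h, hv']))
  · intro y hy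
    simp only [Finset.mem_filter, Finset.mem_univ, true_and] at hy
    refine ⟨r (v.symm y), by simp [hrpos], ?_⟩
    refine key _ _ (hrpos _) hy ?_
    have h1 : v (r (v.symm y)) = y ∨ v (r (v.symm y)) = y.neg := by
      rcases hr (v.symm y) with h | h
      · exact Or.inl (by simp [h])
      · exact Or.inr (by rw [h, hv']; simp)
    rcases hr (v (r (v.symm y))) with h | h <;> rcases h1 with h' | h'
    · exact Or.inl (h.trans h')
    · exact Or.inr (h.trans h')
    · exact Or.inr (by rw [h, h'])
    · exact Or.inl (by rw [h, h', hnn])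
  · intro x _
    rcases hr (v x) with h | h <;> simp only [h, hf]

theorem neg_one_pow_negCount_mul {n : ℕ} {w v : Equiv.Perm (SignedIndex n)}
    (hw : w ∈ signedPerm n) (hv : v ∈ signedPerm n) :
    (-1 : ℤ) ^ negCount (w * v) = (-1) ^ negCount w * (-1) ^ negCount v := by
  have hw' : ∀ x, w x.neg = (w x).neg := hw
  have hs : ∀ x : SignedIndex n, x.1.sign * x.1.sign = 1 := by
    intro x
    rcases lt_or_gt_of_ne x.ne_zero with h | h
    · simp [Int.sign_eq_neg_one_of_neg h]
    · simp [Int.sign_eq_one_of_pos h]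
  have h1 := prod_comp_signedPerm hv (fun x => (w x).1.sign * x.1.sign) (by
    intro x
    rw [hw']
    simp [SignedIndex.neg])
  have h2 : ∏ x ∈ Finset.univ.filter (fun x : SignedIndex n => 0 < x.1),
      (w x).1.sign * x.1.sign =
      ∏ x ∈ Finset.univ.filter (fun x : SignedIndex n => 0 < x.1), (w x).1.sign := by
    refine Finset.prod_congr rfl fun x hx => ?_
    simp only [Finset.mem_filter, Finset.mem_univ, true_and] at hx
    rw [Int.sign_eq_one_of_pos hx, mul_one]
  rw [neg_one_pow_negCount, neg_one_pow_negCount w, neg_one_pow_negCount v, ← h2, ← h1,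
    ← Finset.prod_mul_distrib]
  refine Finset.prod_congr rfl fun x _ => ?_
  rw [mul_assoc, hs, mul_one, Equiv.Perm.mul_apply]

/-- The group `D_n` of even signed permutations: the elements of `B_n` that send an even number of
positive integers to negative ones. -/
def evenSignedPerm (n : ℕ) : Subgroup (Equiv.Perm (SignedIndex n)) where
  carrier := {w | w ∈ signedPerm n ∧ Even (negCount w)}
  one_mem' := by
    refine ⟨one_mem _, ?_⟩
    have : negCount (1 : Equiv.Perm (SignedIndex n)) = 0 := by
      simp only [negCount, Finset.card_eq_zero, Finset.filter_eq_empty_iff]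
      rintro x - ⟨h1, h2⟩
      simp only [Equiv.Perm.one_apply] at h2
      omega
    simp [this]
  mul_mem' := by
    rintro a b ⟨ha, ha'⟩ ⟨hb, hb'⟩
    refine ⟨mul_mem ha hb, ?_⟩
    have h := neg_one_pow_negCount_mul ha hb
    rw [ha'.neg_one_pow, hb'.neg_one_pow, mul_one] at h
    exact (neg_one_pow_eq_one_iff_even (by norm_num)).1 h
  inv_mem' := by
    rintro a ⟨ha, ha'⟩
    refine ⟨inv_mem ha, ?_⟩
    have h := neg_one_pow_negCount_mul ha (inv_mem ha)
    have h1 : negCount (1 : Equiv.Perm (SignedIndex n)) = 0 := by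
      simp only [negCount, Finset.card_eq_zero, Finset.filter_eq_empty_iff]
      rintro x - ⟨h1, h2⟩
      simp only [Equiv.Perm.one_apply] at h2
      omega
    rw [mul_inv_cancel, h1, ha'.neg_one_pow, one_mul, pow_zero] at h
    exact (neg_one_pow_eq_one_iff_even (by norm_num)).1 h.symm

noncomputable instance (n : ℕ) : Fintype (evenSignedPerm n) := Fintype.ofFinite _

/-- Every subset of the finite group `D_n` is an event. -/
instance (n : ℕ) : MeasurableSpace (evenSignedPerm n) := ⊤

/-- The Coxeter generators of `D_n`: `s_i = (i  i+1)(-i  -i-1)` for `1 ≤ i ≤ n - 1`, and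
`s_0 = (-1  2)(1  -2)`. -/
def typeDGenerators (n : ℕ) : Set (evenSignedPerm n) :=
  {s | ∃ a b : SignedIndex n,
    ((0 < a.1 ∧ b.1 = a.1 + 1) ∨ (a.1 = -1 ∧ b.1 = 2)) ∧
      (s : Equiv.Perm (SignedIndex n)) = Equiv.swap a b * Equiv.swap a.neg b.neg}

/-! ### Test functions -/

/-- `h` is continuous, and continuously differentiable off a set that has only finitely many points
in each bounded interval. -/
def PiecewiseContDiff (h : ℝ → ℝ) : Prop :=
  Continuous h ∧ ∃ s : Set ℝ, (∀ a b : ℝ, (s ∩ Set.Icc a b).Finite) ∧ ∀ x ∉ s, ContDiffAt ℝ 1 h x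

/-- The supremum norm, with value `∞` for an unbounded function. -/
noncomputable def supNorm (f : ℝ → ℝ) : ℝ≥0∞ := ⨆ x, ‖f x‖ₑ

/-! Write `T = des w + des w⁻¹` with mean `μ` and variance `σ²`, `p = q / (1 + q)` and `κ = p (1 -
p)`. Right multiplication by a generator `s_i` pairs `w` with `w s_i`, and the Mallows weights of
the two have ratio `q`. Hence `E[(1{descent at i} - p) F] = κ E[δ_i F]`, where `δ_i F` is the change
of `F` from the shorter to the longer element (`mean_descInd_sub_mul`). The law is invariant under
inversion, so for `F w⁻¹ = F w` summation over `i` gives the integration by parts formula `E[(T - μ)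
F] = 2κ ∑ E[δ_i F]` (`mean_twoDes_sub_mul`). Taking `F = T - μ` yields `Var T = 2κ E G` with `G = ∑
δ_i T` (`gradSum`). Taking `F = f(W)` with `W = (T - μ) / σ` and expanding to second order bounds
`E[f'(W) - W f(W)]` by the relative fluctuation of `G` plus a term of order `nκ/σ³` (`stein_bound`).
Applied to solutions of Stein's equation (`exists_stein_solution`), this gives the theorem, provided
that `E G` has order `n` and the fluctuation of `G` has order `√n`, both uniformly in `q`.

Up to an error of 6, `G` is 2 plus the number of monotone consecutive triples plus the number of
positions where consecutive values differ by one (`abs_gradSum_sub_le`). A triple is monotone with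
probability at least 1/3 for every `q`, which bounds `E G` from below. For the variances, the
relative order of the values at the positions `c, …, n` is independent of the coset of `w` modulo
permutations of these positions (`mean_mul_of_isPattern`), so triples at distance at least 3 are
uncorrelated.

Adjacency of values is not a matter of relative order. It is replaced by being consecutive among the
values at later positions, and the excess is a "gap" event. The gap probabilities have bounded sum
(`sum_gapProb_le_const`): with `x = min q q⁻¹`, a gap can be carried to other positions at a cost
`x` per adjacent transposition, so gaps at neighbouring positions are rarer than all gaps by the
factor `S = ∑ x^r`, up to a constant. On the other hand the expected number of gaps is at most `6
S`, because gaps are places where `w⁻¹` leaves the block of values `c, …, n`, and entries and exits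
balance up to 2 while their means differ by the factor `q`. -/

/-! ### Stein's equation for the normal distribution. -/

section Stein

/-- The unnormalised standard Gaussian density. -/
noncomputable def gaussKernel (t : ℝ) : ℝ := Real.exp (-(1 / 2) * t ^ 2)

theorem gaussKernel_pos (t : ℝ) : 0 < gaussKernel t := Real.exp_pos _

theorem gaussKernel_neg (t : ℝ) : gaussKernel (-t) = gaussKernel t := by
  simp [gaussKernel]

theorem continuous_gaussKernel : Continuous gaussKernel := by
  unfold gaussKernel; fun_prop

theorem integrable_gaussKernel : Integrable gaussKernel :=
  integrable_exp_neg_mul_sq (by norm_num : (0 : ℝ) < 1 / 2)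

theorem integrable_id_mul_gaussKernel : Integrable fun t => t * gaussKernel t :=
  integrable_mul_exp_neg_mul_sq (by norm_num : (0 : ℝ) < 1 / 2)

theorem integrable_sq_mul_gaussKernel : Integrable fun t => t ^ 2 * gaussKernel t := by
  have := integrable_rpow_mul_exp_neg_mul_sq (by norm_num : (0 : ℝ) < 1 / 2)
    (by norm_num : (-1 : ℝ) < 2)
  simpa [gaussKernel] using this

theorem hasDerivAt_gaussKernel (t : ℝ) : HasDerivAt gaussKernel (-(t * gaussKernel t)) t := by
  have h : HasDerivAt (fun t : ℝ => -(1 / 2) * t ^ 2) (-(1 / 2) * (2 * t)) t := by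
    simpa using (hasDerivAt_pow 2 t).const_mul (-(1 / 2) : ℝ)
  exact h.exp.congr_deriv (by simp only [gaussKernel]; ring)

theorem integral_gaussKernel : ∫ t, gaussKernel t = √(2 * Real.pi) := by
  have := integral_gaussian (1 / 2)
  simp only [gaussKernel]
  rw [this]; congr 1; ring

theorem tendsto_gaussKernel : Filter.Tendsto gaussKernel Filter.atTop (nhds 0) := by
  have h := tendsto_rpow_abs_mul_exp_neg_mul_sq_cocompact (by norm_num : (0 : ℝ) < 1 / 2) 0
  exact (h.mono_left atTop_le_cocompact).congr fun t => by simp [gaussKernel]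

theorem tendsto_id_mul_gaussKernel :
    Filter.Tendsto (fun t => t * gaussKernel t) Filter.atTop (nhds 0) := by
  have h := tendsto_rpow_abs_mul_exp_neg_mul_sq_cocompact (by norm_num : (0 : ℝ) < 1 / 2) 1
  have h2 := h.mono_left atTop_le_cocompact
  refine h2.congr' ?_
  filter_upwards [Filter.eventually_ge_atTop 0] with t ht
  simp [gaussKernel, abs_of_nonneg ht]

theorem integral_Ioi_id_mul_gaussKernel (x : ℝ) :
    ∫ t in Set.Ioi x, t * gaussKernel t = gaussKernel x := by
  have := integral_Ioi_of_hasDerivAt_of_tendsto' (a := x) (f := fun t => -gaussKernel t)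
    (f' := fun t => t * gaussKernel t) (m := 0)
    (fun t _ => (hasDerivAt_gaussKernel t).neg.congr_deriv (neg_neg _))
    integrable_id_mul_gaussKernel.integrableOn (by simpa using tendsto_gaussKernel.neg)
  simpa using this

theorem integral_Ioi_sq_mul_gaussKernel (x : ℝ) :
    ∫ t in Set.Ioi x, t ^ 2 * gaussKernel t =
      x * gaussKernel x + ∫ t in Set.Ioi x, gaussKernel t := by
  have := integral_Ioi_of_hasDerivAt_of_tendsto' (a := x) (f := fun t => -(t * gaussKernel t))
    (f' := fun t => t ^ 2 * gaussKernel t - gaussKernel t) (m := 0)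
    (fun t _ => ((hasDerivAt_id t).mul (hasDerivAt_gaussKernel t)).neg.congr_deriv
      (by simp only [id]; ring))
    (integrable_sq_mul_gaussKernel.sub integrable_gaussKernel).integrableOn
    (by simpa using tendsto_id_mul_gaussKernel.neg)
  rw [integral_sub integrable_sq_mul_gaussKernel.integrableOn
    integrable_gaussKernel.integrableOn] at this
  linarith

theorem integral_abs_mul_gaussKernel : ∫ t, |t| * gaussKernel t = 2 := by
  have h := integral_comp_abs (f := fun t => t * gaussKernel t)
  have h0 : ∀ t, gaussKernel |t| = gaussKernel t := fun t => by simp [gaussKernel]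
  simp only [h0] at h
  rw [h, integral_Ioi_id_mul_gaussKernel]
  simp [gaussKernel]

theorem integrable_abs_mul_gaussKernel : Integrable fun t => |t| * gaussKernel t := by
  have := integrable_id_mul_gaussKernel.abs
  simpa [abs_mul, abs_of_pos (gaussKernel_pos _)] using this

/-- The Gaussian tail integral. -/
noncomputable def gaussTail (x : ℝ) : ℝ := ∫ t in Set.Ioi x, gaussKernel t

theorem integral_Ioi_sub_mul_gaussKernel (x : ℝ) :
    ∫ t in Set.Ioi x, (t - x) * gaussKernel t = gaussKernel x - x * gaussTail x := by
  simp only [sub_mul]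
  rw [integral_sub integrable_id_mul_gaussKernel.integrableOn
    (integrable_gaussKernel.const_mul x).integrableOn, integral_Ioi_id_mul_gaussKernel,
    integral_const_mul, gaussTail]

theorem mul_gaussTail_le (x : ℝ) : x * gaussTail x ≤ gaussKernel x := by
  have h : 0 ≤ ∫ t in Set.Ioi x, (t - x) * gaussKernel t :=
    setIntegral_nonneg measurableSet_Ioi fun t ht =>
      mul_nonneg (sub_nonneg.2 (le_of_lt ht)) (gaussKernel_pos t).le
  rw [integral_Ioi_sub_mul_gaussKernel] at h
  linarith

/-- Expand `∫ (t - x)² φ ≥ 0` over the tail. Together with `mul_gaussTail_le` it traps the Mills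
ratio between `x / (1 + x²)` and `1 / x` for `x > 0`. -/
theorem le_one_add_sq_mul_gaussTail (x : ℝ) :
    x * gaussKernel x ≤ (1 + x ^ 2) * gaussTail x := by
  have h : 0 ≤ ∫ t in Set.Ioi x, (t - x) ^ 2 * gaussKernel t :=
    setIntegral_nonneg measurableSet_Ioi fun t _ =>
      mul_nonneg (sq_nonneg _) (gaussKernel_pos t).le
  have e : ∀ t, (t - x) ^ 2 * gaussKernel t =
      t ^ 2 * gaussKernel t - (2 * x) * (t * gaussKernel t) + x ^ 2 * gaussKernel t := by
    intro t; ring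
  simp only [e] at h
  have hi : Integrable fun t => t ^ 2 * gaussKernel t - (2 * x) * (t * gaussKernel t) :=
    integrable_sq_mul_gaussKernel.sub (integrable_id_mul_gaussKernel.const_mul _)
  rw [integral_add hi.integrableOn (integrable_gaussKernel.const_mul _).integrableOn,
    integral_sub integrable_sq_mul_gaussKernel.integrableOn
      (integrable_id_mul_gaussKernel.const_mul _).integrableOn,
    integral_const_mul, integral_const_mul, integral_Ioi_id_mul_gaussKernel,
    integral_Ioi_sq_mul_gaussKernel] at h
  simp only [gaussTail]
  linarith

/-- The constant exceeds `√(π/2)`, the tail at 0, and `φ(t + x) ≤ φ(x) φ(t)` for `t, x ≥ 0`. It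
serves near 0, where the bound `1 / x` is useless. -/
theorem gaussTail_le {x : ℝ} (hx : 0 ≤ x) : gaussTail x ≤ 1.26 * gaussKernel x := by
  have h0 : gaussTail 0 ≤ 1.26 := by
    have := integral_gaussian_Ioi (1 / 2)
    simp only [gaussTail, gaussKernel]
    rw [this]
    have h2 : √(Real.pi / (1 / 2)) ≤ 2.52 := by
      apply Real.sqrt_le_iff.2 ⟨by norm_num, ?_⟩
      have := Real.pi_lt_d2
      norm_num at this ⊢; linarith
    linarith
  have h1 : gaussTail x = ∫ t in Set.Ioi (0 : ℝ), gaussKernel (t + x) := by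
    have hm : MeasurePreserving (fun t : ℝ => t + x) volume volume :=
      measurePreserving_add_right volume x
    have := hm.setIntegral_preimage_emb (measurableEmbedding_addRight x) gaussKernel (Set.Ioi x)
    rw [gaussTail, ← this]
    simp
  have h2 : ∫ t in Set.Ioi (0 : ℝ), gaussKernel (t + x) ≤
      ∫ t in Set.Ioi (0 : ℝ), gaussKernel x * gaussKernel t := by
    refine setIntegral_mono_on ?_ (integrable_gaussKernel.const_mul _).integrableOn
      measurableSet_Ioi ?_
    · exact (integrable_gaussKernel.comp_add_right x).integrableOn
    · intro t ht
      have ht : 0 < t := ht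
      simp only [gaussKernel, ← Real.exp_add]
      apply Real.exp_le_exp.2
      nlinarith [mul_nonneg ht.le hx]
  rw [integral_const_mul] at h2
  rw [h1]
  refine h2.trans ?_
  rw [mul_comm]
  exact mul_le_mul_of_nonneg_right h0 (gaussKernel_pos x).le

variable {g : ℝ → ℝ} {C L : ℝ}

theorem integrable_mul_gaussKernel (hgc : Continuous g) (hC : ∀ x, |g x| ≤ C) :
    Integrable fun t => g t * gaussKernel t :=
  integrable_gaussKernel.bdd_mul (c := C) hgc.aestronglyMeasurable
    (Filter.Eventually.of_forall fun x => by simpa using hC x)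

/-- As `g` has Gaussian mean zero, `g x` is the Gaussian average of `g x - g t`; then `∫ |t| φ = 2 ≤
√(2π)`. -/
theorem abs_le_of_centered (hgc : Continuous g) (hC : ∀ x, |g x| ≤ C)
    (hL : ∀ x y, |g x - g y| ≤ L * |x - y|) (h0 : ∫ t, g t * gaussKernel t = 0)
    {x : ℝ} (hx : 0 ≤ x) : |g x| ≤ L * (x + 1) := by
  have hL0 : 0 ≤ L := by
    have := (abs_nonneg _).trans (hL 1 0); simpa using this
  have hi := integrable_mul_gaussKernel hgc hC
  have h1 : ∫ t, (g x - g t) * gaussKernel t = g x * √(2 * Real.pi) := by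
    simp only [sub_mul]
    rw [integral_sub (integrable_gaussKernel.const_mul _) hi, h0, integral_const_mul,
      integral_gaussKernel, sub_zero]
  have h2 : |∫ t, (g x - g t) * gaussKernel t| ≤
      ∫ t, (L * x * gaussKernel t + L * (|t| * gaussKernel t)) := by
    rw [← Real.norm_eq_abs]
    refine norm_integral_le_of_norm_le ((integrable_gaussKernel.const_mul _).add
      (integrable_abs_mul_gaussKernel.const_mul _)) (Filter.Eventually.of_forall fun t => ?_)
    rw [Real.norm_eq_abs, abs_mul, abs_of_pos (gaussKernel_pos t)]
    have := hL x t
    have h3 : |x - t| ≤ x + |t| := by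
      have := abs_sub x t; rwa [abs_of_nonneg hx] at this
    have h4 : |g x - g t| ≤ L * (x + |t|) := this.trans (mul_le_mul_of_nonneg_left h3 hL0)
    calc |g x - g t| * gaussKernel t ≤ L * (x + |t|) * gaussKernel t :=
          mul_le_mul_of_nonneg_right h4 (gaussKernel_pos t).le
      _ = _ := by ring
  rw [h1, integral_add (integrable_gaussKernel.const_mul _)
    (integrable_abs_mul_gaussKernel.const_mul _), integral_const_mul, integral_const_mul,
    integral_gaussKernel, integral_abs_mul_gaussKernel, abs_mul, abs_of_nonneg (Real.sqrt_nonneg _)]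
    at h2
  have h5 : 2 ≤ √(2 * Real.pi) := by
    apply Real.le_sqrt_of_sq_le
    have := Real.pi_gt_three; norm_num; linarith
  have h6 : |g x| * √(2 * Real.pi) ≤ L * (x + 1) * √(2 * Real.pi) := by nlinarith
  exact le_of_mul_le_mul_right h6 (by linarith)

/-- The tail form of the solution of Stein's equation, with right-hand side `g`. -/
noncomputable def steinTail (g : ℝ → ℝ) (x : ℝ) : ℝ :=
  (gaussKernel x)⁻¹ * ∫ t in Set.Ioi x, g t * gaussKernel t

theorem abs_integral_Ioi_le (hC : ∀ x, |g x| ≤ C) (x : ℝ) :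
    |∫ t in Set.Ioi x, g t * gaussKernel t| ≤ C * gaussTail x := by
  rw [gaussTail, ← integral_const_mul, ← Real.norm_eq_abs]
  refine norm_integral_le_of_norm_le (integrable_gaussKernel.const_mul _).integrableOn
    (Filter.Eventually.of_forall fun t => ?_)
  rw [Real.norm_eq_abs, abs_mul, abs_of_pos (gaussKernel_pos t)]
  exact mul_le_mul_of_nonneg_right (hC t) (gaussKernel_pos t).le

theorem abs_mul_steinTail_le (hC : ∀ x, |g x| ≤ C) {x : ℝ} (hx : 0 ≤ x) :
    |x * steinTail g x| ≤ C := by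
  have hC0 : 0 ≤ C := (abs_nonneg _).trans (hC 0)
  have hp := gaussKernel_pos x
  rw [steinTail, abs_mul, abs_mul, abs_of_nonneg hx, abs_of_pos (inv_pos.2 hp)]
  have h1 := abs_integral_Ioi_le hC x
  have h2 := mul_gaussTail_le x
  calc x * ((gaussKernel x)⁻¹ * |∫ t in Set.Ioi x, g t * gaussKernel t|)
      ≤ x * ((gaussKernel x)⁻¹ * (C * gaussTail x)) := by gcongr
    _ = C * (gaussKernel x)⁻¹ * (x * gaussTail x) := by ring
    _ ≤ C * (gaussKernel x)⁻¹ * gaussKernel x := by gcongr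
    _ = C := by field_simp

/-- The quantity is the derivative of `x * steinTail g x`. Splitting `g t = g x + (g t - g x)` in
the tail integral leaves `g x`, of size `L (x + 1)`, times the Mills defect `K`, and a remainder `J`
controlled by the Lipschitz constant. They contribute at most `2.3 L` and `L`. -/
theorem abs_steinTail_deriv_le (hgc : Continuous g) (hC : ∀ x, |g x| ≤ C)
    (hL : ∀ x y, |g x - g y| ≤ L * |x - y|) (h0 : ∫ t, g t * gaussKernel t = 0)
    {x : ℝ} (hx : 0 ≤ x) : |(1 + x ^ 2) * steinTail g x - x * g x| ≤ 4 * L := by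
  have hL0 : 0 ≤ L := by
    have := (abs_nonneg _).trans (hL 1 0); simpa using this
  have hp := gaussKernel_pos x
  have hi := integrable_mul_gaussKernel hgc hC
  set J := ∫ t in Set.Ioi x, (g t - g x) * gaussKernel t with hJ
  have hsplit : ∫ t in Set.Ioi x, g t * gaussKernel t = g x * gaussTail x + J := by
    rw [hJ]
    simp only [sub_mul]
    rw [integral_sub hi.integrableOn (integrable_gaussKernel.const_mul _).integrableOn,
      integral_const_mul, gaussTail]
    ring
  have hJle : |J| ≤ L * (gaussKernel x - x * gaussTail x) := by
    rw [hJ, ← integral_Ioi_sub_mul_gaussKernel, ← integral_const_mul, ← Real.norm_eq_abs]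
    have hint : Integrable fun t => L * ((t - x) * gaussKernel t) := by
      simp only [sub_mul]
      exact (integrable_id_mul_gaussKernel.sub (integrable_gaussKernel.const_mul _)).const_mul _
    refine norm_integral_le_of_norm_le hint.integrableOn ?_
    filter_upwards [ae_restrict_mem measurableSet_Ioi] with t ht
    have ht : x < t := ht
    rw [Real.norm_eq_abs, abs_mul, abs_of_pos (gaussKernel_pos t), ← mul_assoc]
    have := hL t x
    rw [abs_of_pos (sub_pos.2 ht)] at this
    exact mul_le_mul_of_nonneg_right this (gaussKernel_pos t).le
  have hg := abs_le_of_centered hgc hC hL h0 hx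
  set K := (1 + x ^ 2) * gaussTail x - x * gaussKernel x with hK
  have hK0 : 0 ≤ K := by have := le_one_add_sq_mul_gaussTail x; linarith
  have h1 := mul_gaussTail_le x
  have hKle : (x + 1) * K ≤ 2.3 * gaussKernel x := by
    -- For `x ≥ 0.8`, `x K ≤ φ` gives `(x + 1) K ≤ (1 + 1/0.8) φ = 2.25 φ`; below, `gaussTail_le` is
    -- used.
    rcases le_total x 0.8 with h | h
    · have h2 := gaussTail_le hx
      have h3 : K ≤ (1.26 * (1 + x ^ 2) - x) * gaussKernel x := by nlinarith [sq_nonneg x]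
      have h4 : (x + 1) * (1.26 * (1 + x ^ 2) - x) ≤ 2.3 := by nlinarith [mul_nonneg hx hx]
      nlinarith
    · have h3 : x * K ≤ gaussKernel x := by
        have : x * K = (1 + x ^ 2) * (x * gaussTail x) - x ^ 2 * gaussKernel x := by
          rw [hK]; ring
        rw [this]; nlinarith [sq_nonneg x]
      have h4 : 0.8 * K ≤ gaussKernel x := by nlinarith
      linarith
  have hJ2 : (1 + x ^ 2) * |J| ≤ L * gaussKernel x := by
    have h2 := le_one_add_sq_mul_gaussTail x
    have h3 : (1 + x ^ 2) * (gaussKernel x - x * gaussTail x) ≤ gaussKernel x := by nlinarith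
    calc (1 + x ^ 2) * |J| ≤ (1 + x ^ 2) * (L * (gaussKernel x - x * gaussTail x)) := by gcongr
      _ = L * ((1 + x ^ 2) * (gaussKernel x - x * gaussTail x)) := by ring
      _ ≤ _ := by gcongr
  have e : (1 + x ^ 2) * steinTail g x - x * g x =
      (gaussKernel x)⁻¹ * (g x * K + (1 + x ^ 2) * J) := by
    rw [steinTail, hsplit, hK]; field_simp; ring
  rw [e, abs_mul, abs_of_pos (inv_pos.2 hp), inv_mul_le_iff₀ hp]
  calc |g x * K + (1 + x ^ 2) * J| ≤ |g x| * K + (1 + x ^ 2) * |J| := by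
        refine (abs_add_le _ _).trans ?_
        rw [abs_mul, abs_mul, abs_of_nonneg hK0, abs_of_nonneg (by positivity : 0 ≤ 1 + x ^ 2)]
    _ ≤ L * (x + 1) * K + L * gaussKernel x := by gcongr
    _ ≤ gaussKernel x * (4 * L) := by nlinarith

/-- Since the total integral vanishes, the right tail is minus the left one. This reduces `x ≤ 0` to
`x ≥ 0`. -/
theorem steinTail_neg (hgc : Continuous g) (hC : ∀ x, |g x| ≤ C)
    (h0 : ∫ t, g t * gaussKernel t = 0) (x : ℝ) :
    steinTail g x = -steinTail (fun t => g (-t)) (-x) := by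
  have hi := integrable_mul_gaussKernel hgc hC
  have h1 := integral_comp_neg_Ioi (-x) (fun t => g t * gaussKernel t)
  have h2 := intervalIntegral.integral_Iic_add_Ioi (b := x) hi.integrableOn hi.integrableOn
  simp only [gaussKernel_neg, neg_neg] at h1
  rw [steinTail, steinTail, gaussKernel_neg, h1]
  rw [h0] at h2
  rw [← mul_neg]; congr 1; linarith

theorem hasDerivAt_steinTail (hgc : Continuous g) (hC : ∀ x, |g x| ≤ C) (x : ℝ) :
    HasDerivAt (steinTail g) (x * steinTail g x - g x) x := by
  have hi := integrable_mul_gaussKernel hgc hC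
  have hcont : Continuous fun t => g t * gaussKernel t := hgc.mul continuous_gaussKernel
  have e : ∀ y, ∫ t in Set.Ioi y, g t * gaussKernel t =
      (∫ t in Set.Ioi 0, g t * gaussKernel t) - ∫ t in (0 : ℝ)..y, g t * gaussKernel t := by
    intro y
    rw [← intervalIntegral.integral_Ioi_sub_Ioi' hi.integrableOn hi.integrableOn]; ring
  have h1 : HasDerivAt (fun y => ∫ t in Set.Ioi y, g t * gaussKernel t)
      (-(g x * gaussKernel x)) x := by
    rw [funext e]
    simpa using (hasDerivAt_const x (∫ t in Set.Ioi 0, g t * gaussKernel t)).fun_sub (intervalIntegral.integral_hasDerivAt_right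
      (hcont.intervalIntegrable 0 x) (hcont.stronglyMeasurableAtFilter _ _) hcont.continuousAt)
  have h2 := ((hasDerivAt_gaussKernel x).inv (gaussKernel_pos x).ne').mul h1
  refine h2.congr_deriv ?_
  have := (gaussKernel_pos x).ne'
  simp only [steinTail, Pi.inv_apply]
  field_simp
  ring

/-- Solutions of Stein's equation `f' x - x f x = g x`, for bounded Lipschitz `g` of mean zero. -/
theorem exists_stein_solution (hgc : Continuous g) (hC : ∀ x, |g x| ≤ C)
    (hL : ∀ x y, |g x - g y| ≤ L * |x - y|) (h0 : ∫ t, g t * gaussKernel t = 0) :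
    ∃ f f' : ℝ → ℝ, (∀ x, HasDerivAt f (f' x) x) ∧ (∀ x, f' x - x * f x = g x) ∧
      (∀ x, |f' x| ≤ 2 * C) ∧ ∀ x y, |f' x - f' y| ≤ 5 * L * |x - y| := by
  have hgc' : Continuous fun t => g (-t) := hgc.comp continuous_neg
  have hC' : ∀ x, |g (-x)| ≤ C := fun x => hC _
  have hL' : ∀ x y, |g (-x) - g (-y)| ≤ L * |x - y| := fun x y => by
    have := hL (-x) (-y)
    rwa [show -x - -y = -(x - y) by ring, abs_neg] at this
  have h0' : ∫ t, g (-t) * gaussKernel t = 0 := by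
    have := integral_neg_eq_self (fun t => g t * gaussKernel t) (volume : Measure ℝ)
    simp only [gaussKernel_neg] at this
    rw [this, h0]
  have b1 : ∀ x, |x * steinTail g x| ≤ C := by
    intro x
    rcases le_total 0 x with h | h
    · exact abs_mul_steinTail_le hC h
    · have := abs_mul_steinTail_le hC' (neg_nonneg.2 h)
      rw [steinTail_neg hgc hC h0]
      rwa [neg_mul, ← mul_neg] at this
  have b2 : ∀ x, |(1 + x ^ 2) * steinTail g x - x * g x| ≤ 4 * L := by
    intro x
    rcases le_total 0 x with h | h
    · exact abs_steinTail_deriv_le hgc hC hL h0 h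
    · have := abs_steinTail_deriv_le hgc' hC' hL' h0' (neg_nonneg.2 h)
      rw [steinTail_neg hgc hC h0, ← abs_neg]
      convert this using 2
      simp only [neg_neg]; ring
  have hd := hasDerivAt_steinTail hgc hC
  -- The constants are `C + C` for `f'` and `L + 4L` for its Lipschitz bound, one part from `g` and
  -- one from `x * steinTail g x`.
  refine ⟨fun x => -steinTail g x, fun x => g x - x * steinTail g x, fun x => ?_, fun x => ?_,
    fun x => ?_, fun x y => ?_⟩
  · exact (hd x).neg.congr_deriv (by ring)
  · ring
  · have h1 := abs_sub (g x) (x * steinTail g x)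
    have h2 := hC x
    have h3 := b1 x
    linarith
  · have hlip : |x * steinTail g x - y * steinTail g y| ≤ 4 * L * |x - y| := by
      have hder : ∀ z, HasDerivAt (fun z => z * steinTail g z)
          ((1 + z ^ 2) * steinTail g z - z * g z) z := by
        intro z
        exact ((hasDerivAt_id z).mul (hd z)).congr_deriv (by simp only [id]; ring)
      have := Convex.norm_image_sub_le_of_norm_hasDerivWithin_le (s := Set.univ) (x := y) (y := x)
        (fun z _ => (hder z).hasDerivWithinAt) (fun z _ => b2 z) convex_univ trivial trivial
      simpa using this
    have h1 := hL x y
    calc |g x - x * steinTail g x - (g y - y * steinTail g y)|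
        = |(g x - g y) - (x * steinTail g x - y * steinTail g y)| := by congr 1; ring
      _ ≤ |g x - g y| + |x * steinTail g x - y * steinTail g y| := abs_sub _ _
      _ ≤ 5 * L * |x - y| := by linarith

end Stein

/-! ### Even signed permutations and the simple reflections. -/

section Signed

/-- The smaller of the two entries exchanged by the `i`-th generator. -/
def genLo (i : ℕ) : ℤ := if i = 0 then -1 else i

/-- The larger of the two entries exchanged by the `i`-th generator. -/
def genHi (i : ℕ) : ℤ := if i = 0 then 2 else i + 1

/-- The `i`-th generator, as a permutation of `ℤ`. -/
def genPerm (i : ℕ) : Equiv.Perm ℤ :=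
  Equiv.swap (genLo i) (genHi i) * Equiv.swap (-genLo i) (-genHi i)

theorem genLo_zero : genLo 0 = -1 := rfl
theorem genHi_zero : genHi 0 = 2 := rfl

theorem genLo_of_pos {i : ℕ} (hi : 1 ≤ i) : genLo i = i := by
  simp [genLo]; omega

theorem genHi_of_pos {i : ℕ} (hi : 1 ≤ i) : genHi i = i + 1 := by
  simp [genHi]; omega

theorem genLo_genHi_cases (i : ℕ) :
    (i = 0 ∧ genLo i = -1 ∧ genHi i = 2) ∨ (1 ≤ i ∧ genLo i = i ∧ genHi i = i + 1) := by
  rcases Nat.eq_zero_or_pos i with h | h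
  · subst h; exact Or.inl ⟨rfl, rfl, rfl⟩
  · exact Or.inr ⟨h, genLo_of_pos h, genHi_of_pos h⟩

theorem genPerm_apply (i : ℕ) (z : ℤ) : genPerm i z =
    if z = genLo i then genHi i else if z = genHi i then genLo i else
    if z = -genLo i then -genHi i else if z = -genHi i then -genLo i else z := by
  have := genLo_genHi_cases i
  simp only [genPerm, Equiv.Perm.mul_apply, Equiv.swap_apply_def]
  split_ifs <;> omega

theorem genPerm_genPerm (i : ℕ) (z : ℤ) : genPerm i (genPerm i z) = z := by
  have := genLo_genHi_cases i
  simp only [genPerm_apply]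
  split_ifs <;> omega

theorem genPerm_neg (i : ℕ) (z : ℤ) : genPerm i (-z) = -genPerm i z := by
  have := genLo_genHi_cases i
  simp only [genPerm_apply]
  split_ifs <;> omega

/-- A simple reflection permutes the positive roots other than its own. Pairs `(-y, y)` must be
excluded, since they are no roots of type `D` and `s_0` reverses `(-1, 1)`. -/
theorem genPerm_lt {i : ℕ} {x y : ℤ} (hx : x ≠ 0) (hy : y ≠ 0) (hxy : x < y) (hne : x ≠ -y)
    (h1 : ¬(x = genLo i ∧ y = genHi i)) (h2 : ¬(x = -genHi i ∧ y = -genLo i)) :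
    genPerm i x < genPerm i y := by
  have := genLo_genHi_cases i
  simp only [genPerm_apply]
  split_ifs <;> omega

theorem genPerm_mem {n i : ℕ} (hn : 2 ≤ n) (hi : i < n) {z : ℤ} (hz : z ≠ 0) (h1 : -(n : ℤ) ≤ z)
    (h2 : z ≤ n) : genPerm i z ≠ 0 ∧ -(n : ℤ) ≤ genPerm i z ∧ genPerm i z ≤ n := by
  have := genLo_genHi_cases i
  simp only [genPerm_apply]
  split_ifs <;> omega

variable {n : ℕ}

theorem mem_signed {z : ℤ} : z ∈ (Finset.Icc (-(n : ℤ)) n).erase 0 ↔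
    z ≠ 0 ∧ -(n : ℤ) ≤ z ∧ z ≤ n := by
  simp

/-- The action of an even signed permutation on `ℤ`, trivial outside `[±n]`. -/
noncomputable def ev : evenSignedPerm n →* Equiv.Perm ℤ :=
  Equiv.Perm.ofSubtype.comp (evenSignedPerm n).subtype

theorem ev_of_mem (w : evenSignedPerm n) {z : ℤ} (hz : z ∈ (Finset.Icc (-(n : ℤ)) n).erase 0) :
    ev w z = ((w : Equiv.Perm (SignedIndex n)) ⟨z, hz⟩).1 :=
  Equiv.Perm.ofSubtype_apply_of_mem _ hz

theorem ev_coe (w : evenSignedPerm n) (x : SignedIndex n) :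
    ev w x.1 = ((w : Equiv.Perm (SignedIndex n)) x).1 := ev_of_mem w x.2

theorem ev_of_notMem (w : evenSignedPerm n) {z : ℤ}
    (hz : z ∉ (Finset.Icc (-(n : ℤ)) n).erase 0) : ev w z = z :=
  Equiv.Perm.ofSubtype_apply_of_not_mem _ hz

theorem ev_injective : Function.Injective (ev : evenSignedPerm n → Equiv.Perm ℤ) :=
  Equiv.Perm.ofSubtype_injective.comp Subtype.val_injective

theorem ev_mem (w : evenSignedPerm n) {z : ℤ} (hz : z ≠ 0) (h1 : -(n : ℤ) ≤ z) (h2 : z ≤ n) :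
    ev w z ≠ 0 ∧ -(n : ℤ) ≤ ev w z ∧ ev w z ≤ n := by
  rw [ev_of_mem w (mem_signed.2 ⟨hz, h1, h2⟩)]
  exact mem_signed.1 (Subtype.prop _)

theorem ev_neg (w : evenSignedPerm n) (z : ℤ) : ev w (-z) = -ev w z := by
  by_cases hz : z ∈ (Finset.Icc (-(n : ℤ)) n).erase 0
  · have hw := w.2.1 ⟨z, hz⟩
    have := congrArg Subtype.val hw
    rw [ev_of_mem w hz]
    exact (ev_coe w (SignedIndex.neg ⟨z, hz⟩)).trans this
  · rw [ev_of_notMem w hz, ev_of_notMem]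
    rw [mem_signed] at hz ⊢
    omega

theorem ev_inv_apply (w : evenSignedPerm n) (z : ℤ) : ev w⁻¹ (ev w z) = z := by
  rw [map_inv]; simp

theorem ev_apply_inv (w : evenSignedPerm n) (z : ℤ) : ev w (ev w⁻¹ z) = z := by
  rw [map_inv]; simp

theorem ev_mul_apply (w v : evenSignedPerm n) (z : ℤ) : ev (w * v) z = ev w (ev v z) := by
  rw [map_mul]; rfl

theorem ev_inj (w : evenSignedPerm n) {x y : ℤ} : ev w x = ev w y ↔ x = y :=
  (ev w).injective.eq_iff

theorem even_card_neg (w : evenSignedPerm n) :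
    Even ((Finset.Icc (1 : ℤ) n).filter fun z => ev w z < 0).card := by
  have h := w.2.2
  convert h using 1
  symm
  refine Finset.card_bij (fun x _ => x.1) ?_ ?_ ?_
  · intro x hx
    have h1 := mem_signed.1 x.2
    simp only [Finset.mem_filter, Finset.mem_univ, true_and] at hx
    simp only [Finset.mem_filter, Finset.mem_Icc, ev_coe]
    omega
  · intro x _ y _ hxy
    exact Subtype.ext hxy
  · intro z hz
    simp only [Finset.mem_filter, Finset.mem_Icc] at hz
    refine ⟨⟨z, mem_signed.2 (by omega)⟩, ?_, rfl⟩
    simp only [Finset.mem_filter, Finset.mem_univ, true_and, ← ev_coe]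
    exact ⟨by omega, hz.2⟩

theorem exists_ev_genPerm (hn : 2 ≤ n) {i : ℕ} (hi : i < n) :
    ∃ s : evenSignedPerm n, ev s = genPerm i ∧
      ∃ a b : SignedIndex n, a.1 = genLo i ∧ b.1 = genHi i ∧
      (s : Equiv.Perm (SignedIndex n)) = Equiv.swap a b * Equiv.swap a.neg b.neg := by
  have hc := genLo_genHi_cases i
  let a : SignedIndex n := ⟨genLo i, mem_signed.2 (by omega)⟩
  let b : SignedIndex n := ⟨genHi i, mem_signed.2 (by omega)⟩
  let σ : Equiv.Perm (SignedIndex n) := Equiv.swap a b * Equiv.swap a.neg b.neg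
  have hσ : ∀ x : SignedIndex n, (σ x).1 = genPerm i x.1 := by
    intro x
    simp only [σ, genPerm, Equiv.Perm.mul_apply]
    have key : ∀ c d y : SignedIndex n, (Equiv.swap c d y).1 = Equiv.swap c.1 d.1 y.1 := by
      intro c d y
      simp only [Equiv.swap_apply_def, Subtype.ext_iff]
      split_ifs <;> rfl
    rw [key, key]; rfl
  have hmem : σ ∈ evenSignedPerm n := by
    refine ⟨fun x => Subtype.ext ?_, ?_⟩
    · rw [hσ]
      change genPerm i (-x.1) = -(σ x).1
      rw [hσ, genPerm_neg]
    · have hcard : negCount σ = ((Finset.Icc (1 : ℤ) n).filter fun z => genPerm i z < 0).card := by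
        refine Finset.card_bij (fun x _ => x.1) ?_ (fun x _ y _ h => Subtype.ext h) ?_
        · intro x hx
          have h1 := mem_signed.1 x.2
          simp only [Finset.mem_filter, Finset.mem_univ, true_and, hσ] at hx
          simp only [Finset.mem_filter, Finset.mem_Icc]
          omega
        · intro z hz
          simp only [Finset.mem_filter, Finset.mem_Icc] at hz
          refine ⟨⟨z, mem_signed.2 (by omega)⟩, ?_, rfl⟩
          simp only [Finset.mem_filter, Finset.mem_univ, true_and, hσ]
          exact ⟨by omega, hz.2⟩
      rw [hcard]
      rcases hc with ⟨h0, h1, h2⟩ | ⟨h0, h1, h2⟩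
      · have : (Finset.Icc (1 : ℤ) n).filter (fun z => genPerm i z < 0) = {1, 2} := by
          ext z
          simp only [Finset.mem_filter, Finset.mem_Icc, Finset.mem_insert,
            Finset.mem_singleton, genPerm_apply, h1, h2]
          split_ifs <;> omega
        rw [this]; decide
      · have : (Finset.Icc (1 : ℤ) n).filter (fun z => genPerm i z < 0) = ∅ := by
          ext z
          simp only [Finset.mem_filter, Finset.mem_Icc, Finset.notMem_empty, iff_false,
            genPerm_apply, h1, h2]
          split_ifs <;> omega
        rw [this]; simp
  refine ⟨⟨σ, hmem⟩, ?_, a, b, rfl, rfl, rfl⟩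
  ext z
  by_cases hz : z ∈ (Finset.Icc (-(n : ℤ)) n).erase 0
  · rw [ev_of_mem _ hz]; exact hσ _
  · rw [ev_of_notMem _ hz]
    rw [mem_signed] at hz
    rw [genPerm_apply]
    split_ifs <;> omega

open Classical in
/-- The `i`-th generator of `D_n` (the identity for `i` out of range). -/
noncomputable def gen (n i : ℕ) : evenSignedPerm n :=
  if h : 2 ≤ n ∧ i < n then (exists_ev_genPerm h.1 h.2).choose else 1

theorem ev_gen (hn : 2 ≤ n) {i : ℕ} (hi : i < n) : ev (gen n i) = genPerm i := by
  rw [gen, dif_pos ⟨hn, hi⟩]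
  exact (exists_ev_genPerm hn hi).choose_spec.1

theorem gen_mul_gen (hn : 2 ≤ n) {i : ℕ} (hi : i < n) : gen n i * gen n i = 1 := by
  apply ev_injective
  ext z
  rw [ev_mul_apply, ev_gen hn hi, genPerm_genPerm]; simp

theorem gen_inv (hn : 2 ≤ n) {i : ℕ} (hi : i < n) : (gen n i)⁻¹ = gen n i :=
  inv_eq_of_mul_eq_one_left (gen_mul_gen hn hi)

theorem typeDGenerators_eq (hn : 2 ≤ n) :
    typeDGenerators n = (gen n) '' (Finset.range n : Set ℕ) := by
  ext s
  simp only [typeDGenerators, Set.mem_ofPred_eq, Finset.coe_range, Set.mem_image, Set.mem_Iio]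
  constructor
  · rintro ⟨a, b, hab, hs⟩
    have ha := mem_signed.1 a.2
    have hb := mem_signed.1 b.2
    have hi : ∃ i : ℕ, i < n ∧ genLo i = a.1 ∧ genHi i = b.1 := by
      rcases hab with h | h
      · refine ⟨a.1.toNat, by omega, ?_⟩
        rw [genLo_of_pos (by omega), genHi_of_pos (by omega)]; omega
      · exact ⟨0, by omega, by rw [genLo_zero]; omega, by rw [genHi_zero]; omega⟩
    obtain ⟨i, hi, h1, h2⟩ := hi
    refine ⟨i, hi, ?_⟩
    rw [gen, dif_pos ⟨hn, hi⟩]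
    obtain ⟨-, a', b', h3, h4, h5⟩ := (exists_ev_genPerm hn hi).choose_spec
    apply Subtype.ext
    rw [hs, h5, Subtype.ext (h3.trans h1), Subtype.ext (h4.trans h2)]
  · rintro ⟨i, hi, rfl⟩
    rw [gen, dif_pos ⟨hn, hi⟩]
    obtain ⟨-, a, b, h3, h4, h5⟩ := (exists_ev_genPerm hn hi).choose_spec
    refine ⟨a, b, ?_, h5⟩
    have := genLo_genHi_cases i
    omega

theorem gen_injOn (hn : 2 ≤ n) : Set.InjOn (gen n) (Finset.range n : Set ℕ) := by
  intro i hi j hj h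
  simp only [Finset.coe_range, Set.mem_Iio] at hi hj
  have h1 : genPerm i (genLo i) = genPerm j (genLo i) := by
    rw [← ev_gen hn hi, ← ev_gen hn hj, h]
  have hci := genLo_genHi_cases i
  have hcj := genLo_genHi_cases j
  simp only [genPerm_apply] at h1
  split_ifs at h1 <;> omega

/-! ### Inversions, length and descents in type `D`. -/

/-- The pairs `(x, y)` in `[±n]` with `x < y` and `x ≠ -y`; each positive root of type `D`
appears twice. -/
noncomputable def rootPairs (n : ℕ) : Finset (ℤ × ℤ) :=
  ((Finset.Icc (-(n : ℤ)) n).erase 0 ×ˢ (Finset.Icc (-(n : ℤ)) n).erase 0).filter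
    fun z => z.1 < z.2 ∧ z.1 ≠ -z.2

theorem mem_rootPairs {x y : ℤ} : (x, y) ∈ rootPairs n ↔
    (x ≠ 0 ∧ -(n : ℤ) ≤ x ∧ x ≤ n) ∧ (y ≠ 0 ∧ -(n : ℤ) ≤ y ∧ y ≤ n) ∧ x < y ∧ x ≠ -y := by
  simp only [rootPairs, Finset.mem_filter, Finset.mem_product, mem_signed]
  tauto

/-- Twice the number of inversions of type `D`. -/
noncomputable def invCount (w : evenSignedPerm n) : ℕ :=
  ((rootPairs n).filter fun z => ev w z.2 < ev w z.1).card

/-- `w` has a right descent at the `i`-th generator. -/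
def IsDesc (i : ℕ) (w : evenSignedPerm n) : Prop := ev w (genHi i) < ev w (genLo i)

noncomputable instance (i : ℕ) (w : evenSignedPerm n) : Decidable (IsDesc i w) := by
  unfold IsDesc; infer_instance

theorem ev_mul_gen (hn : 2 ≤ n) {i : ℕ} (hi : i < n) (w : evenSignedPerm n) (z : ℤ) :
    ev (w * gen n i) z = ev w (genPerm i z) := by
  rw [ev_mul_apply, ev_gen hn hi]

theorem genPerm_genLo (i : ℕ) : genPerm i (genLo i) = genHi i := by
  simp [genPerm_apply]

theorem genPerm_genHi (i : ℕ) : genPerm i (genHi i) = genLo i := by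
  have := genLo_genHi_cases i
  simp only [genPerm_apply]; split_ifs <;> omega

theorem isDesc_mul_gen (hn : 2 ≤ n) {i : ℕ} (hi : i < n) (w : evenSignedPerm n) :
    IsDesc i (w * gen n i) ↔ ¬IsDesc i w := by
  have hc := genLo_genHi_cases i
  have : ev w (genLo i) ≠ ev w (genHi i) := by rw [Ne, ev_inj]; omega
  rw [IsDesc, IsDesc, ev_mul_gen hn hi, ev_mul_gen hn hi, genPerm_genLo, genPerm_genHi]
  omega

/-- The inversions of `w` other than those at the `i`-th simple root. -/
noncomputable def restInv (i : ℕ) (w : evenSignedPerm n) : ℕ :=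
  (((rootPairs n \ {(genLo i, genHi i), (-genHi i, -genLo i)})).filter
    fun z => ev w z.2 < ev w z.1).card

theorem invCount_eq (hn : 2 ≤ n) {i : ℕ} (hi : i < n) (w : evenSignedPerm n) :
    invCount w = restInv i w + if IsDesc i w then 2 else 0 := by
  have hc := genLo_genHi_cases i
  set T : Finset (ℤ × ℤ) := {(genLo i, genHi i), (-genHi i, -genLo i)} with hT
  have hsub : T ⊆ rootPairs n := by
    intro z hz
    simp only [hT, Finset.mem_insert, Finset.mem_singleton] at hz
    rcases hz with rfl | rfl <;> rw [mem_rootPairs] <;> omega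
  have h1 : (T.filter fun z => ev w z.2 < ev w z.1).card = if IsDesc i w then 2 else 0 := by
    have hne : (genLo i, genHi i) ≠ (-genHi i, -genLo i) := by
      simp only [Ne, Prod.mk.injEq]; omega
    split_ifs with h
    · rw [Finset.filter_true_of_mem, hT, Finset.card_pair hne]
      intro z hz
      simp only [hT, Finset.mem_insert, Finset.mem_singleton] at hz
      unfold IsDesc at h
      rcases hz with rfl | rfl
      · exact h
      · simp only [ev_neg]; omega
    · rw [Finset.filter_false_of_mem, Finset.card_empty]
      intro z hz
      simp only [hT, Finset.mem_insert, Finset.mem_singleton] at hz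
      unfold IsDesc at h
      rcases hz with rfl | rfl
      · exact h
      · simp only [ev_neg]; omega
  rw [← h1, invCount, restInv, ← Finset.card_union_of_disjoint, ← Finset.filter_union,
    Finset.sdiff_union_of_subset hsub]
  exact Finset.disjoint_filter_filter Finset.sdiff_disjoint

/-- By `genPerm_lt`, `(x, y) ↦ (s_i x, s_i y)` permutes the remaining pairs, and it matches the
inversions of `w` with those of `w s_i`. -/
theorem restInv_mul_gen (hn : 2 ≤ n) {i : ℕ} (hi : i < n) (w : evenSignedPerm n) :
    restInv i (w * gen n i) = restInv i w := by
  have hc := genLo_genHi_cases i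
  have hmaps : ∀ v : evenSignedPerm n, ∀ z ∈ ((rootPairs n \
      {(genLo i, genHi i), (-genHi i, -genLo i)})).filter fun z => ev v z.2 < ev v z.1,
      (genPerm i z.1, genPerm i z.2) ∈ ((rootPairs n \
      {(genLo i, genHi i), (-genHi i, -genLo i)})).filter
        fun z => ev (v * gen n i) z.2 < ev (v * gen n i) z.1 := by
    rintro v ⟨x, y⟩ hz
    simp only [Finset.mem_filter, Finset.mem_sdiff, mem_rootPairs, Finset.mem_insert,
      Finset.mem_singleton, Prod.mk.injEq, not_or] at hz
    obtain ⟨⟨⟨hx, hy, hxy, hne⟩, h1, h2⟩, hv⟩ := hz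
    have hlt := genPerm_lt hx.1 hy.1 hxy hne h1 h2
    have hx' := genPerm_mem hn hi hx.1 hx.2.1 hx.2.2
    have hy' := genPerm_mem hn hi hy.1 hy.2.1 hy.2.2
    simp only [Finset.mem_filter, Finset.mem_sdiff, mem_rootPairs, Finset.mem_insert,
      Finset.mem_singleton, Prod.mk.injEq, not_or, ev_mul_gen hn hi, genPerm_genPerm]
    refine ⟨⟨⟨hx', hy', hlt, ?_⟩, ?_, ?_⟩, hv⟩
    · rw [← genPerm_neg]; intro h; exact hne ((genPerm i).injective h)
    · rintro ⟨e1, e2⟩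
      have e1' := congrArg (genPerm i) e1
      have e2' := congrArg (genPerm i) e2
      rw [genPerm_genPerm, genPerm_genLo] at e1'
      rw [genPerm_genPerm, genPerm_genHi] at e2'
      omega
    · rintro ⟨e1, e2⟩
      have e1' := congrArg (genPerm i) e1
      have e2' := congrArg (genPerm i) e2
      rw [genPerm_genPerm, genPerm_neg, genPerm_genHi] at e1'
      rw [genPerm_genPerm, genPerm_neg, genPerm_genLo] at e2'
      omega
  rw [restInv, restInv]
  symm
  refine Finset.card_nbij' (fun z => (genPerm i z.1, genPerm i z.2))
    (fun z => (genPerm i z.1, genPerm i z.2)) (hmaps w) ?_ ?_ ?_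
  · intro z hz
    have := hmaps (w * gen n i) z hz
    rwa [mul_assoc, gen_mul_gen hn hi, mul_one] at this
  · intro z _; simp [genPerm_genPerm]
  · intro z _; simp [genPerm_genPerm]

theorem invCount_mul_gen (hn : 2 ≤ n) {i : ℕ} (hi : i < n) (w : evenSignedPerm n) :
    (IsDesc i w → invCount w = invCount (w * gen n i) + 2) ∧
      (¬IsDesc i w → invCount (w * gen n i) = invCount w + 2) := by
  have h1 := invCount_eq hn hi w
  have h2 := invCount_eq hn hi (w * gen n i)
  rw [restInv_mul_gen hn hi] at h2
  have h3 := isDesc_mul_gen hn hi w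
  constructor <;> intro h
  · rw [if_pos h] at h1; rw [if_neg (by tauto)] at h2; omega
  · rw [if_neg h] at h1; rw [if_pos (by tauto)] at h2; omega

theorem invCount_one : invCount (1 : evenSignedPerm n) = 0 := by
  rw [invCount, Finset.card_eq_zero, Finset.filter_eq_empty_iff]
  rintro ⟨x, y⟩ hz
  rw [mem_rootPairs] at hz
  simp only [map_one, Equiv.Perm.one_apply]
  omega

theorem eq_one_of_forall_not_isDesc (hn : 2 ≤ n) (w : evenSignedPerm n)
    (h : ∀ i < n, ¬IsDesc i w) : w = 1 := by
  have hstep : ∀ i : ℕ, 1 ≤ i → i < n → ev w i < ev w (i + 1) := by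
    intro i h1 h2
    have := h i h2
    rw [IsDesc, genLo_of_pos h1, genHi_of_pos h1] at this
    have : ev w i ≠ ev w (i + 1) := by rw [Ne, ev_inj]; omega
    omega
  have h0 : -ev w 1 < ev w 2 := by
    have h1 := h 0 (by omega)
    rw [IsDesc, genLo_zero, genHi_zero, ev_neg] at h1
    have : ev w 2 ≠ ev w (-1) := by rw [Ne, ev_inj]; omega
    rw [ev_neg] at this
    omega
  have h12 : ev w 1 < ev w 2 := by simpa using hstep 1 le_rfl (by omega)
  have hpos2 : ∀ k : ℕ, 2 ≤ k → k ≤ n → 0 < ev w k := by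
    intro k hk
    induction k, hk using Nat.le_induction with
    | base => intro _; push_cast; omega
    | succ k hk ih =>
      intro hkn
      have := hstep k (by omega) (by omega)
      have := ih (by omega)
      push_cast; omega
  have hpos1 : 0 < ev w 1 := by
    by_contra hneg
    have hne : ev w 1 ≠ 0 := (ev_mem w one_ne_zero (by omega) (by omega)).1
    -- Without descents `w 2, …, w n` are positive, so only position 1 could carry a negative value,
    -- and evenness forbids exactly one sign change.
    have : ((Finset.Icc (1 : ℤ) n).filter fun z => ev w z < 0) = {1} := by
      ext z
      simp only [Finset.mem_filter, Finset.mem_Icc, Finset.mem_singleton]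
      constructor
      · rintro ⟨hz, hz'⟩
        by_contra hz1
        have := hpos2 z.toNat (by omega) (by omega)
        rw [show ((z.toNat : ℕ) : ℤ) = z by omega] at this
        omega
      · rintro rfl; omega
    have h2 := even_card_neg w
    rw [this] at h2
    simp at h2
  have hge : ∀ k : ℕ, 1 ≤ k → k ≤ n → (k : ℤ) ≤ ev w k := by
    intro k hk
    induction k, hk using Nat.le_induction with
    | base => intro _; push_cast; omega
    | succ k hk ih =>
      intro hkn
      have := hstep k (by omega) (by omega)
      have := ih (by omega)
      push_cast; omega
  have hle : ∀ j k : ℕ, k + j = n → 1 ≤ k → ev w k ≤ k := by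
    intro j
    induction j with
    | zero =>
      intro k hk h1
      have := ev_mem w (z := k) (by omega) (by omega) (by omega)
      omega
    | succ j ih =>
      intro k hk h1
      have h2 := ih (k + 1) (by omega) (by omega)
      have := hstep k (by omega) (by omega)
      push_cast at h2; omega
  have heq : ∀ z : ℤ, 1 ≤ z → z ≤ n → ev w z = z := by
    intro z h1 h2
    have h3 := hge z.toNat (by omega) (by omega)
    have h4 := hle (n - z.toNat) z.toNat (by omega) (by omega)
    rw [show ((z.toNat : ℕ) : ℤ) = z by omega] at h3 h4
    omega
  apply ev_injective
  ext z
  rw [map_one, Equiv.Perm.one_apply]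
  by_cases hz : z ∈ (Finset.Icc (-(n : ℤ)) n).erase 0
  · rw [mem_signed] at hz
    rcases lt_or_gt_of_ne hz.1 with h1 | h1
    · have := heq (-z) (by omega) (by omega)
      rw [ev_neg] at this; omega
    · exact heq z (by omega) (by omega)
  · exact ev_of_notMem w hz

/-- The length function of `D_n` with respect to the Coxeter generators. -/
noncomputable def len (w : evenSignedPerm n) : ℕ := coxeterLength (typeDGenerators n) w

theorem gen_mem (hn : 2 ≤ n) {i : ℕ} (hi : i < n) : gen n i ∈ typeDGenerators n := by
  rw [typeDGenerators_eq hn]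
  exact ⟨i, by simpa using hi, rfl⟩

theorem exists_word (hn : 2 ≤ n) (k : ℕ) : ∀ w : evenSignedPerm n, invCount w = k →
    ∃ l : List (evenSignedPerm n), (∀ s ∈ l, s ∈ typeDGenerators n) ∧ l.prod = w ∧
      2 * l.length = invCount w := by
  induction k using Nat.strong_induction_on with
  | _ k ih =>
    intro w hw
    by_cases h : ∃ i < n, IsDesc i w
    · obtain ⟨i, hi, hd⟩ := h
      have h1 := (invCount_mul_gen hn hi w).1 hd
      obtain ⟨l, hl, hp, hlen⟩ := ih _ (by omega) (w * gen n i) rfl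
      refine ⟨l ++ [gen n i], ?_, ?_, ?_⟩
      · intro s hs
        rw [List.mem_append, List.mem_singleton] at hs
        rcases hs with hs | rfl
        · exact hl s hs
        · exact gen_mem hn hi
      · rw [List.prod_append, hp, List.prod_singleton, mul_assoc, gen_mul_gen hn hi, mul_one]
      · rw [List.length_append, List.length_singleton]; omega
    · push Not at h
      have := eq_one_of_forall_not_isDesc hn w h
      subst this
      exact ⟨[], by simp, rfl, by rw [invCount_one]; rfl⟩

theorem invCount_list_prod_le (hn : 2 ≤ n) (l : List (evenSignedPerm n))
    (hl : ∀ s ∈ l, s ∈ typeDGenerators n) : invCount l.prod ≤ 2 * l.length := by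
  induction l using List.reverseRecOn with
  | nil => simp [invCount_one]
  | append_singleton l s ih =>
    have h1 := ih fun t ht => hl t (by simp [ht])
    have h2 := hl s (by simp)
    rw [typeDGenerators_eq hn] at h2
    obtain ⟨i, hi, rfl⟩ := h2
    have hi : i < n := by simpa using hi
    rw [List.prod_append, List.prod_singleton, List.length_append, List.length_singleton]
    have h3 := invCount_mul_gen hn hi l.prod
    by_cases hd : IsDesc i l.prod
    · have := h3.1 hd; omega
    · have := h3.2 hd; omega

/-- Each letter changes `invCount` by exactly 2, so words cannot be too short; removing descents one
at a time produces a word that attains the bound. -/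
theorem invCount_eq_two_mul_len (hn : 2 ≤ n) (w : evenSignedPerm n) :
    invCount w = 2 * len w := by
  obtain ⟨l, hl, hp, hlen⟩ := exists_word hn _ w rfl
  have hmem : l.length ∈ {k : ℕ | ∃ l : List (evenSignedPerm n),
      (∀ s ∈ l, s ∈ typeDGenerators n) ∧ l.prod = w ∧ l.length = k} := ⟨l, hl, hp, rfl⟩
  have h1 : len w ≤ l.length := Nat.sInf_le hmem
  obtain ⟨l', hl', hp', hlen'⟩ := Nat.sInf_mem ⟨_, hmem⟩
  have h2 := invCount_list_prod_le hn l' hl'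
  rw [hp'] at h2
  have h3 : l'.length = len w := hlen'
  omega

theorem len_of_isDesc (hn : 2 ≤ n) {i : ℕ} (hi : i < n) {w : evenSignedPerm n}
    (h : IsDesc i w) : len w = len (w * gen n i) + 1 := by
  have := (invCount_mul_gen hn hi w).1 h
  rw [invCount_eq_two_mul_len hn, invCount_eq_two_mul_len hn] at this
  omega

theorem len_of_not_isDesc (hn : 2 ≤ n) {i : ℕ} (hi : i < n) {w : evenSignedPerm n}
    (h : ¬IsDesc i w) : len (w * gen n i) = len w + 1 := by
  have := (invCount_mul_gen hn hi w).2 h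
  rw [invCount_eq_two_mul_len hn, invCount_eq_two_mul_len hn] at this
  omega

theorem len_inv_le (hn : 2 ≤ n) (w : evenSignedPerm n) : len w⁻¹ ≤ len w := by
  obtain ⟨l, hl, hp, hlen⟩ := exists_word hn _ w rfl
  rw [invCount_eq_two_mul_len hn] at hlen
  refine (Nat.sInf_le ⟨(l.map (·⁻¹)).reverse, ?_, ?_, ?_⟩ : len w⁻¹ ≤ len w)
  · intro s hs
    simp only [List.mem_reverse, List.mem_map] at hs
    obtain ⟨t, ht, rfl⟩ := hs
    have h2 := hl t ht
    rw [typeDGenerators_eq hn] at h2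
    obtain ⟨i, hi, rfl⟩ := h2
    have hi : i < n := by simpa using hi
    rw [gen_inv hn hi]
    exact gen_mem hn hi
  · rw [← List.prod_inv_reverse, hp]
  · rw [List.length_reverse, List.length_map]; omega

theorem len_inv (hn : 2 ≤ n) (w : evenSignedPerm n) : len w⁻¹ = len w :=
  le_antisymm (len_inv_le hn w) (by simpa using len_inv_le hn w⁻¹)

theorem descentCount_eq (hn : 2 ≤ n) (w : evenSignedPerm n) :
    descentCount (typeDGenerators n) w = ((Finset.range n).filter fun i => IsDesc i w).card := by
  have : {s ∈ typeDGenerators n | coxeterLength (typeDGenerators n) (w * s) <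
      coxeterLength (typeDGenerators n) w} =
      gen n '' (((Finset.range n).filter fun i => IsDesc i w : Finset ℕ) : Set ℕ) := by
    ext s
    simp only [typeDGenerators_eq hn, Set.mem_ofPred_eq, Set.mem_image, Finset.coe_filter,
      Finset.mem_coe, Finset.mem_range]
    constructor
    · rintro ⟨⟨i, hi, rfl⟩, h⟩
      refine ⟨i, ⟨hi, ?_⟩, rfl⟩
      by_contra hd
      have := len_of_not_isDesc hn hi hd
      rw [← typeDGenerators_eq hn] at h
      unfold len at this
      omega
    · rintro ⟨i, ⟨hi, hd⟩, rfl⟩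
      refine ⟨⟨i, hi, rfl⟩, ?_⟩
      have := len_of_isDesc hn hi hd
      rw [← typeDGenerators_eq hn]
      unfold len at this
      omega
  rw [descentCount, this, Set.InjOn.ncard_image, Set.ncard_coe_finset]
  exact (gen_injOn hn).mono (Finset.coe_subset.2 (Finset.filter_subset _ _))

end Signed

/-! ### Integration by parts for the Mallows distribution, and Stein's method. -/

section Mean

variable {n : ℕ} {q : ℝ}

/-- The Mallows probability of `w`. -/
noncomputable def mprob (q : ℝ) (w : evenSignedPerm n) : ℝ :=
  q ^ len w / ∑ v : evenSignedPerm n, q ^ len v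

/-- The expectation of `F` under the Mallows distribution. -/
noncomputable def mean (q : ℝ) (F : evenSignedPerm n → ℝ) : ℝ := ∑ w, mprob q w * F w

theorem sum_pow_len_pos (hq : 0 < q) : 0 < ∑ v : evenSignedPerm n, q ^ len v :=
  Finset.sum_pos (fun _ _ => pow_pos hq _) Finset.univ_nonempty

theorem mprob_pos (hq : 0 < q) (w : evenSignedPerm n) : 0 < mprob q w :=
  div_pos (pow_pos hq _) (sum_pow_len_pos hq)

theorem sum_mprob (hq : 0 < q) : ∑ w : evenSignedPerm n, mprob q w = 1 := by
  simp only [mprob, ← Finset.sum_div]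
  exact div_self (sum_pow_len_pos hq).ne'

theorem mprob_inv (hn : 2 ≤ n) (w : evenSignedPerm n) : mprob q w⁻¹ = mprob q w := by
  rw [mprob, mprob, len_inv hn]

theorem mprob_of_isDesc (hn : 2 ≤ n) {i : ℕ} (hi : i < n) {w : evenSignedPerm n}
    (h : IsDesc i w) : mprob q w = q * mprob q (w * gen n i) := by
  rw [mprob, mprob, len_of_isDesc hn hi h, pow_succ]; ring

theorem mprob_of_not_isDesc (hn : 2 ≤ n) {i : ℕ} (hi : i < n) {w : evenSignedPerm n}
    (h : ¬IsDesc i w) : mprob q (w * gen n i) = q * mprob q w := by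
  rw [mprob, mprob, len_of_not_isDesc hn hi h, pow_succ]; ring

variable {F G : evenSignedPerm n → ℝ}

theorem mean_add (F G : evenSignedPerm n → ℝ) :
    mean q (fun w => F w + G w) = mean q F + mean q G := by
  simp only [mean, mul_add, Finset.sum_add_distrib]

theorem mean_sub (F G : evenSignedPerm n → ℝ) :
    mean q (fun w => F w - G w) = mean q F - mean q G := by
  simp only [mean, mul_sub, Finset.sum_sub_distrib]

theorem mean_const_mul (c : ℝ) (F : evenSignedPerm n → ℝ) :
    mean q (fun w => c * F w) = c * mean q F := by
  simp only [mean, Finset.mul_sum]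
  exact Finset.sum_congr rfl fun w _ => by ring

theorem mean_mul_const (c : ℝ) (F : evenSignedPerm n → ℝ) :
    mean q (fun w => F w * c) = mean q F * c := by
  simp only [mean, Finset.sum_mul]
  exact Finset.sum_congr rfl fun w _ => by ring

theorem mean_const (hq : 0 < q) (c : ℝ) : mean q (fun _ : evenSignedPerm n => c) = c := by
  simp only [mean, ← Finset.sum_mul, sum_mprob hq, one_mul]

theorem mean_sum {ι : Type*} (s : Finset ι) (f : ι → evenSignedPerm n → ℝ) :
    mean q (fun w => ∑ i ∈ s, f i w) = ∑ i ∈ s, mean q (f i) := by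
  simp only [mean, Finset.mul_sum]
  exact Finset.sum_comm

theorem mean_mono (hq : 0 < q) (h : ∀ w, F w ≤ G w) : mean q F ≤ mean q G :=
  Finset.sum_le_sum fun w _ => mul_le_mul_of_nonneg_left (h w) (mprob_pos hq w).le

theorem mean_nonneg (hq : 0 < q) (h : ∀ w, 0 ≤ F w) : 0 ≤ mean q F :=
  Finset.sum_nonneg fun w _ => mul_nonneg (mprob_pos hq w).le (h w)

theorem abs_mean_le (hq : 0 < q) (F : evenSignedPerm n → ℝ) :
    |mean q F| ≤ mean q fun w => |F w| := by
  refine (Finset.abs_sum_le_sum_abs _ _).trans (le_of_eq (Finset.sum_congr rfl fun w _ => ?_))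
  rw [abs_mul, abs_of_pos (mprob_pos hq w)]

theorem mean_le_of_le (hq : 0 < q) {c : ℝ} (h : ∀ w, F w ≤ c) : mean q F ≤ c :=
  (mean_mono hq h).trans (mean_const hq c).le

theorem mean_inv (hn : 2 ≤ n) (F : evenSignedPerm n → ℝ) :
    mean q (fun w => F w⁻¹) = mean q F := by
  simp only [mean]
  rw [← Equiv.sum_comp (Equiv.inv (evenSignedPerm n)) (fun w => mprob q w * F w)]
  exact Finset.sum_congr rfl fun w _ => by simp [mprob_inv hn]

theorem mean_mul_right (v : evenSignedPerm n) (F : evenSignedPerm n → ℝ) :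
    mean q F = ∑ w, mprob q (w * v) * F (w * v) :=
  (Equiv.sum_comp (Equiv.mulRight v) (fun w => mprob q w * F w)).symm

theorem mean_sq_le (hq : 0 < q) (F : evenSignedPerm n → ℝ) :
    mean q F ^ 2 ≤ mean q fun w => F w ^ 2 := by
  have h : 0 ≤ mean q fun w => (F w - mean q F) ^ 2 := mean_nonneg hq fun w => sq_nonneg _
  have e : (fun w => (F w - mean q F) ^ 2) =
      fun w => (F w ^ 2 - (2 * mean q F) * F w) + mean q F ^ 2 := by
    funext w; ring
  rw [e, mean_add, mean_sub, mean_const hq, mean_const_mul] at h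
  linarith

theorem mean_variance (hq : 0 < q) (F : evenSignedPerm n → ℝ) :
    mean q (fun w => (F w - mean q F) ^ 2) = mean q (fun w => F w ^ 2) - mean q F ^ 2 := by
  have e : (fun w => (F w - mean q F) ^ 2) =
      fun w => (F w ^ 2 - (2 * mean q F) * F w) + mean q F ^ 2 := by
    funext w; ring
  rw [e, mean_add, mean_sub, mean_const hq, mean_const_mul]
  ring

theorem mean_abs_sub_le_sqrt (hq : 0 < q) (F : evenSignedPerm n → ℝ) :
    mean q (fun w => |F w - mean q F|) ≤
      √(mean q (fun w => F w ^ 2) - mean q F ^ 2) := by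
  apply Real.le_sqrt_of_sq_le
  rw [← mean_variance hq]
  refine (mean_sq_le hq _).trans (le_of_eq ?_)
  simp only [sq_abs]

/-- The indicator of a right descent at the `i`-th generator. -/
noncomputable def descInd (i : ℕ) (w : evenSignedPerm n) : ℝ := if IsDesc i w then 1 else 0

/-- The change of `F` along the coset `{w, w s_i}`, from the shorter to the longer element. -/
noncomputable def delta (i : ℕ) (F : evenSignedPerm n → ℝ) (w : evenSignedPerm n) : ℝ :=
  if IsDesc i w then F w - F (w * gen n i) else F (w * gen n i) - F w

theorem mean_isDesc_transfer (hn : 2 ≤ n) {i : ℕ} (hi : i < n) (F : evenSignedPerm n → ℝ) :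
    mean q (fun w => if IsDesc i w then F w else 0) =
      q * mean q (fun w => if IsDesc i w then 0 else F (w * gen n i)) := by
  rw [mean_mul_right (gen n i), mean, Finset.mul_sum]
  refine Finset.sum_congr rfl fun w _ => ?_
  by_cases h : IsDesc i w
  · have := isDesc_mul_gen hn hi w
    rw [if_neg (by tauto), if_pos h]; ring
  · have := isDesc_mul_gen hn hi w
    rw [if_pos (by tauto), if_neg h, mprob_of_not_isDesc hn hi h]; ring

/-- The Mallows probability of a descent at a given generator. -/
noncomputable def descProb (q : ℝ) : ℝ := q / (1 + q)

/-- On each pair `{w, w s_i}` the descent indicator is Bernoulli with parameter `p = q / (1 + q)`,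
and its covariance with `F` on the pair is `p (1 - p)` times the increment of `F`. -/
theorem mean_descInd_sub_mul (hn : 2 ≤ n) (hq : 0 < q) {i : ℕ} (hi : i < n)
    (F : evenSignedPerm n → ℝ) :
    mean q (fun w => (descInd i w - descProb q) * F w) =
      descProb q * (1 - descProb q) * mean q (delta i F) := by
  have h1 := mean_isDesc_transfer (q := q) hn hi F
  have h2 := mean_isDesc_transfer (q := q) hn hi fun w => F (w * gen n i)
  simp only [mul_assoc, gen_mul_gen hn hi, mul_one] at h2
  have e1 : mean q (fun w => (descInd i w - descProb q) * F w) =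
      (1 - descProb q) * mean q (fun w => if IsDesc i w then F w else 0) -
      descProb q * mean q (fun w => if IsDesc i w then 0 else F w) := by
    rw [← mean_const_mul, ← mean_const_mul, ← mean_sub]
    congr 1; funext w
    unfold descInd; split_ifs <;> ring
  have e2 : mean q (delta i F) = mean q (fun w => if IsDesc i w then F w else 0) -
      mean q (fun w => if IsDesc i w then F (w * gen n i) else 0) +
      (mean q (fun w => if IsDesc i w then 0 else F (w * gen n i)) -
      mean q (fun w => if IsDesc i w then 0 else F w)) := by
    rw [← mean_sub, ← mean_sub, ← mean_add]
    congr 1; funext w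
    unfold delta; split_ifs <;> ring
  rw [e1, e2, h1, h2, descProb]
  have : 1 + q ≠ 0 := by positivity
  field_simp
  ring

/-- Right multiplication by a generator changes each weight by the factor `q` or `q⁻¹`. -/
theorem min_mul_mean_le (hn : 2 ≤ n) (hq : 0 < q) {i : ℕ} (hi : i < n)
    (hF : ∀ w, 0 ≤ F w) : min q q⁻¹ * mean q F ≤ mean q fun w => F (w * gen n i) := by
  rw [mean_mul_right (gen n i) (fun w => F (w * gen n i)), mean, Finset.mul_sum]
  refine Finset.sum_le_sum fun w _ => ?_
  rw [mul_assoc w, gen_mul_gen hn hi, mul_one, ← mul_assoc]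
  refine mul_le_mul_of_nonneg_right ?_ (hF w)
  have hp := (mprob_pos hq w).le
  by_cases h : IsDesc i w
  · have h1 := mprob_of_isDesc (q := q) hn hi h
    calc min q q⁻¹ * mprob q w ≤ q⁻¹ * mprob q w := by gcongr; exact min_le_right _ _
      _ = mprob q (w * gen n i) := by rw [h1]; field_simp
  · rw [mprob_of_not_isDesc hn hi h]
    gcongr; exact min_le_left _ _

/-- The two-sided descent statistic, as a real function. -/
noncomputable def twoDes (w : evenSignedPerm n) : ℝ :=
  ∑ i ∈ Finset.range n, (descInd i w + descInd i w⁻¹)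

theorem twoSidedDescent_eq (hn : 2 ≤ n) (w : evenSignedPerm n) :
    (twoSidedDescent (typeDGenerators n) w : ℝ) = twoDes w := by
  rw [twoSidedDescent, descentCount_eq hn, descentCount_eq hn, twoDes, Finset.sum_add_distrib]
  push_cast
  simp only [descInd, Finset.sum_boole]

theorem twoDes_inv (w : evenSignedPerm n) : twoDes w⁻¹ = twoDes w := by
  simp only [twoDes, inv_inv, add_comm]

/-- The total change of the two-sided descent statistic over all right multiplications. -/
noncomputable def gradSum (w : evenSignedPerm n) : ℝ :=
  ∑ i ∈ Finset.range n, delta i twoDes w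

theorem mean_descInd (hn : 2 ≤ n) (hq : 0 < q) {i : ℕ} (hi : i < n) :
    mean q (descInd (n := n) i) = descProb q := by
  have := mean_descInd_sub_mul (q := q) hn hq hi fun _ => 1
  have e : delta (n := n) i (fun _ => (1 : ℝ)) = fun _ => 0 := by
    funext w; simp [delta]
  simp only [mul_one, e, mean_sub, mean_const hq, mul_zero] at this
  linarith

theorem mean_twoDes (hn : 2 ≤ n) (hq : 0 < q) :
    mean q (twoDes (n := n)) = ∑ _i ∈ Finset.range n, 2 * descProb q := by
  unfold twoDes
  rw [mean_sum]
  refine Finset.sum_congr rfl fun i hi => ?_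
  rw [mean_add, mean_inv hn (descInd i), mean_descInd hn hq (Finset.mem_range.1 hi)]
  ring

/-- Inversion preserves the law and fixes `F`, so the descents of `w⁻¹` contribute as much as those
of `w`: hence the factor 2. -/
theorem mean_twoDes_sub_mul (hn : 2 ≤ n) (hq : 0 < q) (hF : ∀ w, F w⁻¹ = F w) :
    mean q (fun w => (twoDes w - mean q (twoDes (n := n))) * F w) =
      2 * (descProb q * (1 - descProb q)) *
        ∑ i ∈ Finset.range n, mean q (delta i F) := by
  have e : (fun w => (twoDes w - mean q (twoDes (n := n))) * F w) = fun w =>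
      ∑ i ∈ Finset.range n, ((descInd i w - descProb q) * F w +
        (descInd i w⁻¹ - descProb q) * F w⁻¹) := by
    funext w
    rw [mean_twoDes hn hq, twoDes, ← Finset.sum_sub_distrib, Finset.sum_mul]
    exact Finset.sum_congr rfl fun i _ => by rw [hF]; ring
  rw [e, mean_sum, Finset.mul_sum]
  refine Finset.sum_congr rfl fun i hi => ?_
  rw [mean_add, mean_inv hn (fun w => (descInd i w - descProb q) * F w),
    mean_descInd_sub_mul hn hq (Finset.mem_range.1 hi)]
  ring

theorem mean_twoDes_variance (hn : 2 ≤ n) (hq : 0 < q) :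
    mean q (fun w : evenSignedPerm n => (twoDes w - mean q (twoDes (n := n))) ^ 2) =
      2 * (descProb q * (1 - descProb q)) * mean q (gradSum (n := n)) := by
  have h := mean_twoDes_sub_mul hn hq (F := fun w => twoDes w - mean q (twoDes (n := n)))
    (fun w => by rw [twoDes_inv])
  have e : ∀ i, delta (n := n) i (fun w => twoDes w - mean q (twoDes (n := n))) =
      delta i twoDes := by
    intro i; funext w; unfold delta; split_ifs <;> ring
  simp only [e, ← sq] at h
  rw [h]
  unfold gradSum
  rw [mean_sum]

/-- Stein's method for the two-sided descent statistic. -/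
theorem stein_bound (hn : 2 ≤ n) (hq : 0 < q) {f f' : ℝ → ℝ} {C L σ D : ℝ}
    (hf : ∀ x, HasDerivAt f (f' x) x) (hC : ∀ x, |f' x| ≤ C)
    (hL : ∀ x y, |f' x - f' y| ≤ L * |x - y|) (hσ : 0 < σ)
    (hvar : σ ^ 2 = mean q (fun w : evenSignedPerm n => (twoDes w - mean q (twoDes (n := n))) ^ 2))
    (hD : ∀ i < n, ∀ w : evenSignedPerm n, |delta i twoDes w| ≤ D) :
    |mean q (fun w : evenSignedPerm n => f' ((twoDes w - mean q (twoDes (n := n))) / σ) -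
      (twoDes w - mean q (twoDes (n := n))) / σ *
        f ((twoDes w - mean q (twoDes (n := n))) / σ))| ≤
      C * (mean q (fun w : evenSignedPerm n => |gradSum w - mean q (gradSum (n := n))|) /
        mean q (gradSum (n := n))) +
      L * D ^ 2 * n * (descProb q * (1 - descProb q)) / σ ^ 3 := by
  set μ := mean q (twoDes (n := n)) with hμ
  set W : evenSignedPerm n → ℝ := fun w => (twoDes w - μ) / σ with hW
  set κ := descProb q * (1 - descProb q) with hκ
  set ρ := mean q (gradSum (n := n)) with hρ
  have hκ0 : 0 < κ := by
    rw [hκ, descProb]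
    have : 1 - q / (1 + q) = 1 / (1 + q) := by field_simp; ring
    rw [this]; positivity
  have hv2 : σ ^ 2 = 2 * κ * ρ := by rw [hvar, mean_twoDes_variance hn hq]
  have hρ0 : 0 < ρ := by
    by_contra h
    have : 2 * κ * ρ ≤ 0 := mul_nonpos_of_nonneg_of_nonpos (by positivity) (not_lt.1 h)
    nlinarith [sq_pos_of_pos hσ]
  have hL0 : 0 ≤ L := by
    have := (abs_nonneg _).trans (hL 1 0); simpa using this
  have hC0 : 0 ≤ C := (abs_nonneg _).trans (hC 0)
  -- As `f'` is only Lipschitz, the second-order remainder is compared with `L/2 (y - x)² t²` along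
  -- the segment instead of using a second derivative.
  have taylor : ∀ x y, |f y - f x - f' x * (y - x)| ≤ L / 2 * (y - x) ^ 2 := by
    intro x y
    have hder : ∀ t, HasDerivAt (fun t => f (x + t * (y - x)) - f x - f' x * (t * (y - x)))
        ((f' (x + t * (y - x)) - f' x) * (y - x)) t := by
      intro t
      have hlin : HasDerivAt (fun t => t * (y - x)) (y - x) t := by
        simpa using (hasDerivAt_id t).mul_const (y - x)
      have h1 := (hf (x + t * (y - x))).comp t (hlin.const_add x)
      exact ((h1.sub_const (f x)).sub (hlin.const_mul (f' x))).congr_deriv (by ring)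
    have hB : ∀ t, HasDerivAt (fun t => L / 2 * (y - x) ^ 2 * t ^ 2) (L * (y - x) ^ 2 * t) t := by
      intro t
      exact ((hasDerivAt_pow 2 t).const_mul (L / 2 * (y - x) ^ 2)).congr_deriv
        (by push_cast; ring)
    have := image_norm_le_of_norm_deriv_right_le_deriv_boundary (a := 0) (b := 1)
      (fun t _ => (hder t).continuousAt.continuousWithinAt)
      (fun t _ => (hder t).hasDerivWithinAt) (by simp) hB (fun t ht => by
        rw [Real.norm_eq_abs, abs_mul]
        have h1 := hL (x + t * (y - x)) x
        rw [add_sub_cancel_left, abs_mul, abs_of_nonneg ht.1] at h1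
        calc _ ≤ L * (t * |y - x|) * |y - x| := by gcongr
          _ = L * |y - x| ^ 2 * t := by ring
          _ = _ := by rw [sq_abs]) (Set.right_mem_Icc.2 zero_le_one)
    simpa using this
  have hdelta : ∀ i < n, ∀ w, |delta i (fun w => f (W w)) w - f' (W w) * (delta i twoDes w / σ)| ≤
      L / 2 * D ^ 2 / σ ^ 2 := by
    intro i hi w
    have h1 := taylor (W w) (W (w * gen n i))
    have h2 : W (w * gen n i) - W w = (twoDes (w * gen n i) - twoDes w) / σ := by
      simp only [hW]; ring
    have h3 : (W (w * gen n i) - W w) ^ 2 = (delta i twoDes w) ^ 2 / σ ^ 2 := by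
      rw [h2]; unfold delta; split_ifs <;> ring
    have h4 : (delta i twoDes w) ^ 2 ≤ D ^ 2 := by
      have := hD i hi w
      rw [← sq_abs]; gcongr
    -- At a descent both increments change sign, so the expansion can always start at `W w`.
    have h5 : |delta i (fun w => f (W w)) w - f' (W w) * (delta i twoDes w / σ)| =
        |f (W (w * gen n i)) - f (W w) - f' (W w) * (W (w * gen n i) - W w)| := by
      rw [h2]; unfold delta; split_ifs
      · rw [← abs_neg]; congr 1; ring
      · congr 1
    rw [h5]
    refine h1.trans ?_
    rw [h3, mul_div_assoc]
    gcongr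
  have hid := mean_twoDes_sub_mul hn hq (F := fun w => f (W w)) (fun w => by
    simp only [hW, twoDes_inv])
  have e1 : mean q (fun w => f' (W w) - W w * f (W w)) =
      mean q (fun w => f' (W w) * (1 - gradSum w / ρ)) -
      (2 * κ / σ) * mean q (fun w => ∑ i ∈ Finset.range n,
        (delta i (fun w => f (W w)) w - f' (W w) * (delta i twoDes w / σ))) := by
    have a1 : mean q (fun w => W w * f (W w)) = (1 / σ) * (2 * κ *
        ∑ i ∈ Finset.range n, mean q (delta i fun w => f (W w))) := by
      rw [← hid, ← mean_const_mul]
      congr 1; funext w; simp only [hW]; ring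
    have a2 : mean q (fun w => ∑ i ∈ Finset.range n,
        (delta i (fun w => f (W w)) w - f' (W w) * (delta i twoDes w / σ))) =
        ∑ i ∈ Finset.range n, mean q (delta i fun w => f (W w)) -
        (1 / σ) * mean q (fun w => f' (W w) * gradSum w) := by
      rw [← mean_sum, ← mean_const_mul, ← mean_sub]
      congr 1; funext w
      rw [Finset.sum_sub_distrib, gradSum, ← mul_assoc, Finset.mul_sum]
      congr 1
      exact Finset.sum_congr rfl fun i _ => by ring
    have a3 : mean q (fun w => f' (W w) * (1 - gradSum w / ρ)) =
        mean q (fun w => f' (W w)) - (1 / ρ) * mean q (fun w => f' (W w) * gradSum w) := by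
      rw [← mean_const_mul, ← mean_sub]
      congr 1; funext w; ring
    rw [mean_sub, a1, a2, a3]
    -- This is the variance identity `σ² = 2κρ`, which makes the first-order terms match.
    have : 1 / ρ = 2 * κ / σ * (1 / σ) := by
      field_simp; linarith
    rw [this]; ring
  have b1 : |mean q (fun w => f' (W w) * (1 - gradSum w / ρ))| ≤
      C * (mean q (fun w : evenSignedPerm n => |gradSum w - ρ|) / ρ) := by
    refine (abs_mean_le hq _).trans ?_
    rw [mul_div_assoc', ← mean_const_mul, div_eq_mul_inv, ← mean_mul_const]
    refine mean_mono hq fun w => ?_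
    rw [abs_mul, mul_assoc]
    have : |1 - gradSum w / ρ| = |gradSum w - ρ| * ρ⁻¹ := by
      rw [show 1 - gradSum w / ρ = -((gradSum w - ρ) * ρ⁻¹) by field_simp; ring, abs_neg,
        abs_mul, abs_of_pos (inv_pos.2 hρ0)]
    rw [this]
    exact mul_le_mul_of_nonneg_right (hC _) (by positivity)
  have b2 : |mean q (fun w => ∑ i ∈ Finset.range n,
        (delta i (fun w => f (W w)) w - f' (W w) * (delta i twoDes w / σ)))| ≤
      n * (L / 2 * D ^ 2 / σ ^ 2) := by
    refine (abs_mean_le hq _).trans (mean_le_of_le hq fun w => ?_)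
    refine (Finset.abs_sum_le_sum_abs _ _).trans ?_
    refine (Finset.sum_le_sum fun i hi => hdelta i (Finset.mem_range.1 hi) w).trans ?_
    simp
  rw [e1]
  refine (abs_sub _ _).trans (add_le_add b1 ?_)
  rw [abs_mul, abs_of_pos (by positivity : 0 < 2 * κ / σ)]
  refine (mul_le_mul_of_nonneg_left b2 (by positivity)).trans (le_of_eq ?_)
  field_simp

end Mean

/-! ### Independence of relative order and parabolic coset. -/

section Parabolic

variable {n : ℕ} {q : ℝ}

/-- The parabolic subgroup of type `A` that permutes the positions `c, …, n`. -/
def parab (n c : ℕ) : Subgroup (evenSignedPerm n) where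
  carrier := {u | ∀ z : ℤ, 0 < z → 0 < ev u z ∧ (z < c → ev u z = z)}
  one_mem' := fun z hz => by simpa using hz
  mul_mem' := by
    intro a b ha hb z hz
    rw [ev_mul_apply]
    have h1 := hb z hz
    have h2 := ha _ h1.1
    refine ⟨h2.1, fun hc => ?_⟩
    rw [h1.2 hc]; exact (ha z hz).2 hc
  inv_mem' := by
    intro a ha z hz
    refine ⟨?_, fun hc => ?_⟩
    · by_contra h
      have h0 : ev a⁻¹ z ≠ 0 := by
        intro h0
        have h1 := ev_apply_inv a z
        have h2 := ev_neg a 0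
        rw [h0] at h1
        simp only [neg_zero] at h2
        omega
      have h1 := (ha (-ev a⁻¹ z) (by omega)).1
      rw [ev_neg, ev_apply_inv] at h1
      omega
    · have := (ha z hz).2 hc
      rw [← this, ev_inv_apply, this]

theorem ev_parab_of_lt {c : ℕ} {u : evenSignedPerm n} (hu : u ∈ parab n c) {z : ℤ} (h0 : 0 < z)
    (hz : z < c) : ev u z = z := (hu z h0).2 hz

theorem ev_parab_mem {c : ℕ} (hc : 1 ≤ c) {u : evenSignedPerm n} (hu : u ∈ parab n c) {z : ℤ}
    (h1 : (c : ℤ) ≤ z) (h2 : z ≤ n) : (c : ℤ) ≤ ev u z ∧ ev u z ≤ n := by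
  have h3 := (hu z (by omega)).1
  refine ⟨?_, (ev_mem u (by omega) (by omega) h2).2.2⟩
  by_contra h
  have h4 := (hu (ev u z) h3).2 (by omega)
  rw [ev_inj] at h4
  omega

theorem gen_mem_parab (hn : 2 ≤ n) {c i : ℕ} (hc : 1 ≤ c) (hci : c ≤ i) (hi : i < n) :
    gen n i ∈ parab n c := by
  intro z hz
  rw [ev_gen hn hi, genPerm_apply, genLo_of_pos (by omega), genHi_of_pos (by omega)]
  split_ifs <;> omega

/-- `w` is increasing on the positions `c, …, n`. -/
def IncrOn (c : ℕ) (w : evenSignedPerm n) : Prop :=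
  ∀ y z : ℤ, (c : ℤ) ≤ y → y < z → z ≤ n → ev w y < ev w z

theorem incrOn_of_not_isDesc {c : ℕ} (hc : 1 ≤ c) {w : evenSignedPerm n}
    (h : ∀ i, c ≤ i → i < n → ¬IsDesc i w) : IncrOn c w := by
  have hstep : ∀ i : ℕ, c ≤ i → i < n → ev w i < ev w (i + 1) := by
    intro i h1 h2
    have := h i h1 h2
    rw [IsDesc, genLo_of_pos (by omega), genHi_of_pos (by omega)] at this
    have : ev w i ≠ ev w (i + 1) := by rw [Ne, ev_inj]; omega
    omega
  have key : ∀ d i : ℕ, c ≤ i → i + d + 1 ≤ n → ev w i < ev w ((i + d + 1 : ℕ) : ℤ) := by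
    intro d
    induction d with
    | zero => intro i h1 h2; push_cast; simpa using hstep i h1 (by omega)
    | succ d ih =>
      intro i h1 h2
      have h3 := ih i h1 (by omega)
      have h4 := hstep (i + d + 1) (by omega) (by omega)
      push_cast at h3 h4 ⊢
      rw [show (i : ℤ) + (d + 1) + 1 = i + d + 1 + 1 by ring]
      omega
  intro y z h1 h2 h3
  have := key (z - y - 1).toNat y.toNat (by omega) (by omega)
  rw [show ((y.toNat : ℕ) : ℤ) = y by omega,
    show ((y.toNat + (z - y - 1).toNat + 1 : ℕ) : ℤ) = z by omega] at this
  exact this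

/-- A shortest element of the coset has no descent at `c, …, n - 1`. -/
theorem exists_incrOn (hn : 2 ≤ n) {c : ℕ} (hc : 1 ≤ c) (w : evenSignedPerm n) :
    ∃ v ∈ parab n c, IncrOn c (w * v) := by
  obtain ⟨v, hv, hmin⟩ := Set.exists_min_image (parab n c : Set (evenSignedPerm n))
    (fun v => len (w * v)) (Set.toFinite _) ⟨1, one_mem _⟩
  refine ⟨v, hv, incrOn_of_not_isDesc hc fun i h1 h2 hd => ?_⟩
  have h3 := len_of_isDesc hn h2 hd
  have h4 := hmin (v * gen n i) (mul_mem hv (gen_mem_parab hn hc h1 h2))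
  rw [← mul_assoc] at h4
  omega

theorem ev_lt_iff_of_incrOn {c : ℕ} {w : evenSignedPerm n} (hw : IncrOn c w) {y z : ℤ}
    (hy1 : (c : ℤ) ≤ y) (hy2 : y ≤ n) (hz1 : (c : ℤ) ≤ z) (hz2 : z ≤ n) :
    ev w y < ev w z ↔ y < z := by
  rcases lt_trichotomy y z with h | h | h
  · exact iff_of_true (hw y z hy1 h hz2) h
  · subst h; simp
  · exact iff_of_false (hw z y hz1 h hy2).not_gt h.not_gt

/-- Lengths add over a minimal coset representative: a descent of `u` is also a descent of `w u`,
because `w` is increasing where `u` acts, so both lengths drop together. -/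
theorem len_mul_of_incrOn (hn : 2 ≤ n) {c : ℕ} (hc : 1 ≤ c) {w : evenSignedPerm n}
    (hw : IncrOn c w) (k : ℕ) : ∀ u ∈ parab n c, len u = k → len (w * u) = len w + len u := by
  induction k with
  | zero =>
    intro u _ h
    have h1 := invCount_eq_two_mul_len hn u
    have : u = 1 := eq_one_of_forall_not_isDesc hn u fun i hi hd => by
      have := len_of_isDesc hn hi hd; omega
    subst this
    rw [mul_one, h, add_zero]
  | succ k ih =>
    intro u hu h
    have : ∃ i < n, IsDesc i u := by
      by_contra hcon
      push Not at hcon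
      have := eq_one_of_forall_not_isDesc hn u hcon
      subst this
      have h1 := invCount_eq_two_mul_len hn (1 : evenSignedPerm n)
      rw [invCount_one] at h1; omega
    obtain ⟨i, hi, hd⟩ := this
    -- `u` keeps positive entries positive and fixes those below `c`, so it has no descent at a
    -- generator below `c`.
    have hci : c ≤ i := by
      by_contra hlt
      have hcs := genLo_genHi_cases i
      unfold IsDesc at hd
      have hp : ∀ z : ℤ, 0 < z → 0 < ev u z := fun z hz => (hu z hz).1
      rcases hcs with ⟨-, h1, h2⟩ | ⟨h0, h1, h2⟩
      · rw [h1, h2, ev_neg] at hd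
        have := hp 1 one_pos
        have := hp 2 two_pos
        omega
      · rw [h1, h2, ev_parab_of_lt hu (by omega : (0 : ℤ) < i) (by omega)] at hd
        have h3 := hp (i + 1) (by omega)
        have h4 := (hu _ h3).2 (by omega)
        rw [ev_inj] at h4
        omega
    have h1 := len_of_isDesc hn hi hd
    have h2 := ih (u * gen n i) (mul_mem hu (gen_mem_parab hn hc hci hi)) (by omega)
    have hd' : IsDesc i (w * u) := by
      unfold IsDesc at hd ⊢
      rw [ev_mul_apply, ev_mul_apply]
      have e1 := genLo_of_pos (i := i) (by omega)
      have e2 := genHi_of_pos (i := i) (by omega)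
      have h3 := ev_parab_mem hc hu (z := genLo i) (by omega) (by omega)
      have h4 := ev_parab_mem hc hu (z := genHi i) (by omega) (by omega)
      exact (ev_lt_iff_of_incrOn hw h4.1 h4.2 h3.1 h3.2).2 hd
    have h3 := len_of_isDesc hn hi hd'
    rw [mul_assoc] at h3
    omega

/-- `F w` depends only on the relative order of the values of `w` at the positions `c, …, n`. -/
def IsPattern (c : ℕ) (F : evenSignedPerm n → ℝ) : Prop :=
  ∀ v w : evenSignedPerm n, (∀ y z : ℤ, (c : ℤ) ≤ y → y ≤ n → (c : ℤ) ≤ z → z ≤ n →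
    (ev v y < ev v z ↔ ev w y < ev w z)) → F v = F w

/-- `G` is invariant under permutations of the positions `c, …, n`. -/
def IsParabInvariant (c : ℕ) (G : evenSignedPerm n → ℝ) : Prop :=
  ∀ w, ∀ u ∈ parab n c, G (w * u) = G w

open Classical in
/-- Under the Mallows distribution, the relative order of the values at the positions `c, …, n` is
independent of the coset modulo permutations of these positions. -/
theorem mean_mul_of_isPattern (hn : 2 ≤ n) (hq : 0 < q) {c : ℕ} (hc : 1 ≤ c)
    {F G : evenSignedPerm n → ℝ} (hF : IsPattern c F) (hG : IsParabInvariant c G) :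
    mean q (fun w => F w * G w) = mean q F * mean q G := by
  set m : ℝ := ((Fintype.card (parab n c) : ℕ) : ℝ) with hm
  have hm0 : m ≠ 0 := by
    rw [hm]; exact_mod_cast Fintype.card_ne_zero
  set S : ℝ := ∑ u : parab n c, q ^ len (u : evenSignedPerm n) with hS
  have hS0 : S ≠ 0 := (Finset.sum_pos (fun u _ => pow_pos hq _) Finset.univ_nonempty).ne'
  set k : ℝ := (∑ u : parab n c, q ^ len (u : evenSignedPerm n) * F u) / S with hk
  -- Averaging over translates by the subgroup avoids a choice of coset representatives; each
  -- element is counted `m` times.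
  have hsym : ∀ H : evenSignedPerm n → ℝ,
      m * mean q H = ∑ w, ∑ u : parab n c, mprob q (w * (u : evenSignedPerm n)) * H (w * u) := by
    intro H
    rw [Finset.sum_comm]
    simp only [← mean_mul_right]
    simp [hm]
  -- From a minimal representative, the weight factors as `q^ℓ(wv) q^ℓ(u)` up to normalisation and
  -- the relative order is that of `u`, so the conditional mean `k` of `F` is the same in every
  -- coset.
  have hcoset : ∀ w, ∑ u : parab n c, mprob q (w * (u : evenSignedPerm n)) * F (w * u) =
      k * ∑ u : parab n c, mprob q (w * (u : evenSignedPerm n)) := by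
    intro w
    obtain ⟨v, hv, hinc⟩ := exists_incrOn hn hc w
    have hre : ∀ f : evenSignedPerm n → ℝ,
        ∑ u : parab n c, f (w * (u : evenSignedPerm n)) = ∑ u : parab n c, f (w * v * (u : evenSignedPerm n)) := by
      intro f
      rw [← Equiv.sum_comp (Equiv.mulLeft (⟨v, hv⟩ : parab n c))]
      simp [mul_assoc]
    rw [hre fun x => mprob q x * F x, hre fun x => mprob q x]
    have h1 : ∀ u : parab n c, mprob q (w * v * (u : evenSignedPerm n)) =
        mprob q (w * v) * q ^ len (u : evenSignedPerm n) := by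
      intro u
      rw [mprob, mprob, len_mul_of_incrOn hn hc hinc _ u u.2 rfl, pow_add]; ring
    have h2 : ∀ u : parab n c, F (w * v * (u : evenSignedPerm n)) = F u := by
      intro u
      refine hF _ _ fun y z hy1 hy2 hz1 hz2 => ?_
      rw [ev_mul_apply, ev_mul_apply _ (u : evenSignedPerm n) z]
      have h3 := ev_parab_mem hc u.2 hy1 hy2
      have h4 := ev_parab_mem hc u.2 hz1 hz2
      exact ev_lt_iff_of_incrOn hinc h3.1 h3.2 h4.1 h4.2
    simp only [h1, h2]
    simp only [mul_assoc (mprob q (w * v)), ← Finset.mul_sum]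
    rw [hk, ← hS]
    field_simp
  have key : ∀ H : evenSignedPerm n → ℝ, IsParabInvariant c H →
      mean q (fun w => F w * H w) = k * mean q H := by
    intro H hH
    apply mul_left_cancel₀ hm0
    rw [hsym, mul_left_comm, hsym, Finset.mul_sum]
    refine Finset.sum_congr rfl fun w _ => ?_
    have : ∀ u : parab n c, H (w * (u : evenSignedPerm n)) = H w := fun u => hH w u u.2
    simp only [this, ← mul_assoc, ← Finset.sum_mul]
    rw [hcoset]
  have h1 := key (fun _ => 1) fun _ _ _ => rfl
  simp only [mul_one, mean_const hq] at h1
  rw [key G hG, h1]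

end Parabolic

/-! ### Monotone consecutive triples. -/

section Triples

variable {n : ℕ} {q : ℝ}

open Classical in
/-- The indicator function of `A`. -/
noncomputable def ind (A : evenSignedPerm n → Prop) (w : evenSignedPerm n) : ℝ :=
  if A w then 1 else 0

theorem ind_nonneg (A : evenSignedPerm n → Prop) (w : evenSignedPerm n) : 0 ≤ ind A w := by
  unfold ind; split_ifs <;> norm_num

theorem ind_le_one (A : evenSignedPerm n → Prop) (w : evenSignedPerm n) : ind A w ≤ 1 := by
  unfold ind; split_ifs <;> norm_num

theorem ind_of {A : evenSignedPerm n → Prop} {w : evenSignedPerm n} (h : A w) : ind A w = 1 :=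
  if_pos h

theorem ind_of_not {A : evenSignedPerm n → Prop} {w : evenSignedPerm n} (h : ¬A w) :
    ind A w = 0 := if_neg h

theorem ind_eq_ite {A : evenSignedPerm n → Prop} {w : evenSignedPerm n} {p : Prop} [Decidable p]
    (h : A w ↔ p) : ind A w = if p then 1 else 0 := by
  by_cases hA : A w
  · rw [ind_of hA, if_pos (h.1 hA)]
  · rw [ind_of_not hA, if_neg (mt h.2 hA)]

theorem ind_congr {A B : evenSignedPerm n → Prop} {w w' : evenSignedPerm n} (h : A w ↔ B w') :
    ind A w = ind B w' := by
  by_cases hA : A w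
  · rw [ind_of hA, ind_of (h.1 hA)]
  · rw [ind_of_not hA, ind_of_not (mt h.2 hA)]

theorem mean_ind_transfer (hn : 2 ≤ n) {i : ℕ} (hi : i < n) {A B : evenSignedPerm n → Prop}
    (hA : ∀ w, A w → IsDesc i w) (hB : ∀ w, B w → ¬IsDesc i w)
    (hAB : ∀ w, ¬IsDesc i w → (A (w * gen n i) ↔ B w)) :
    mean q (ind A) = q * mean q (ind B) := by
  have h := mean_isDesc_transfer (q := q) hn hi (ind A)
  have e1 : (fun w => if IsDesc i w then ind A w else 0) = ind A := by
    funext w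
    by_cases hd : IsDesc i w
    · rw [if_pos hd]
    · rw [if_neg hd, ind, if_neg fun h => hd (hA w h)]
  have e2 : (fun w => if IsDesc i w then 0 else ind A (w * gen n i)) = ind B := by
    funext w
    by_cases hd : IsDesc i w
    · rw [if_pos hd, ind, if_neg fun h => hB w h hd]
    · rw [if_neg hd, ind_congr (hAB w hd)]
  rwa [e1, e2] at h

theorem ev_mul_gen_of_pos (hn : 2 ≤ n) {i : ℕ} (h1 : 1 ≤ i) (hi : i < n) (w : evenSignedPerm n)
    {z : ℤ} (hz : 0 < z) : ev (w * gen n i) z =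
      if z = i then ev w (i + 1) else if z = i + 1 then ev w i else ev w z := by
  rw [ev_mul_gen hn hi, genPerm_apply, genLo_of_pos h1, genHi_of_pos h1]
  split_ifs <;> first | rfl | omega

theorem isDesc_iff_of_pos {i : ℕ} (h1 : 1 ≤ i) (w : evenSignedPerm n) :
    IsDesc i w ↔ ev w (i + 1) < ev w i := by
  rw [IsDesc, genLo_of_pos h1, genHi_of_pos h1]

/-- The values of `w` at the positions `k, k + 1, k + 2` are monotone. -/
def IsMonoTriple (k : ℕ) (w : evenSignedPerm n) : Prop :=
  (ev w k < ev w (k + 1) ∧ ev w (k + 1) < ev w (k + 2)) ∨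
    (ev w (k + 2) < ev w (k + 1) ∧ ev w (k + 1) < ev w k)

/-- The six relative orders of three consecutive values. -/
def TripleLt (k : ℕ) (a b c : ℤ) (w : evenSignedPerm n) : Prop :=
  ev w (k + a) < ev w (k + b) ∧ ev w (k + b) < ev w (k + c)

theorem sum_ind_order {x y z : ℤ} (hxy : x ≠ y) (hxz : x ≠ z) (hyz : y ≠ z)
    [Decidable (x < y ∧ y < z)] [Decidable (y < x ∧ x < z)] [Decidable (x < z ∧ z < y)]
    [Decidable (y < z ∧ z < x)] [Decidable (z < x ∧ x < y)] [Decidable (z < y ∧ y < x)] :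
    (if x < y ∧ y < z then (1 : ℝ) else 0) + (if y < x ∧ x < z then 1 else 0) +
      (if x < z ∧ z < y then 1 else 0) + (if y < z ∧ z < x then 1 else 0) +
      (if z < x ∧ x < y then 1 else 0) + (if z < y ∧ y < x then 1 else 0) = 1 := by
  rcases lt_or_gt_of_ne hxy with h1 | h1 <;> rcases lt_or_gt_of_ne hxz with h2 | h2 <;>
    rcases lt_or_gt_of_ne hyz with h3 | h3 <;>
    first | omega | simp [h1, h2, h3, h1.not_gt, h2.not_gt, h3.not_gt]

/-- Adjacent exchanges show that the six orders have probabilities proportional to `1, q, q, q², q²,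
q³`. The claim becomes `3 (1 + q³) - (1 + 2q + 2q² + q³) = 2 (1 + q)(1 - q)² ≥ 0`. -/
theorem third_le_mean_isMonoTriple (hn : 2 ≤ n) (hq : 0 < q) {k : ℕ} (hk : 1 ≤ k)
    (hkn : k + 2 ≤ n) : 1 / 3 ≤ mean q (ind (IsMonoTriple (n := n) k)) := by
  have hne : ∀ (w : evenSignedPerm n) (a b : ℤ), a ≠ b → ev w (k + a) ≠ ev w (k + b) := by
    intro w a b hab; rw [Ne, ev_inj]; omega
  have d0 : ∀ w : evenSignedPerm n, IsDesc k w ↔ ev w (k + 1) < ev w (k + 0) := by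
    intro w; rw [isDesc_iff_of_pos hk, add_zero]
  have d1 : ∀ w : evenSignedPerm n, IsDesc (k + 1) w ↔ ev w (k + 2) < ev w (k + 1) := by
    intro w; rw [isDesc_iff_of_pos (by omega)]; push_cast; rw [add_assoc]; norm_num
  have s0 : ∀ (w : evenSignedPerm n), ev (w * gen n k) (k + 0) = ev w (k + 1) ∧
      ev (w * gen n k) (k + 1) = ev w (k + 0) ∧ ev (w * gen n k) (k + 2) = ev w (k + 2) := by
    intro w
    refine ⟨?_, ?_, ?_⟩ <;> rw [ev_mul_gen_of_pos hn hk (by omega) w (by omega)] <;>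
      split_ifs <;> first | omega | simp
  have s1 : ∀ (w : evenSignedPerm n), ev (w * gen n (k + 1)) (k + 0) = ev w (k + 0) ∧
      ev (w * gen n (k + 1)) (k + 1) = ev w (k + 2) ∧
      ev (w * gen n (k + 1)) (k + 2) = ev w (k + 1) := by
    intro w
    refine ⟨?_, ?_, ?_⟩ <;> rw [ev_mul_gen_of_pos hn (by omega) (by omega) w (by omega)] <;>
      split_ifs <;> first | omega | (push_cast; ring_nf)
  have r1 : mean q (ind (TripleLt (n := n) k 1 0 2)) = q * mean q (ind (TripleLt (n := n) k 0 1 2)) := by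
    refine mean_ind_transfer hn (i := k) (by omega) ?_ ?_ ?_ <;> intro w <;>
      obtain ⟨e0, e1, e2⟩ := s0 w <;> simp only [TripleLt, d0, e0, e1, e2] <;> intro h <;>
      first | omega | trivial
  have r2 : mean q (ind (TripleLt (n := n) k 0 2 1)) = q * mean q (ind (TripleLt (n := n) k 0 1 2)) := by
    refine mean_ind_transfer hn (i := k + 1) (by omega) ?_ ?_ ?_ <;> intro w <;>
      obtain ⟨e0, e1, e2⟩ := s1 w <;> simp only [TripleLt, d1, e0, e1, e2] <;> intro h <;>
      first | omega | trivial
  have r3 : mean q (ind (TripleLt (n := n) k 1 2 0)) = q * mean q (ind (TripleLt (n := n) k 0 2 1)) := by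
    refine mean_ind_transfer hn (i := k) (by omega) ?_ ?_ ?_ <;> intro w <;>
      obtain ⟨e0, e1, e2⟩ := s0 w <;> simp only [TripleLt, d0, e0, e1, e2] <;> intro h <;>
      first | omega | trivial
  have r4 : mean q (ind (TripleLt (n := n) k 2 0 1)) = q * mean q (ind (TripleLt (n := n) k 1 0 2)) := by
    refine mean_ind_transfer hn (i := k + 1) (by omega) ?_ ?_ ?_ <;> intro w <;>
      obtain ⟨e0, e1, e2⟩ := s1 w <;> simp only [TripleLt, d1, e0, e1, e2] <;> intro h <;>
      first | omega | trivial
  have r5 : mean q (ind (TripleLt (n := n) k 2 1 0)) = q * mean q (ind (TripleLt (n := n) k 2 0 1)) := by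
    refine mean_ind_transfer hn (i := k) (by omega) ?_ ?_ ?_ <;> intro w <;>
      obtain ⟨e0, e1, e2⟩ := s0 w <;> simp only [TripleLt, d0, e0, e1, e2] <;> intro h <;>
      first | omega | trivial
  have hT : ∀ (w : evenSignedPerm n) (a b c : ℤ), ind (TripleLt k a b c) w =
      if ev w (k + a) < ev w (k + b) ∧ ev w (k + b) < ev w (k + c) then 1 else 0 :=
    fun w a b c => ind_eq_ite Iff.rfl
  have hM : mean q (ind (IsMonoTriple (n := n) k)) =
      mean q (ind (TripleLt (n := n) k 0 1 2)) + mean q (ind (TripleLt (n := n) k 2 1 0)) := by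
    rw [← mean_add]
    congr 1; funext w
    rw [hT, hT, ind_eq_ite (A := IsMonoTriple k) (p := (ev w k < ev w (k + 1) ∧
      ev w (k + 1) < ev w (k + 2)) ∨ (ev w (k + 2) < ev w (k + 1) ∧ ev w (k + 1) < ev w k))
      Iff.rfl, add_zero]
    split_ifs <;> first | omega | norm_num
  have hsum : mean q (ind (TripleLt (n := n) k 0 1 2)) + mean q (ind (TripleLt (n := n) k 1 0 2)) +
      mean q (ind (TripleLt (n := n) k 0 2 1)) + mean q (ind (TripleLt (n := n) k 1 2 0)) +
      mean q (ind (TripleLt (n := n) k 2 0 1)) + mean q (ind (TripleLt (n := n) k 2 1 0)) = 1 := by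
    rw [← mean_add, ← mean_add, ← mean_add, ← mean_add, ← mean_add, ← mean_const (n := n) hq 1]
    congr 1; funext w
    have h01 := hne w 0 1 (by norm_num)
    have h02 := hne w 0 2 (by norm_num)
    have h12 := hne w 1 2 (by norm_num)
    simp only [hT]
    exact sum_ind_order h01 h02 h12
  rw [r5, r4, r3, r2, r1] at hsum
  rw [hM, r5, r4, r1]
  set x := mean q (ind (TripleLt (n := n) k 0 1 2)) with hx
  have hx0 : 0 ≤ x := mean_nonneg hq (ind_nonneg _)
  nlinarith [mul_nonneg hx0 (mul_nonneg (add_pos one_pos hq).le (sq_nonneg (1 - q)))]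

theorem isPattern_isMonoTriple {c k : ℕ} (hck : c ≤ k) (hkn : k + 2 ≤ n) :
    IsPattern c (ind (IsMonoTriple (n := n) k)) := by
  intro w w' h
  have h01 := h k (k + 1) (by omega) (by omega) (by omega) (by omega)
  have h12 := h (k + 1) (k + 2) (by omega) (by omega) (by omega) (by omega)
  have h10 := h (k + 1) k (by omega) (by omega) (by omega) (by omega)
  have h21 := h (k + 2) (k + 1) (by omega) (by omega) (by omega) (by omega)
  exact ind_congr (by simp only [IsMonoTriple, h01, h12, h10, h21])

theorem isParabInvariant_isMonoTriple {c k : ℕ} (hk : 1 ≤ k) (hkc : k + 3 ≤ c) :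
    IsParabInvariant c (ind (IsMonoTriple (n := n) k)) := by
  intro w u hu
  refine ind_congr ?_
  simp only [IsMonoTriple, ev_mul_apply]
  rw [ev_parab_of_lt hu (by omega : (0 : ℤ) < k) (by omega),
    ev_parab_of_lt hu (by omega : (0 : ℤ) < k + 1) (by omega),
    ev_parab_of_lt hu (by omega : (0 : ℤ) < k + 2) (by omega)]

/-- The variance of a sum of `[0, 1]`-valued functions, when the covariances with the later terms
at distance at least `r` add up to at most `D`. -/
theorem variance_sum_le (hq : 0 < q) (s : Finset ℕ) (f : ℕ → evenSignedPerm n → ℝ)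
    (h0 : ∀ i ∈ s, ∀ w, 0 ≤ f i w) (h1 : ∀ i ∈ s, ∀ w, f i w ≤ 1) {r : ℕ} (hr : 1 ≤ r) {D : ℝ}
    (hD : ∀ i ∈ s, ∑ j ∈ s with i + r ≤ j,
      (mean q (fun w => f i w * f j w) - mean q (f i) * mean q (f j)) ≤ D) :
    mean q (fun w => (∑ i ∈ s, f i w) ^ 2) - mean q (fun w => ∑ i ∈ s, f i w) ^ 2 ≤
      s.card * (2 * r + 2 * D) := by
  set cov : ℕ → ℕ → ℝ := fun i j =>
    mean q (fun w => f i w * f j w) - mean q (f i) * mean q (f j) with hcov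
  have hsymm : ∀ i j, cov i j = cov j i := by
    intro i j
    simp only [hcov, mul_comm]
  have hcov1 : ∀ i ∈ s, ∀ j ∈ s, cov i j ≤ 1 := by
    intro i hi j hj
    have a1 : mean q (fun w => f i w * f j w) ≤ 1 :=
      mean_le_of_le hq fun w => mul_le_one₀ (h1 i hi w) (h0 j hj w) (h1 j hj w)
    have a2 := mul_nonneg (mean_nonneg hq (h0 i hi)) (mean_nonneg hq (h0 j hj))
    simp only [hcov]; linarith
  have e : mean q (fun w => (∑ i ∈ s, f i w) ^ 2) - mean q (fun w => ∑ i ∈ s, f i w) ^ 2 =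
      ∑ i ∈ s, ∑ j ∈ s, cov i j := by
    have e1 : (fun w => (∑ i ∈ s, f i w) ^ 2) =
        fun w => ∑ i ∈ s, ∑ j ∈ s, f i w * f j w := by
      funext w; rw [sq, Finset.sum_mul_sum]
    rw [e1, mean_sum, mean_sum, sq, Finset.sum_mul_sum, ← Finset.sum_sub_distrib]
    refine Finset.sum_congr rfl fun i _ => ?_
    rw [mean_sum, ← Finset.sum_sub_distrib]
  -- Pairs at distance less than `r` number at most `2r` per index and have covariance at most 1;
  -- the far pairs occur twice by symmetry.
  have hsplit : ∑ i ∈ s, ∑ j ∈ s, cov i j =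
      (∑ i ∈ s, ∑ j ∈ s, if i < j + r ∧ j < i + r then cov i j else 0) +
      ((∑ i ∈ s, ∑ j ∈ s, if i + r ≤ j then cov i j else 0) +
        ∑ i ∈ s, ∑ j ∈ s, if j + r ≤ i then cov i j else 0) := by
    simp only [← Finset.sum_add_distrib]
    refine Finset.sum_congr rfl fun i _ => Finset.sum_congr rfl fun j _ => ?_
    split_ifs <;> first | omega | simp
  have hswap : (∑ i ∈ s, ∑ j ∈ s, if j + r ≤ i then cov i j else 0) =
      ∑ i ∈ s, ∑ j ∈ s, if i + r ≤ j then cov i j else 0 := by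
    rw [Finset.sum_comm]
    exact Finset.sum_congr rfl fun i _ => Finset.sum_congr rfl fun j _ => by rw [hsymm]
  have hnear : ∀ i ∈ s, (∑ j ∈ s, if i < j + r ∧ j < i + r then cov i j else 0) ≤ 2 * r := by
    intro i hi
    rw [← Finset.sum_filter]
    have hc : (s.filter fun j => i < j + r ∧ j < i + r).card ≤ 2 * r := by
      refine (Finset.card_le_card (t := Finset.Ico (i + 1 - r) (i + r)) fun j hj => ?_).trans ?_
      · simp only [Finset.mem_filter] at hj
        rw [Finset.mem_Ico]; omega
      · rw [Nat.card_Ico]; omega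
    calc _ ≤ ∑ j ∈ s with i < j + r ∧ j < i + r, (1 : ℝ) :=
          Finset.sum_le_sum fun j hj => hcov1 i hi j (Finset.mem_filter.1 hj).1
      _ = ((s.filter fun j => i < j + r ∧ j < i + r).card : ℝ) := by simp
      _ ≤ 2 * r := by exact_mod_cast hc
  have hfar : ∀ i ∈ s, (∑ j ∈ s, if i + r ≤ j then cov i j else 0) ≤ D := by
    intro i hi
    rw [← Finset.sum_filter]; exact hD i hi
  rw [e, hsplit, hswap]
  have b1 := Finset.sum_le_card_nsmul s _ _ hnear
  have b2 := Finset.sum_le_card_nsmul s _ _ hfar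
  rw [nsmul_eq_mul] at b1 b2
  linarith

/-- The number of monotone consecutive triples. -/
noncomputable def monoTriples (w : evenSignedPerm n) : ℝ :=
  ∑ k ∈ Finset.Icc 1 (n - 2), ind (IsMonoTriple k) w

/-- Triples starting at distance at least 3 use disjoint positions: with `c = i + 3` the later one
is a relative order and the earlier one is unaffected by permuting `c, …, n`. So they are
uncorrelated, and `6 = 2 · 3`. -/
theorem variance_monoTriples_le (hn : 2 ≤ n) (hq : 0 < q) :
    mean q (fun w : evenSignedPerm n => monoTriples w ^ 2) -
      mean q (monoTriples (n := n)) ^ 2 ≤ 6 * n := by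
  have h := variance_sum_le (n := n) hq (Finset.Icc 1 (n - 2)) (fun k => ind (IsMonoTriple k))
    (fun _ _ => ind_nonneg _) (fun _ _ => ind_le_one _) (r := 3) (by norm_num) (D := 0) (by
      intro i hi
      rw [Finset.mem_Icc] at hi
      refine (Finset.sum_eq_zero fun j hj => ?_).le
      simp only [Finset.mem_filter, Finset.mem_Icc] at hj
      have := mean_mul_of_isPattern hn hq (c := i + 3) (by omega)
        (isPattern_isMonoTriple (n := n) hj.2 (by omega))
        (isParabInvariant_isMonoTriple (n := n) hi.1 le_rfl)
      simp only [mul_comm] at this ⊢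
      rw [this]; ring)
  refine h.trans ?_
  have h2 : (((Finset.Icc 1 (n - 2)).card : ℕ) : ℝ) ≤ n := by
    rw [Nat.card_Icc]; exact_mod_cast (by omega)
  push_cast
  nlinarith

theorem le_mean_monoTriples (hn : 2 ≤ n) (hq : 0 < q) :
    ((n : ℝ) - 2) / 3 ≤ mean q (monoTriples (n := n)) := by
  unfold monoTriples
  rw [mean_sum]
  have h := Finset.card_nsmul_le_sum (Finset.Icc 1 (n - 2))
    (fun k => mean q (ind (IsMonoTriple (n := n) k))) (1 / 3) (fun k hk => by
      rw [Finset.mem_Icc] at hk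
      exact third_le_mean_isMonoTriple hn hq hk.1 (by omega))
  rw [Nat.card_Icc, nsmul_eq_mul, show n - 2 + 1 - 1 = n - 2 by omega, Nat.cast_sub hn] at h
  push_cast at h
  linarith

end Triples

/-! ### The total increment of the two-sided descent statistic. -/

section Gradient

variable {n : ℕ} {q : ℝ}

/-- The values of `w` at the positions `i, i + 1` differ by one. -/
def IsAdj (i : ℕ) (w : evenSignedPerm n) : Prop :=
  ev w (i + 1) = ev w i + 1 ∨ ev w (i + 1) = ev w i - 1

/-- The number of positions at which consecutive values differ by one. -/
noncomputable def adjCount (w : evenSignedPerm n) : ℝ :=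
  ∑ i ∈ Finset.Icc 1 (n - 1), ind (IsAdj i) w

/-- `w s_i w⁻¹ = s_j`. -/
def IsLink (i j : ℕ) (w : evenSignedPerm n) : Prop :=
  (ev w (genLo i) = genLo j ∧ ev w (genHi i) = genHi j) ∨
  (ev w (genLo i) = genHi j ∧ ev w (genHi i) = genLo j) ∨
  (ev w (genLo i) = -genHi j ∧ ev w (genHi i) = -genLo j) ∨
  (ev w (genLo i) = -genLo j ∧ ev w (genHi i) = -genHi j)

theorem descInd_of {i : ℕ} {w : evenSignedPerm n} (h : IsDesc i w) : descInd i w = 1 := if_pos h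

theorem descInd_of_not {i : ℕ} {w : evenSignedPerm n} (h : ¬IsDesc i w) : descInd i w = 0 :=
  if_neg h

theorem descInd_congr {i j : ℕ} {w v : evenSignedPerm n} (h : IsDesc i w ↔ IsDesc j v) :
    descInd i w = descInd j v := by
  unfold descInd; simp only [h]

theorem descInd_mem (i : ℕ) (w : evenSignedPerm n) : descInd i w = 0 ∨ descInd i w = 1 := by
  unfold descInd; split_ifs <;> simp

theorem delta_descInd_self (hn : 2 ≤ n) {i : ℕ} (hi : i < n) (w : evenSignedPerm n) :
    delta i (descInd i) w = 1 := by
  have h := isDesc_mul_gen hn hi w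
  unfold delta
  split_ifs with hd
  · rw [descInd_of hd, descInd_of_not (by tauto), sub_zero]
  · rw [descInd_of_not hd, descInd_of (by tauto), sub_zero]

theorem abs_delta_descInd_le (i j : ℕ) (w : evenSignedPerm n) :
    |delta i (descInd j) w| ≤ 1 := by
  unfold delta
  rcases descInd_mem j w with h | h <;> rcases descInd_mem j (w * gen n i) with h' | h' <;>
    rw [h, h'] <;> split_ifs <;> norm_num

theorem delta_descInd_eq_zero (hn : 2 ≤ n) {i j : ℕ} (hi : i < n)
    (h1 : genPerm i (genLo j) = genLo j) (h2 : genPerm i (genHi j) = genHi j)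
    (w : evenSignedPerm n) : delta i (descInd j) w = 0 := by
  have : descInd j (w * gen n i) = descInd j w := by
    apply descInd_congr
    rw [IsDesc, IsDesc, ev_mul_gen hn hi, ev_mul_gen hn hi, h1, h2]
  unfold delta
  rw [this]; simp

theorem delta_descInd_far (hn : 2 ≤ n) {i j : ℕ} (hi : i < n) (h1 : i ≠ j) (h2 : j ≠ i + 1)
    (h3 : i ≠ j + 1) (h4 : i = 0 → 3 ≤ j) (h5 : j = 0 → 3 ≤ i) (w : evenSignedPerm n) :
    delta i (descInd j) w = 0 := by
  have ci := genLo_genHi_cases i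
  have cj := genLo_genHi_cases j
  apply delta_descInd_eq_zero hn hi <;> rw [genPerm_apply] <;> split_ifs <;> omega

theorem mono_triple_order {x y z : ℤ} (hxy : x ≠ y) (hxz : x ≠ z) (hyz : y ≠ z) :
    (if y < x then (if z < y then (1 : ℝ) else 0) - (if z < x then 1 else 0)
      else (if z < x then 1 else 0) - (if z < y then 1 else 0)) +
    (if z < y then (if y < x then 1 else 0) - (if z < x then 1 else 0)
      else (if z < x then 1 else 0) - (if y < x then 1 else 0)) =
    (if (x < y ∧ y < z) ∨ (z < y ∧ y < x) then 1 else 0) - 1 := by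
  rcases lt_or_gt_of_ne hxy with h1 | h1 <;> rcases lt_or_gt_of_ne hxz with h2 | h2 <;>
    rcases lt_or_gt_of_ne hyz with h3 | h3 <;>
    first | omega | (simp [h1, h2, h3, h1.not_gt, h2.not_gt, h3.not_gt])

/-- Only the order of three consecutive values matters: the two increments sum to 0 for a monotone
triple and to -1 otherwise. -/
theorem delta_descInd_add (hn : 2 ≤ n) {k : ℕ} (hk : 1 ≤ k) (hkn : k + 1 < n)
    (w : evenSignedPerm n) : delta k (descInd (k + 1)) w + delta (k + 1) (descInd k) w =
      ind (IsMonoTriple k) w - 1 := by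
  have d0 : ∀ v : evenSignedPerm n, IsDesc k v ↔ ev v (k + 1) < ev v k := by
    intro v; rw [isDesc_iff_of_pos hk]
  have d1 : ∀ v : evenSignedPerm n, IsDesc (k + 1) v ↔ ev v (k + 2) < ev v (k + 1) := by
    intro v; rw [isDesc_iff_of_pos (by omega)]; push_cast; rw [add_assoc]; norm_num
  have e1 : IsDesc (k + 1) (w * gen n k) ↔ ev w (k + 2) < ev w k := by
    rw [d1, ev_mul_gen_of_pos hn hk (by omega) w (by omega),
      ev_mul_gen_of_pos hn hk (by omega) w (by omega), if_neg (by omega), if_neg (by omega),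
      if_neg (by omega), if_pos rfl]
  have e2 : IsDesc k (w * gen n (k + 1)) ↔ ev w (k + 2) < ev w k := by
    rw [d0, ev_mul_gen_of_pos hn (by omega) (by omega) w (by omega),
      ev_mul_gen_of_pos hn (by omega) (by omega) w (by omega), if_pos (by push_cast; ring),
      if_neg (by omega), if_neg (by push_cast; omega)]
    push_cast; rw [add_assoc]; norm_num
  have h := mono_triple_order (x := ev w k) (y := ev w (k + 1)) (z := ev w (k + 2))
    (by rw [Ne, ev_inj]; omega) (by rw [Ne, ev_inj]; omega) (by rw [Ne, ev_inj]; omega)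
  rw [ind_eq_ite (A := IsMonoTriple k) (p := (ev w k < ev w (k + 1) ∧
      ev w (k + 1) < ev w (k + 2)) ∨ (ev w (k + 2) < ev w (k + 1) ∧ ev w (k + 1) < ev w k))
      Iff.rfl, ← h]
  simp only [delta, descInd, d0 w, d1 w, e1, e2]

theorem sum_sum_ite_succ {n : ℕ} (f : ℕ → ℝ) :
    (∑ i ∈ Finset.range n, ∑ j ∈ Finset.range n, if 1 ≤ i ∧ j = i + 1 then f i else 0) =
      ∑ k ∈ Finset.Icc 1 (n - 2), f k := by
  have : ∀ i ∈ Finset.range n, (∑ j ∈ Finset.range n, if 1 ≤ i ∧ j = i + 1 then f i else 0) =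
      if 1 ≤ i ∧ i + 1 < n then f i else 0 := by
    intro i _
    by_cases h : 1 ≤ i
    · simp [h, Finset.sum_ite_eq']
    · simp [h]
  rw [Finset.sum_congr rfl this, ← Finset.sum_filter]
  refine Finset.sum_congr ?_ fun _ _ => rfl
  ext i
  simp only [Finset.mem_filter, Finset.mem_range, Finset.mem_Icc]
  omega

/-- The diagonal contributes `n` and neighbouring positive indices contribute `monoTriples w - (n -
2)`. The four pairs in `T`, which involve the generator `s_0`, are bounded by 1 each; all other
pairs contribute nothing. -/
theorem abs_sum_delta_descInd_sub_le (hn : 2 ≤ n) (w : evenSignedPerm n) :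
    |(∑ i ∈ Finset.range n, ∑ j ∈ Finset.range n, delta i (descInd j) w) -
      (2 + monoTriples w)| ≤ 4 := by
  set T : Finset (ℕ × ℕ) := {(0, 1), (0, 2), (1, 0), (2, 0)} with hT
  have hmemT : ∀ i j : ℕ, (i, j) ∈ T ↔ (i = 0 ∧ j = 1) ∨ (i = 0 ∧ j = 2) ∨ (i = 1 ∧ j = 0) ∨
      (i = 2 ∧ j = 0) := by
    intro i j; simp [hT]
  have hsplit : ∀ i ∈ Finset.range n, ∀ j ∈ Finset.range n, delta i (descInd j) w =
      (if i = j then 1 else 0) +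
      ((if 1 ≤ i ∧ j = i + 1 then delta i (descInd (i + 1)) w else 0) +
      (if 1 ≤ j ∧ i = j + 1 then delta (j + 1) (descInd j) w else 0)) +
      (if (i, j) ∈ T then delta i (descInd j) w else 0) := by
    intro i hi j hj
    rw [Finset.mem_range] at hi hj
    by_cases h1 : i = j
    · subst h1
      rw [if_pos rfl, if_neg (by omega), if_neg (by omega), if_neg (by rw [hmemT]; omega),
        delta_descInd_self hn hi]; norm_num
    by_cases h2 : 1 ≤ i ∧ j = i + 1
    · rw [if_neg h1, if_pos h2, if_neg (by omega), if_neg (by rw [hmemT]; omega), h2.2]; norm_num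
    by_cases h3 : 1 ≤ j ∧ i = j + 1
    · rw [if_neg h1, if_neg h2, if_pos h3, if_neg (by rw [hmemT]; omega), h3.2]; norm_num
    by_cases h4 : (i, j) ∈ T
    · rw [if_neg h1, if_neg h2, if_neg h3, if_pos h4]; norm_num
    · rw [if_neg h1, if_neg h2, if_neg h3, if_neg h4]
      rw [hmemT] at h4
      rw [delta_descInd_far hn hi (by omega) (by omega) (by omega) (by omega) (by omega)]
      norm_num
  rw [Finset.sum_congr rfl fun i hi => Finset.sum_congr rfl (hsplit i hi)]
  simp only [Finset.sum_add_distrib]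
  have s1 : (∑ i ∈ Finset.range n, ∑ j ∈ Finset.range n, if i = j then (1 : ℝ) else 0) = n := by
    have h1 : ∀ i ∈ Finset.range n, (∑ j ∈ Finset.range n, if i = j then (1 : ℝ) else 0) = 1 :=
      fun i hi => by rw [Finset.sum_ite_eq, if_pos hi]
    rw [Finset.sum_congr rfl h1]; simp
  have s3 : (∑ i ∈ Finset.range n, ∑ j ∈ Finset.range n,
      if 1 ≤ j ∧ i = j + 1 then delta (j + 1) (descInd j) w else 0) =
      ∑ k ∈ Finset.Icc 1 (n - 2), delta (k + 1) (descInd k) w := by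
    rw [Finset.sum_comm]; exact sum_sum_ite_succ _
  have s23 : (∑ k ∈ Finset.Icc 1 (n - 2), delta k (descInd (k + 1)) w) +
      ∑ k ∈ Finset.Icc 1 (n - 2), delta (k + 1) (descInd k) w =
      monoTriples w - ((n : ℝ) - 2) := by
    have h1 : ∀ k ∈ Finset.Icc 1 (n - 2), delta k (descInd (k + 1)) w +
        delta (k + 1) (descInd k) w = ind (IsMonoTriple k) w - 1 := fun k hk => by
      rw [Finset.mem_Icc] at hk
      exact delta_descInd_add hn hk.1 (by omega) w
    rw [← Finset.sum_add_distrib, Finset.sum_congr rfl h1, Finset.sum_sub_distrib, monoTriples]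
    simp [Nat.cast_sub hn]
  have s4 : |∑ i ∈ Finset.range n, ∑ j ∈ Finset.range n,
      if (i, j) ∈ T then delta i (descInd j) w else 0| ≤ 4 := by
    rw [← Finset.sum_product' (f := fun i j => if (i, j) ∈ T then delta i (descInd j) w else 0)]
    simp only [Prod.mk.eta]
    rw [← Finset.sum_filter]
    refine (Finset.abs_sum_le_sum_abs _ _).trans
      ((Finset.sum_le_card_nsmul _ _ 1 fun z _ => abs_delta_descInd_le _ _ w).trans ?_)
    rw [nsmul_eq_mul, mul_one]
    have : ((Finset.range n ×ˢ Finset.range n).filter fun x => x ∈ T).card ≤ T.card :=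
      Finset.card_le_card fun z hz => (Finset.mem_filter.1 hz).2
    have h2 : T.card ≤ 4 := Finset.card_le_four
    exact_mod_cast this.trans h2
  rw [s1, sum_sum_ite_succ fun i => delta i (descInd (i + 1)) w, s3, s23]
  convert s4 using 2
  ring

/-- With `x, y` the images under `w⁻¹` of the entries of `s_j`, multiplication by `s_i` can reverse
their order only if they form the root of `s_i` up to sign, by `genPerm_lt`. In that case `w` has a
descent at `i` exactly when `w⁻¹` has one at `j`, so the increment is `+1`. -/
theorem delta_descInd_inv (hn : 2 ≤ n) {i j : ℕ} (hi : i < n) (hj : j < n)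
    (w : evenSignedPerm n) : delta i (fun v => descInd j v⁻¹) w = ind (IsLink i j) w := by
  have ci := genLo_genHi_cases i
  have cj := genLo_genHi_cases j
  obtain ⟨x, hx⟩ : ∃ x, x = ev w⁻¹ (genLo j) := ⟨_, rfl⟩
  obtain ⟨y, hy⟩ : ∃ y, y = ev w⁻¹ (genHi j) := ⟨_, rfl⟩
  have wx : ev w x = genLo j := by rw [hx, ev_apply_inv]
  have wy : ev w y = genHi j := by rw [hy, ev_apply_inv]
  have hxm := ev_mem w⁻¹ (z := genLo j) (by omega) (by omega) (by omega)
  have hym := ev_mem w⁻¹ (z := genHi j) (by omega) (by omega) (by omega)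
  rw [← hx] at hxm
  rw [← hy] at hym
  have hxy : x ≠ y := by rintro rfl; omega
  have hxy' : x ≠ -y := by rintro rfl; rw [ev_neg] at wx; omega
  have d1 : IsDesc j w⁻¹ ↔ y < x := by rw [IsDesc, hx, hy]
  have d2 : IsDesc j (w * gen n i)⁻¹ ↔ genPerm i y < genPerm i x := by
    rw [IsDesc, mul_inv_rev, gen_inv hn hi, ev_mul_apply, ev_mul_apply, ev_gen hn hi, hx, hy]
  have hlink : IsLink i j w ↔ (x = genLo i ∧ y = genHi i) ∨ (x = genHi i ∧ y = genLo i) ∨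
      (x = -genHi i ∧ y = -genLo i) ∨ (x = -genLo i ∧ y = -genHi i) := by
    have n1 : ev w (genLo i) = -genLo j ↔ ev w (-genLo i) = ev w x := by
      rw [ev_neg, wx, neg_eq_iff_eq_neg]
    have n2 : ev w (genLo i) = -genHi j ↔ ev w (-genLo i) = ev w y := by
      rw [ev_neg, wy, neg_eq_iff_eq_neg]
    have n3 : ev w (genHi i) = -genLo j ↔ ev w (-genHi i) = ev w x := by
      rw [ev_neg, wx, neg_eq_iff_eq_neg]
    have n4 : ev w (genHi i) = -genHi j ↔ ev w (-genHi i) = ev w y := by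
      rw [ev_neg, wy, neg_eq_iff_eq_neg]
    rw [IsLink, n1, n2, n3, n4, ← wx, ← wy]
    simp only [ev_inj]
    omega
  have hdi : ∀ u v : ℤ, ev w (genLo i) = u → ev w (genHi i) = v → (IsDesc i w ↔ v < u) := by
    intro u v h1 h2; rw [IsDesc, h1, h2]
  by_cases hl : IsLink i j w
  · rw [ind_of hl]
    have gl := genPerm_genLo i
    have gh := genPerm_genHi i
    have hl' := hlink.1 hl
    have hdesc : (IsDesc i w ↔ y < x) ∧ (genPerm i y < genPerm i x ↔ ¬(y < x)) := by
      rcases hl' with ⟨rfl, rfl⟩ | ⟨rfl, rfl⟩ | ⟨rfl, rfl⟩ | ⟨rfl, rfl⟩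
      · rw [hdi _ _ wx wy, gl, gh]; omega
      · rw [hdi _ _ wy wx, gl, gh]; omega
      · rw [ev_neg] at wx wy
        rw [hdi (-genHi j) (-genLo j) (by omega) (by omega), genPerm_neg, genPerm_neg, gl, gh]
        omega
      · rw [ev_neg] at wx wy
        rw [hdi (-genLo j) (-genHi j) (by omega) (by omega), genPerm_neg, genPerm_neg, gl, gh]
        omega
    unfold delta
    beta_reduce
    split_ifs with hd
    · rw [descInd_of (d1.2 (hdesc.1.1 hd)), descInd_of_not, sub_zero]
      rw [d2, hdesc.2, ← hdesc.1]; simpa using hd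
    · rw [descInd_of_not (i := j) (w := w⁻¹), descInd_of, sub_zero]
      · rw [d2, hdesc.2, ← hdesc.1]; exact hd
      · rw [d1, ← hdesc.1]; exact hd
  · rw [ind_of_not hl]
    rw [hlink] at hl
    have hiff : genPerm i y < genPerm i x ↔ y < x := by
      rcases lt_or_gt_of_ne hxy with h | h
      · have := genPerm_lt (i := i) hxm.1 hym.1 h hxy' (fun h => hl (Or.inl h))
          fun h => hl (Or.inr (Or.inr (Or.inl h)))
        exact iff_of_false this.not_gt h.not_gt
      · have := genPerm_lt (i := i) hym.1 hxm.1 h (fun h' => hxy' (by rw [h', neg_neg]))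
          (fun h => hl (Or.inr (Or.inl ⟨h.2, h.1⟩)))
          fun h => hl (Or.inr (Or.inr (Or.inr ⟨h.2, h.1⟩)))
        exact iff_of_true this h
    have : descInd j (w * gen n i)⁻¹ = descInd j w⁻¹ := descInd_congr (by rw [d1, d2, hiff])
    unfold delta
    beta_reduce
    rw [this]; simp

theorem sum_ind_of_unique (s : Finset ℕ) (A : ℕ → evenSignedPerm n → Prop) (w : evenSignedPerm n)
    (h : ∀ i ∈ s, ∀ j ∈ s, A i w → A j w → i = j) :
    ∑ i ∈ s, ind (A i) w = ind (fun w => ∃ i ∈ s, A i w) w := by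
  by_cases hex : ∃ i ∈ s, A i w
  · rw [ind_of (A := fun w => ∃ i ∈ s, A i w) hex]
    obtain ⟨i, hi, hA⟩ := hex
    rw [Finset.sum_eq_single_of_mem i hi, ind_of hA]
    intro j hj hne
    exact ind_of_not fun hAj => hne (h j hj i hi hAj hA)
  · rw [ind_of_not (A := fun w => ∃ i ∈ s, A i w) hex]
    refine Finset.sum_eq_zero fun i hi => ind_of_not fun hA => hex ⟨i, hi, hA⟩

theorem isLink_unique_right {i j j' : ℕ} {w : evenSignedPerm n} (h : IsLink i j w)
    (h' : IsLink i j' w) : j = j' := by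
  have cj := genLo_genHi_cases j
  have cj' := genLo_genHi_cases j'
  unfold IsLink at h h'
  omega

theorem isLink_inv {i j : ℕ} {w : evenSignedPerm n} (h : IsLink i j w) : IsLink j i w⁻¹ := by
  have key : ∀ a b : ℤ, ev w a = b → ev w⁻¹ b = a := by
    rintro a b rfl; exact ev_inv_apply w a
  have key' : ∀ a b : ℤ, ev w a = -b → ev w⁻¹ b = -a := by
    intro a b h
    apply key; rw [ev_neg, h, neg_neg]
  unfold IsLink at h ⊢
  rcases h with ⟨h1, h2⟩ | ⟨h1, h2⟩ | ⟨h1, h2⟩ | ⟨h1, h2⟩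
  · exact Or.inl ⟨key _ _ h1, key _ _ h2⟩
  · exact Or.inr (Or.inl ⟨key _ _ h2, key _ _ h1⟩)
  · exact Or.inr (Or.inr (Or.inl ⟨key' _ _ h2, key' _ _ h1⟩))
  · exact Or.inr (Or.inr (Or.inr ⟨key' _ _ h1, key' _ _ h2⟩))

theorem isLink_unique_left {i i' j : ℕ} {w : evenSignedPerm n} (h : IsLink i j w)
    (h' : IsLink i' j w) : i = i' :=
  isLink_unique_right (isLink_inv h) (isLink_inv h')

/-- Values that differ by one have the same sign, as 0 is not a value; sign and direction select the
four cases of `IsLink`. -/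
theorem isAdj_iff {i : ℕ} (h1 : 1 ≤ i) (hi : i < n) (w : evenSignedPerm n) :
    (∃ j ∈ Finset.Icc 1 (n - 1), IsLink i j w) ↔ IsAdj i w := by
  have hl := ev_mem w (z := i) (by omega) (by omega) (by omega)
  have hh := ev_mem w (z := i + 1) (by omega) (by omega) (by omega)
  constructor
  · rintro ⟨j, hj, h⟩
    rw [Finset.mem_Icc] at hj
    rw [IsLink, genLo_of_pos h1, genHi_of_pos h1, genLo_of_pos hj.1, genHi_of_pos hj.1] at h
    unfold IsAdj
    omega
  · intro h
    unfold IsAdj at h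
    obtain ⟨j, hj, hj'⟩ : ∃ j : ℕ, j ∈ Finset.Icc 1 (n - 1) ∧
        ((j : ℤ) = ev w i ∧ (j : ℤ) + 1 = ev w (i + 1) ∨
        (j : ℤ) + 1 = ev w i ∧ (j : ℤ) = ev w (i + 1) ∨
        -(j : ℤ) = ev w i ∧ -((j : ℤ) + 1) = ev w (i + 1) ∨
        -((j : ℤ) + 1) = ev w i ∧ -(j : ℤ) = ev w (i + 1)) := by
      simp only [Finset.mem_Icc]
      rcases h with h | h <;> rcases lt_or_gt_of_ne hl.1 with h' | h'
      · exact ⟨(-(ev w i + 1)).toNat, by omega, by omega⟩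
      · exact ⟨(ev w i).toNat, by omega, by omega⟩
      · exact ⟨(-ev w i).toNat, by omega, by omega⟩
      · exact ⟨(ev w i - 1).toNat, by omega, by omega⟩
    refine ⟨j, hj, ?_⟩
    rw [Finset.mem_Icc] at hj
    rw [IsLink, genLo_of_pos h1, genHi_of_pos h1, genLo_of_pos hj.1, genHi_of_pos hj.1]
    omega

theorem range_eq_insert_Icc (hn : 2 ≤ n) : Finset.range n = insert 0 (Finset.Icc 1 (n - 1)) := by
  ext i
  simp only [Finset.mem_range, Finset.mem_insert, Finset.mem_Icc]
  omega

/-- Each row and column of the link matrix has at most one entry. Row 0 and column 0 therefore add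
at most 2 to the adjacencies. -/
theorem abs_sum_ind_isLink_sub_le (hn : 2 ≤ n) (w : evenSignedPerm n) :
    |(∑ i ∈ Finset.range n, ∑ j ∈ Finset.range n, ind (IsLink i j) w) - adjCount w| ≤ 2 := by
  have h0 : (0 : ℕ) ∉ Finset.Icc 1 (n - 1) := by simp
  have e : ∑ i ∈ Finset.range n, ∑ j ∈ Finset.range n, ind (IsLink i j) w =
      ∑ j ∈ Finset.range n, ind (IsLink 0 j) w +
      (∑ i ∈ Finset.Icc 1 (n - 1), ind (IsLink i 0) w + adjCount w) := by
    conv_lhs => rw [range_eq_insert_Icc hn, Finset.sum_insert h0]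
    rw [← range_eq_insert_Icc hn]
    congr 1
    rw [adjCount, ← Finset.sum_add_distrib]
    refine Finset.sum_congr rfl fun i hi => ?_
    rw [Finset.mem_Icc] at hi
    rw [range_eq_insert_Icc hn, Finset.sum_insert h0]
    congr 1
    rw [sum_ind_of_unique _ (fun j => IsLink i j) w fun _ _ _ _ h h' => isLink_unique_right h h']
    exact ind_congr (isAdj_iff hi.1 (by omega) w)
  rw [e, sum_ind_of_unique _ (fun j => IsLink 0 j) w fun _ _ _ _ h h' => isLink_unique_right h h',
    sum_ind_of_unique _ (fun i => IsLink i 0) w fun _ _ _ _ h h' => isLink_unique_left h h']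
  have a1 := ind_nonneg (fun w => ∃ i ∈ Finset.range n, IsLink 0 i w) w
  have a2 := ind_le_one (fun w => ∃ i ∈ Finset.range n, IsLink 0 i w) w
  have a3 := ind_nonneg (fun w => ∃ i ∈ Finset.Icc 1 (n - 1), IsLink i 0 w) w
  have a4 := ind_le_one (fun w => ∃ i ∈ Finset.Icc 1 (n - 1), IsLink i 0 w) w
  rw [abs_le]
  constructor <;> linarith

theorem delta_twoDes (i : ℕ) (w : evenSignedPerm n) : delta i twoDes w =
    ∑ j ∈ Finset.range n, delta i (descInd j) w +
      ∑ j ∈ Finset.range n, delta i (fun v => descInd j v⁻¹) w := by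
  unfold delta twoDes
  split_ifs <;> simp only [Finset.sum_add_distrib, Finset.sum_sub_distrib] <;> ring

theorem abs_gradSum_sub_le (hn : 2 ≤ n) (w : evenSignedPerm n) :
    |gradSum w - (2 + monoTriples w + adjCount w)| ≤ 6 := by
  have e : gradSum w = (∑ i ∈ Finset.range n, ∑ j ∈ Finset.range n, delta i (descInd j) w) +
      ∑ i ∈ Finset.range n, ∑ j ∈ Finset.range n, ind (IsLink i j) w := by
    rw [gradSum, ← Finset.sum_add_distrib]
    refine Finset.sum_congr rfl fun i hi => ?_
    rw [delta_twoDes]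
    congr 1
    exact Finset.sum_congr rfl fun j hj =>
      delta_descInd_inv hn (Finset.mem_range.1 hi) (Finset.mem_range.1 hj) w
  have h1 := abs_le.1 (abs_sum_delta_descInd_sub_le hn w)
  have h2 := abs_le.1 (abs_sum_ind_isLink_sub_le hn w)
  rw [e, abs_le]
  constructor <;> linarith [h1.1, h1.2, h2.1, h2.2]

theorem abs_delta_twoDes_le (hn : 2 ≤ n) {i : ℕ} (hi : i < n) (w : evenSignedPerm n) :
    |delta i twoDes w| ≤ 5 := by
  -- `T` contains every `j` whose descent can be affected by `s_i`. The repeated 0 only gives both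
  -- cases four listed entries.
  set T : Finset ℕ := if i = 0 then {0, 0, 1, 2} else {0, i - 1, i, i + 1} with hT
  have hTc : T.card ≤ 4 := by
    rw [hT]; split_ifs <;> exact Finset.card_le_four
  have h1 : |∑ j ∈ Finset.range n, delta i (descInd j) w| ≤ 4 := by
    refine (Finset.abs_sum_le_sum_abs _ _).trans ?_
    have hle : ∀ j ∈ Finset.range n, |delta i (descInd j) w| ≤ if j ∈ T then (1 : ℝ) else 0 := by
      intro j _
      split_ifs with hj
      · exact abs_delta_descInd_le _ _ _
      · have hj' : (i = 0 → 3 ≤ j) ∧ (1 ≤ i → j ≠ 0 ∧ j ≠ i - 1 ∧ j ≠ i ∧ j ≠ i + 1) := by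
          rw [hT] at hj
          split_ifs at hj with h0
          · simp at hj; omega
          · simp at hj; omega
        rw [delta_descInd_far hn hi (by omega) (by omega) (by omega) (by omega) (by omega)]
        simp
    refine (Finset.sum_le_sum hle).trans ?_
    rw [← Finset.sum_filter, Finset.sum_const, nsmul_eq_mul, mul_one]
    have : ((Finset.range n).filter fun x => x ∈ T).card ≤ T.card :=
      Finset.card_le_card fun z hz => (Finset.mem_filter.1 hz).2
    exact_mod_cast this.trans hTc
  have h2 : ∑ j ∈ Finset.range n, delta i (fun v => descInd j v⁻¹) w =
      ind (fun w => ∃ j ∈ Finset.range n, IsLink i j w) w := by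
    rw [Finset.sum_congr rfl fun j hj => delta_descInd_inv hn hi (Finset.mem_range.1 hj) w]
    exact sum_ind_of_unique _ (fun j => IsLink i j) w fun _ _ _ _ h h' => isLink_unique_right h h'
  rw [delta_twoDes, h2]
  refine (abs_add_le _ _).trans ?_
  rw [abs_of_nonneg (ind_nonneg _ w)]
  have := ind_le_one (fun w => ∃ j ∈ Finset.range n, IsLink i j w) w
  linarith

end Gradient

/-! ### The variance of the number of adjacencies. -/

section Adjacencies

variable {n : ℕ} {q : ℝ}

/-- No value of `w` at the positions `c, …, n` lies strictly between those at `j` and `j + 1`. -/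
def IsPatternAdj (c j : ℕ) (w : evenSignedPerm n) : Prop :=
  ∀ z : ℤ, (c : ℤ) ≤ z → z ≤ n → ¬(ev w j < ev w z ∧ ev w z < ev w (j + 1)) ∧
    ¬(ev w (j + 1) < ev w z ∧ ev w z < ev w j)

/-- The value `ev w l` follows `ev w k` among the values at the positions `c, …, n`, but is not its
successor in `ℤ`. -/
def IsGap (c : ℕ) (k l : ℤ) (w : evenSignedPerm n) : Prop :=
  ev w k < ev w l ∧ (∀ z : ℤ, (c : ℤ) ≤ z → z ≤ n → ¬(ev w k < ev w z ∧ ev w z < ev w l)) ∧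
    ev w l ≠ ev w k + 1

/-- Being consecutive among the values at later positions is a relative-order event that contains
adjacency; a gap, in one of two orders, is the exact difference. -/
theorem ind_isPatternAdj {c j : ℕ} (w : evenSignedPerm n) :
    ind (IsPatternAdj c j) w =
      ind (IsAdj j) w + (ind (IsGap c j (j + 1)) w + ind (IsGap c (j + 1) j) w) := by
  have hne : ev w j ≠ ev w (j + 1) := by rw [Ne, ev_inj]; omega
  rcases lt_or_gt_of_ne hne with h | h
  · rw [ind_of_not (A := IsGap c (j + 1) j) fun hg => h.not_gt hg.1]
    by_cases ha : IsAdj j w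
    · have ha' : ev w (j + 1) = ev w j + 1 := by unfold IsAdj at ha; omega
      rw [ind_of ha, ind_of_not (A := IsGap c j (j + 1)) fun hg => hg.2.2 ha', ind_of]
      · norm_num
      · intro z _ _; omega
    · rw [ind_of_not ha, ind_congr (B := IsGap c j (j + 1)) (w' := w)]
      · norm_num
      · refine ⟨fun hp => ⟨h, fun z h1 h2 => (hp z h1 h2).1, fun h' => ha (Or.inl h')⟩,
          fun hg z h1 h2 => ⟨hg.2.1 z h1 h2, by omega⟩⟩
  · rw [ind_of_not (A := IsGap c j (j + 1)) fun hg => h.not_gt hg.1]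
    by_cases ha : IsAdj j w
    · have ha' : ev w j = ev w (j + 1) + 1 := by unfold IsAdj at ha; omega
      rw [ind_of ha, ind_of_not (A := IsGap c (j + 1) j) fun hg => hg.2.2 ha', ind_of]
      · norm_num
      · intro z _ _; omega
    · rw [ind_of_not ha, ind_congr (B := IsGap c (j + 1) j) (w' := w)]
      · norm_num
      · refine ⟨fun hp => ⟨h, fun z h1 h2 => (hp z h1 h2).2, fun h' => ha (Or.inr (by omega))⟩,
          fun hg z h1 h2 => ⟨by omega, hg.2.1 z h1 h2⟩⟩

theorem isPattern_isPatternAdj {c j : ℕ} (hcj : c ≤ j) (hj : j + 1 ≤ n) :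
    IsPattern c (ind (IsPatternAdj (n := n) c j)) := by
  intro w w' h
  refine ind_congr (forall_congr' fun z => forall_congr' fun h1 => forall_congr' fun h2 => ?_)
  rw [h j z (by omega) (by omega) h1 h2, h z (j + 1) h1 h2 (by omega) (by omega),
    h (j + 1) z (by omega) (by omega) h1 h2, h z j h1 h2 (by omega) (by omega)]

theorem isParabInvariant_isAdj {c i : ℕ} (hi : 1 ≤ i) (hc : i + 2 ≤ c) :
    IsParabInvariant c (ind (IsAdj (n := n) i)) := by
  intro w u hu
  refine ind_congr ?_
  simp only [IsAdj, ev_mul_apply]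
  rw [ev_parab_of_lt hu (by omega : (0 : ℤ) < i) (by omega),
    ev_parab_of_lt hu (by omega : (0 : ℤ) < i + 1) (by omega)]

theorem isGap_mul_gen (hn : 2 ≤ n) {c m : ℕ} (hc : 1 ≤ c) (hcm : c ≤ m) (hm : m < n) (k l : ℤ)
    (w : evenSignedPerm n) :
    IsGap c k l (w * gen n m) ↔ IsGap c (genPerm m k) (genPerm m l) w := by
  have hs : ∀ z : ℤ, (c : ℤ) ≤ z → z ≤ n → (c : ℤ) ≤ genPerm m z ∧ genPerm m z ≤ n := by
    intro z h1 h2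
    rw [genPerm_apply, genLo_of_pos (by omega), genHi_of_pos (by omega)]
    split_ifs <;> omega
  simp only [IsGap, ev_mul_gen hn hm]
  refine and_congr_right fun _ => and_congr_left fun _ => ⟨fun h z h1 h2 => ?_, fun h z h1 h2 => ?_⟩
  · have := h (genPerm m z) (hs z h1 h2).1 (hs z h1 h2).2
    rwa [genPerm_genPerm] at this
  · exact h _ (hs z h1 h2).1 (hs z h1 h2).2

/-- The probability of a gap between the values at the positions `k` and `l`, in either order. -/
noncomputable def gapProb (n : ℕ) (q : ℝ) (c : ℕ) (k l : ℤ) : ℝ :=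
  mean q (ind (IsGap (n := n) c k l)) + mean q (ind (IsGap (n := n) c l k))

theorem gapProb_nonneg (hq : 0 < q) (c : ℕ) (k l : ℤ) : 0 ≤ gapProb n q c k l :=
  add_nonneg (mean_nonneg hq (ind_nonneg _)) (mean_nonneg hq (ind_nonneg _))

theorem gapProb_comm (c : ℕ) (k l : ℤ) : gapProb n q c k l = gapProb n q c l k := add_comm _ _

theorem min_mul_gapProb_le (hn : 2 ≤ n) (hq : 0 < q) {c m : ℕ} (hc : 1 ≤ c) (hcm : c ≤ m)
    (hm : m < n) (k l : ℤ) :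
    min q q⁻¹ * gapProb n q c k l ≤ gapProb n q c (genPerm m k) (genPerm m l) := by
  have key : ∀ k l : ℤ, min q q⁻¹ * mean q (ind (IsGap (n := n) c k l)) ≤
      mean q (ind (IsGap (n := n) c (genPerm m k) (genPerm m l))) := by
    intro k l
    refine (min_mul_mean_le hn hq hm (ind_nonneg _)).trans (le_of_eq ?_)
    congr 1; funext w
    exact ind_congr (isGap_mul_gen hn hc hcm hm k l w)
  rw [gapProb, gapProb, mul_add]
  exact add_le_add (key k l) (key l k)

theorem min_inv_pos (hq : 0 < q) : 0 < min q q⁻¹ := lt_min hq (inv_pos.2 hq)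

theorem min_inv_le_one : min q q⁻¹ ≤ 1 := by
  rcases le_total q 1 with h | h
  · exact (min_le_left _ _).trans h
  · exact (min_le_right _ _).trans (inv_le_one_of_one_le₀ h)

/-- Each transposition of neighbouring positions inside `c, …, n` moves the second end of the gap
one step and costs at most the factor `min q q⁻¹`. -/
theorem pow_mul_gapProb_le_right (hn : 2 ≤ n) (hq : 0 < q) {c j : ℕ} (hc : 1 ≤ c) (hcj : c ≤ j)
    (r : ℕ) (hr : j + 1 + r ≤ n) :
    min q q⁻¹ ^ r * gapProb n q c j (j + 1) ≤ gapProb n q c j ((j + 1 + r : ℕ) : ℤ) := by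
  induction r with
  | zero => simp
  | succ r ih =>
    have h1 := min_mul_gapProb_le (q := q) hn hq (m := j + 1 + r) hc (by omega) (by omega)
      (j : ℤ) ((j + 1 + r : ℕ) : ℤ)
    have e1 : genPerm (j + 1 + r) (j : ℤ) = j := by
      rw [genPerm_apply, genLo_of_pos (by omega), genHi_of_pos (by omega)]
      split_ifs <;> omega
    have e2 : genPerm (j + 1 + r) ((j + 1 + r : ℕ) : ℤ) = ((j + 1 + (r + 1) : ℕ) : ℤ) := by
      rw [genPerm_apply, genLo_of_pos (by omega), genHi_of_pos (by omega)]
      split_ifs <;> omega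
    rw [e1, e2] at h1
    rw [pow_succ', mul_assoc]
    exact (mul_le_mul_of_nonneg_left (ih (by omega)) (min_inv_pos hq).le).trans h1

theorem pow_mul_gapProb_le_left (hn : 2 ≤ n) (hq : 0 < q) {c j : ℕ} (hc : 1 ≤ c) (hj : j + 1 ≤ n)
    (r : ℕ) (hr : c + r ≤ j) :
    min q q⁻¹ ^ r * gapProb n q c j (j + 1) ≤ gapProb n q c ((j - r : ℕ) : ℤ) (j + 1) := by
  induction r with
  | zero => simp
  | succ r ih =>
    have h1 := min_mul_gapProb_le (q := q) hn hq (m := j - (r + 1)) hc (by omega) (by omega)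
      ((j - r : ℕ) : ℤ) ((j : ℤ) + 1)
    have e1 : genPerm (j - (r + 1)) ((j - r : ℕ) : ℤ) = ((j - (r + 1) : ℕ) : ℤ) := by
      rw [genPerm_apply, genLo_of_pos (by omega), genHi_of_pos (by omega)]
      split_ifs <;> omega
    have e2 : genPerm (j - (r + 1)) ((j : ℤ) + 1) = j + 1 := by
      rw [genPerm_apply, genLo_of_pos (by omega), genHi_of_pos (by omega)]
      split_ifs <;> omega
    rw [e1, e2] at h1
    rw [pow_succ', mul_assoc]
    exact (mul_le_mul_of_nonneg_left (ih (by omega)) (min_inv_pos hq).le).trans h1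

theorem geom_sum_add_le {x : ℝ} (h0 : 0 ≤ x) (h1 : x ≤ 1) (s t : ℕ) :
    ∑ r ∈ Finset.range (s + t), x ^ r ≤
      ∑ r ∈ Finset.range s, x ^ r + ∑ r ∈ Finset.range t, x ^ r := by
  rw [Finset.sum_range_add]
  exact add_le_add le_rfl
    (Finset.sum_le_sum fun r _ => pow_le_pow_of_le_one h0 h1 (Nat.le_add_left r s))

/-- The gap at `(j, j + 1)` spreads to `(j, l)` for `l > j` and to `(j + 1, l)` for `l ≤ j`. The two
ranges have `n + 1 - c` terms in all, and splitting a geometric sum with ratio at most 1 only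
increases it. -/
theorem geom_sum_mul_gapProb_le (hn : 2 ≤ n) (hq : 0 < q) {c j : ℕ} (hc : 1 ≤ c) (hcj : c ≤ j)
    (hj : j < n) :
    (∑ r ∈ Finset.range (n + 1 - c), min q q⁻¹ ^ r) * gapProb n q c j (j + 1) ≤
      ∑ l ∈ Finset.Icc c n, gapProb n q c j l +
        ∑ l ∈ Finset.Icc c n, gapProb n q c ((j + 1 : ℕ) : ℤ) l := by
  have h1 : (∑ r ∈ Finset.range (n - j), min q q⁻¹ ^ r) * gapProb n q c j (j + 1) ≤
      ∑ l ∈ Finset.Icc c n, gapProb n q c j l := by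
    rw [Finset.sum_mul]
    calc _ ≤ ∑ r ∈ Finset.range (n - j), gapProb n q c j ((j + 1 + r : ℕ) : ℤ) := by
          refine Finset.sum_le_sum fun r hr => ?_
          rw [Finset.mem_range] at hr
          exact pow_mul_gapProb_le_right hn hq hc hcj r (by omega)
      _ = ∑ l ∈ (Finset.range (n - j)).image (fun r => j + 1 + r), gapProb n q c j l := by
          rw [Finset.sum_image]
          intro a _ b _ h; simpa using h
      _ ≤ _ := by
          refine Finset.sum_le_sum_of_subset_of_nonneg ?_ fun _ _ _ => gapProb_nonneg hq _ _ _
          intro l hl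
          simp only [Finset.mem_image, Finset.mem_range] at hl
          rw [Finset.mem_Icc]; omega
  have h2 : (∑ r ∈ Finset.range (j + 1 - c), min q q⁻¹ ^ r) * gapProb n q c j (j + 1) ≤
      ∑ l ∈ Finset.Icc c n, gapProb n q c ((j + 1 : ℕ) : ℤ) l := by
    rw [Finset.sum_mul]
    calc _ ≤ ∑ r ∈ Finset.range (j + 1 - c), gapProb n q c ((j + 1 : ℕ) : ℤ) ((j - r : ℕ) : ℤ) := by
          refine Finset.sum_le_sum fun r hr => ?_
          rw [Finset.mem_range] at hr
          rw [gapProb_comm c ((j + 1 : ℕ) : ℤ)]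
          exact_mod_cast pow_mul_gapProb_le_left hn hq hc (by omega) r (by omega)
      _ = ∑ l ∈ (Finset.range (j + 1 - c)).image (fun r => j - r),
            gapProb n q c ((j + 1 : ℕ) : ℤ) l := by
          rw [Finset.sum_image]
          intro a ha b hb h
          simp only [Finset.coe_range, Set.mem_Iio] at ha hb
          simp only at h
          omega
      _ ≤ _ := by
          refine Finset.sum_le_sum_of_subset_of_nonneg ?_ fun _ _ _ => gapProb_nonneg hq _ _ _
          intro l hl
          simp only [Finset.mem_image, Finset.mem_range] at hl
          rw [Finset.mem_Icc]; omega
  have h3 := geom_sum_add_le (min_inv_pos hq).le min_inv_le_one (n - j) (j + 1 - c)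
  rw [show n - j + (j + 1 - c) = n + 1 - c by omega] at h3
  have h4 := mul_le_mul_of_nonneg_right h3 (gapProb_nonneg (n := n) hq c j (j + 1))
  rw [add_mul] at h4
  linarith

/-- The number of gaps between the values of `w` at the positions `c, …, n`. -/
noncomputable def gapCount (c : ℕ) (w : evenSignedPerm n) : ℝ :=
  ∑ k ∈ Finset.Icc c n, ∑ l ∈ Finset.Icc c n, ind (IsGap c k l) w

/-- Each row sum of `gapProb` is used at most twice, once as `j` and once as `j + 1`, and `gapProb`
itself counts both orders: hence the factor 4. -/
theorem sum_gapProb_le (hn : 2 ≤ n) (hq : 0 < q) {c : ℕ} (hc : 1 ≤ c) :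
    (∑ r ∈ Finset.range (n + 1 - c), min q q⁻¹ ^ r) *
      ∑ j ∈ Finset.Ico c n, gapProb n q c j (j + 1) ≤ 4 * mean q (gapCount (n := n) c) := by
  have htot : ∑ k ∈ Finset.Icc c n, ∑ l ∈ Finset.Icc c n, gapProb n q c k l =
      2 * mean q (gapCount (n := n) c) := by
    have e : mean q (gapCount (n := n) c) =
        ∑ k ∈ Finset.Icc c n, ∑ l ∈ Finset.Icc c n, mean q (ind (IsGap (n := n) c k l)) := by
      unfold gapCount
      rw [mean_sum]
      exact Finset.sum_congr rfl fun k _ => mean_sum _ _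
    simp only [gapProb, Finset.sum_add_distrib]
    rw [Finset.sum_comm (f := fun k l : ℕ => mean q (ind (IsGap (n := n) c l k))), e]
    ring
  have hY : ∀ k : ℕ, 0 ≤ ∑ l ∈ Finset.Icc c n, gapProb n q c k l := fun k =>
    Finset.sum_nonneg fun _ _ => gapProb_nonneg hq _ _ _
  rw [Finset.mul_sum]
  calc _ ≤ ∑ j ∈ Finset.Ico c n, (∑ l ∈ Finset.Icc c n, gapProb n q c j l +
        ∑ l ∈ Finset.Icc c n, gapProb n q c ((j + 1 : ℕ) : ℤ) l) := by
        refine Finset.sum_le_sum fun j hj => ?_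
        rw [Finset.mem_Ico] at hj
        exact geom_sum_mul_gapProb_le hn hq hc hj.1 hj.2
    _ = ∑ j ∈ Finset.Ico c n, ∑ l ∈ Finset.Icc c n, gapProb n q c j l +
        ∑ j ∈ Finset.Ico (c + 1) (n + 1), ∑ l ∈ Finset.Icc c n, gapProb n q c j l := by
        rw [Finset.sum_add_distrib, ← Finset.sum_Ico_add' (fun j : ℕ =>
          ∑ l ∈ Finset.Icc c n, gapProb n q c j l) c n 1]
    _ ≤ ∑ j ∈ Finset.Icc c n, ∑ l ∈ Finset.Icc c n, gapProb n q c j l +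
        ∑ j ∈ Finset.Icc c n, ∑ l ∈ Finset.Icc c n, gapProb n q c j l := by
        refine add_le_add (Finset.sum_le_sum_of_subset_of_nonneg ?_ fun k _ _ => hY k)
          (Finset.sum_le_sum_of_subset_of_nonneg ?_ fun k _ _ => hY k) <;> intro x <;>
          simp only [Finset.mem_Ico, Finset.mem_Icc] <;> omega
    _ = _ := by rw [htot]; ring

theorem sum_ind_isGap (c k : ℕ) (w : evenSignedPerm n) :
    ∑ l ∈ Finset.Icc c n, ind (IsGap c k l) w =
      ind (fun w => ∃ l ∈ Finset.Icc c n, IsGap c k l w) w := by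
  refine sum_ind_of_unique _ (fun l => IsGap c k l) w fun l hl l' hl' h h' => ?_
  rw [Finset.mem_Icc] at hl hl'
  have h1 := h.2.1 l' (by omega) (by omega)
  have h2 := h'.2.1 l (by omega) (by omega)
  have : ev w l = ev w l' := by have := h.1; have := h'.1; omega
  rw [ev_inj] at this
  omega

theorem gapCount_le (c : ℕ) (w : evenSignedPerm n) : gapCount c w ≤ ((n + 1 - c : ℕ) : ℝ) := by
  unfold gapCount
  simp only [sum_ind_isGap]
  refine (Finset.sum_le_card_nsmul _ _ 1 fun k _ => ind_le_one _ w).trans ?_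
  rw [nsmul_eq_mul, mul_one, Nat.card_Icc]

/-- `w` maps `z` to one of `c, …, n`. -/
def MapsTop (c : ℕ) (z : ℤ) (w : evenSignedPerm n) : Prop := (c : ℤ) ≤ ev w z ∧ ev w z ≤ n

/-- The number of ascents between values in `c, …, n` and the others, read from `1` to `n` and from
`-n` to `-1`. -/
noncomputable def downCount (c : ℕ) (w : evenSignedPerm n) : ℝ :=
  ∑ j ∈ Finset.Icc 1 (n - 1), (ind (fun w => MapsTop c j w ∧ ¬MapsTop c (j + 1) w) w +
    ind (fun w => MapsTop c (-(j + 1)) w ∧ ¬MapsTop c (-j) w) w)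

/-- The reverse of `downCount`. -/
noncomputable def upCount (c : ℕ) (w : evenSignedPerm n) : ℝ :=
  ∑ j ∈ Finset.Icc 1 (n - 1), (ind (fun w => MapsTop c (j + 1) w ∧ ¬MapsTop c j w) w +
    ind (fun w => MapsTop c (-j) w ∧ ¬MapsTop c (-(j + 1)) w) w)

/-- Exchanging the positions `j, j + 1` turns an entry into the block `c, …, n` into an exit. Exits
counted here are descents, so they carry the extra weight `q`. -/
theorem mean_downCount (hn : 2 ≤ n) (c : ℕ) :
    mean q (downCount (n := n) c) = q * mean q (upCount (n := n) c) := by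
  unfold downCount upCount
  rw [mean_sum, mean_sum, Finset.mul_sum]
  refine Finset.sum_congr rfl fun j hj => ?_
  rw [Finset.mem_Icc] at hj
  have s1 : ∀ w : evenSignedPerm n, ev (w * gen n j) j = ev w (j + 1) := fun w => by
    rw [ev_mul_gen_of_pos hn hj.1 (by omega) w (by omega), if_pos rfl]
  have s2 : ∀ w : evenSignedPerm n, ev (w * gen n j) (j + 1) = ev w j := fun w => by
    rw [ev_mul_gen_of_pos hn hj.1 (by omega) w (by omega), if_neg (by omega), if_pos rfl]
  rw [mean_add, mean_add, mul_add]
  congr 1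
  · refine mean_ind_transfer hn (i := j) (by omega) ?_ ?_ ?_ <;> intro w <;>
      simp only [isDesc_iff_of_pos hj.1, MapsTop, s1, s2]
    · have := ev_mem w (z := j + 1) (by omega) (by omega) (by omega)
      omega
    · have := ev_mem w (z := j) (by omega) (by omega) (by omega)
      omega
    · simp
  · refine mean_ind_transfer hn (i := j) (by omega) ?_ ?_ ?_ <;> intro w <;>
      simp only [isDesc_iff_of_pos hj.1, MapsTop, ev_neg, s1, s2]
    · have := ev_mem w (z := j) (by omega) (by omega) (by omega)
      omega
    · have := ev_mem w (z := j + 1) (by omega) (by omega) (by omega)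
      omega
    · simp

theorem ind_and_not_sub (A B : evenSignedPerm n → Prop) (w : evenSignedPerm n) :
    ind (fun w => A w ∧ ¬B w) w - ind (fun w => B w ∧ ¬A w) w = ind A w - ind B w := by
  by_cases hA : A w <;> by_cases hB : B w <;> simp [ind, hA, hB]

/-- Exits minus entries telescope along each of the two runs `1, …, n` and `-n, …, -1`, leaving only
boundary terms. -/
theorem abs_downCount_sub_upCount_le (hn : 2 ≤ n) (c : ℕ) (w : evenSignedPerm n) :
    |downCount c w - upCount c w| ≤ 2 := by
  have e : downCount c w - upCount c w = (ind (MapsTop c 1) w - ind (MapsTop c n) w) +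
      (ind (MapsTop c (-n)) w - ind (MapsTop c (-1)) w) := by
    set f : ℕ → ℝ := fun j => ind (MapsTop c (-(j + 1 : ℕ))) w - ind (MapsTop c (j + 1 : ℕ)) w
      with hf
    have h := Finset.sum_range_sub f (n - 1)
    have hre : ∑ j ∈ Finset.Icc 1 (n - 1), (f j - f (j - 1)) =
        ∑ i ∈ Finset.range (n - 1), (f (i + 1) - f i) := by
      rw [← Finset.Ico_add_one_right_eq_Icc, Finset.sum_Ico_eq_sum_range]
      refine Finset.sum_congr rfl fun i _ => ?_
      rw [add_comm 1 i, Nat.add_sub_cancel]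
    have hD : downCount c w - upCount c w = ∑ j ∈ Finset.Icc 1 (n - 1), (f j - f (j - 1)) := by
      unfold downCount upCount
      rw [← Finset.sum_sub_distrib]
      refine Finset.sum_congr rfl fun j hj => ?_
      rw [Finset.mem_Icc] at hj
      have a1 := ind_and_not_sub (MapsTop c j) (MapsTop c (j + 1)) w
      have a2 := ind_and_not_sub (MapsTop c (-((j : ℤ) + 1))) (MapsTop c (-j)) w
      simp only [hf]
      rw [show j - 1 + 1 = j by omega]
      push_cast
      linarith
    rw [hD, hre, h, hf]
    beta_reduce
    rw [show n - 1 + 1 = n by omega]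
    push_cast
    ring
  rw [e, abs_le]
  have a1 := ind_nonneg (MapsTop c 1) w
  have a2 := ind_le_one (MapsTop c 1) w
  have b1 := ind_nonneg (MapsTop c n) w
  have b2 := ind_le_one (MapsTop c n) w
  have c1 := ind_nonneg (MapsTop c (-n)) w
  have c2 := ind_le_one (MapsTop c (-n)) w
  have d1 := ind_nonneg (MapsTop c (-1)) w
  have d2 := ind_le_one (MapsTop c (-1)) w
  constructor <;> linarith

theorem mean_downCount_le (hn : 2 ≤ n) (hq : 0 < q) (c : ℕ) :
    (1 - min q q⁻¹) * mean q (downCount (n := n) c) ≤ 2 := by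
  have h1 := mean_downCount (q := q) hn c
  have h2 : |mean q (downCount (n := n) c) - mean q (upCount (n := n) c)| ≤ 2 := by
    rw [← mean_sub]
    exact (abs_mean_le hq _).trans (mean_le_of_le hq fun w => abs_downCount_sub_upCount_le hn c w)
  have h3 : 0 ≤ mean q (upCount (n := n) c) := mean_nonneg hq fun w =>
    Finset.sum_nonneg fun j _ => add_nonneg (ind_nonneg _ w) (ind_nonneg _ w)
  rw [abs_le] at h2
  set u := mean q (upCount (n := n) c)
  rw [h1] at h2 ⊢
  rcases le_total q 1 with h | h
  · have hle : q ≤ q⁻¹ := h.trans (one_le_inv_iff₀.2 ⟨hq, h⟩)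
    rw [min_eq_left hle]
    have : (1 - q) * u ≤ 2 := by linarith
    have h5 : 0 ≤ (1 - q) * u := mul_nonneg (by linarith) h3
    nlinarith
  · have hle : q⁻¹ ≤ q := (inv_le_one_of_one_le₀ h).trans h
    rw [min_eq_right hle]
    have : (1 - q⁻¹) * (q * u) = q * u - u := by field_simp
    linarith

/-- If a gap starts at the value `v`, then `v + 1` is not taken at a position in `c, …, n`, so `w⁻¹`
leaves this block between `v` and `v + 1`. -/
theorem gapCount_le_downCount {c : ℕ} (hc : 1 ≤ c) (w : evenSignedPerm n) :
    gapCount c w ≤ 1 + downCount c w⁻¹ := by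
  classical
  set K := (Finset.Icc c n).filter fun k : ℕ => ¬MapsTop c (ev w k + 1) w⁻¹ ∧ ev w k < n with hK
  set D1 := (Finset.Icc 1 (n - 1)).filter fun j : ℕ => MapsTop c j w⁻¹ ∧ ¬MapsTop c (j + 1) w⁻¹
    with hD1
  set D2 := (Finset.Icc 1 (n - 1)).filter fun j : ℕ =>
    MapsTop c (-(j + 1)) w⁻¹ ∧ ¬MapsTop c (-j) w⁻¹ with hD2
  have h1 : gapCount c w ≤ K.card := by
    unfold gapCount
    simp only [sum_ind_isGap]
    rw [hK, Finset.card_filter]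
    push_cast
    refine Finset.sum_le_sum fun k hk => ?_
    by_cases hex : ∃ l ∈ Finset.Icc c n, IsGap c k l w
    · rw [if_pos]
      · exact ind_le_one _ w
      obtain ⟨l, hl, hg⟩ := hex
      rw [Finset.mem_Icc] at hl
      have hlm := ev_mem w (z := l) (by omega) (by omega) (by omega)
      refine ⟨fun hm => ?_, ?_⟩
      · have := hg.2.1 _ hm.1 hm.2
        rw [ev_apply_inv] at this
        have := hg.1
        have := hg.2.2
        omega
      · have := hg.1
        omega
    · rw [ind_of_not (A := fun w => ∃ l ∈ Finset.Icc c n, IsGap c k l w) hex]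
      split_ifs <;> norm_num
  have h2 : K.card ≤ 1 + (D1.card + D2.card) := by
    have hinj : Function.Injective fun k : ℕ => ev w (k : ℤ) := fun a b h => by
      have := (ev_inj w).1 h; omega
    rw [← Finset.card_image_of_injective K hinj]
    have hsub : K.image (fun k : ℕ => ev w (k : ℤ)) ⊆ {(-1 : ℤ)} ∪
        (D1.image (fun j : ℕ => (j : ℤ)) ∪ D2.image fun j : ℕ => -((j : ℤ) + 1)) := by
      intro v hv
      rw [Finset.mem_image] at hv
      obtain ⟨k, hk, rfl⟩ := hv
      rw [hK, Finset.mem_filter, Finset.mem_Icc] at hk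
      obtain ⟨hk1, hk2, hk3⟩ := hk
      have hm := ev_mem w (z := k) (by omega) (by omega) (by omega)
      have hv : MapsTop c (ev w k) w⁻¹ := by
        rw [MapsTop, ev_inv_apply]; omega
      set v := ev w k
      rw [Finset.mem_union, Finset.mem_union, Finset.mem_singleton, Finset.mem_image,
        Finset.mem_image]
      rcases lt_or_gt_of_ne hm.1 with h | h
      · by_cases hv1 : v = -1
        · exact Or.inl hv1
        · have e1 : -((((-v - 1).toNat : ℕ) : ℤ) + 1) = v := by omega
          have e2 : -(((-v - 1).toNat : ℕ) : ℤ) = v + 1 := by omega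
          refine Or.inr (Or.inr ⟨(-v - 1).toNat, ?_, e1⟩)
          rw [hD2, Finset.mem_filter, Finset.mem_Icc, e1, e2]
          exact ⟨by omega, hv, hk2⟩
      · have e1 : ((v.toNat : ℕ) : ℤ) = v := by omega
        refine Or.inr (Or.inl ⟨v.toNat, ?_, e1⟩)
        rw [hD1, Finset.mem_filter, Finset.mem_Icc, e1]
        exact ⟨by omega, hv, hk2⟩
    refine (Finset.card_le_card hsub).trans ((Finset.card_union_le _ _).trans ?_)
    rw [Finset.card_singleton]
    exact Nat.add_le_add_left ((Finset.card_union_le _ _).trans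
      (Nat.add_le_add Finset.card_image_le Finset.card_image_le)) _
  have h3 : downCount c w⁻¹ = D1.card + D2.card := by
    unfold downCount
    rw [Finset.sum_add_distrib, hD1, hD2, Finset.card_filter, Finset.card_filter]
    push_cast
    congr 1 <;> exact Finset.sum_congr rfl fun j _ => ind_eq_ite Iff.rfl
  rw [h3]
  refine h1.trans ?_
  exact_mod_cast h2

/-- With `a = n + 1 - c` positions, the mean is at most `a` and, by the exit count, at most `3 / (1
- x)` when `x < 1`. The geometric sum `S` is comparable to the smaller of `a` and `1 / (1 - x)`. -/
theorem mean_gapCount_le (hn : 2 ≤ n) (hq : 0 < q) {c : ℕ} (hc : 1 ≤ c) :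
    mean q (gapCount (n := n) c) ≤ 6 * ∑ r ∈ Finset.range (n + 1 - c), min q q⁻¹ ^ r := by
  set x := min q q⁻¹ with hx
  set a := n + 1 - c with ha
  set S := ∑ r ∈ Finset.range a, x ^ r with hS
  set g := mean q (gapCount (n := n) c) with hg
  have hx0 := min_inv_pos hq
  have hx1 := min_inv_le_one (q := q)
  rw [← hx] at hx0 hx1
  have hg0 : 0 ≤ g := mean_nonneg hq fun w =>
    Finset.sum_nonneg fun _ _ => Finset.sum_nonneg fun _ _ => ind_nonneg _ w
  have hga : g ≤ a := mean_le_of_le hq fun w => gapCount_le c w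
  have hgt : (1 - x) * g ≤ 3 := by
    have h1 : g ≤ 1 + mean q (downCount (n := n) c) := by
      rw [← mean_inv hn (downCount c), ← mean_const (n := n) hq 1, ← mean_add]
      exact mean_mono hq fun w => gapCount_le_downCount hc w
    have h2 := mean_downCount_le hn hq c
    rw [← hx] at h2
    nlinarith
  have hSa : (a : ℝ) ≤ S * (1 + a * (1 - x)) := by
    have h1 : S * (1 - x) = 1 - x ^ a := by
      have := geom_sum_mul x a
      rw [← hS] at this
      linarith
    have h2 : a * x ^ a ≤ S := by
      have := Finset.card_nsmul_le_sum (Finset.range a) (fun r => x ^ r) (x ^ a) fun r hr =>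
        pow_le_pow_of_le_one hx0.le hx1 (Finset.mem_range.1 hr).le
      rwa [Finset.card_range, nsmul_eq_mul] at this
    have h3 : S * (1 + a * (1 - x)) = S + a * (1 - x ^ a) := by rw [← h1]; ring
    rw [h3]; linarith
  have hS0 : 0 ≤ S := Finset.sum_nonneg fun r _ => pow_nonneg hx0.le r
  -- If `a (1 - x) ≤ 1` then `a ≤ 2 S`; otherwise `1 ≤ 2 (1 - x) S`, and `(1 - x) g ≤ 3` gives the
  -- factor 6.
  rcases le_total ((a : ℝ) * (1 - x)) 1 with h | h
  · nlinarith
  · have ha0 : (0 : ℝ) < a := by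
      by_contra h0
      have : (a : ℝ) = 0 := le_antisymm (not_lt.1 h0) (Nat.cast_nonneg a)
      rw [this] at h; linarith
    have h1 : 1 ≤ 2 * ((1 - x) * S) := by
      have : (a : ℝ) * 1 ≤ a * (2 * ((1 - x) * S)) := by nlinarith
      exact le_of_mul_le_mul_left this ha0
    nlinarith

theorem sum_gapProb_le_const (hn : 2 ≤ n) (hq : 0 < q) {c : ℕ} (hc : 1 ≤ c) :
    ∑ j ∈ Finset.Ico c n, gapProb n q c j (j + 1) ≤ 24 := by
  rcases le_or_gt n c with h | h
  · rw [Finset.Ico_eq_empty (by omega)]; norm_num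
  have h1 := sum_gapProb_le hn hq (n := n) hc
  have h2 := mean_gapCount_le hn hq (n := n) hc
  have hS0 : 0 < ∑ r ∈ Finset.range (n + 1 - c), min q q⁻¹ ^ r :=
    Finset.sum_pos (fun r _ => pow_pos (min_inv_pos hq) r)
      (Finset.nonempty_range_iff.2 (by omega))
  have h3 := h1.trans (mul_le_mul_of_nonneg_left h2 (by norm_num : (0 : ℝ) ≤ 4))
  refine le_of_mul_le_mul_left (a := ∑ r ∈ Finset.range (n + 1 - c), min q q⁻¹ ^ r) ?_ hS0
  linarith

/-- For `j ≥ i + 2`, enlarging adjacency at `j` to its relative-order version makes it independent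
of adjacency at `i`, so the covariance is at most the gap probability. The constant is `2 · 2 + 2 ·
24`. -/
theorem variance_adjCount_le (hn : 2 ≤ n) (hq : 0 < q) :
    mean q (fun w : evenSignedPerm n => adjCount w ^ 2) -
      mean q (adjCount (n := n)) ^ 2 ≤ 52 * n := by
  have h := variance_sum_le (n := n) hq (Finset.Icc 1 (n - 1)) (fun k => ind (IsAdj k))
    (fun _ _ => ind_nonneg _) (fun _ _ => ind_le_one _) (r := 2) (by norm_num) (D := 24) (by
      intro i hi
      rw [Finset.mem_Icc] at hi
      refine le_trans ?_ (sum_gapProb_le_const (n := n) hn hq (c := i + 2) (by omega))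
      have hset : (Finset.Icc 1 (n - 1)).filter (fun j => i + 2 ≤ j) = Finset.Ico (i + 2) n := by
        ext j
        simp only [Finset.mem_filter, Finset.mem_Icc, Finset.mem_Ico]
        omega
      rw [hset]
      refine Finset.sum_le_sum fun j hj => ?_
      rw [Finset.mem_Ico] at hj
      have h1 := mean_mul_of_isPattern hn hq (c := i + 2) (by omega)
        (isPattern_isPatternAdj (n := n) hj.1 (by omega))
        (isParabInvariant_isAdj (n := n) hi.1 le_rfl)
      have h2 : mean q (ind (IsPatternAdj (n := n) (i + 2) j)) =
          mean q (ind (IsAdj (n := n) j)) + gapProb n q (i + 2) j (j + 1) := by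
        rw [gapProb, ← mean_add, ← mean_add]
        congr 1; funext w
        exact ind_isPatternAdj w
      have h3 : mean q (fun w : evenSignedPerm n => ind (IsAdj i) w * ind (IsAdj j) w) ≤
          mean q (fun w : evenSignedPerm n => ind (IsPatternAdj (i + 2) j) w * ind (IsAdj i) w) := by
        refine mean_mono hq fun w => ?_
        rw [mul_comm]
        refine mul_le_mul_of_nonneg_right ?_ (ind_nonneg _ w)
        rw [ind_isPatternAdj]
        have := ind_nonneg (IsGap (i + 2) j (j + 1)) w
        have := ind_nonneg (IsGap (i + 2) (j + 1) j) w
        linarith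
      rw [h1, h2] at h3
      have h4 : mean q (ind (IsAdj (n := n) i)) ≤ 1 := mean_le_of_le hq fun w => ind_le_one _ w
      have h5 := gapProb_nonneg (n := n) hq (i + 2) j (j + 1)
      nlinarith)
  refine h.trans ?_
  have h2 : (((Finset.Icc 1 (n - 1)).card : ℕ) : ℝ) ≤ n := by
    rw [Nat.card_Icc]; exact_mod_cast (by omega)
  push_cast
  nlinarith

end Adjacencies

/-! ### Constants and the passage to measure-theoretic expectations. -/

section Assembly

variable {n : ℕ} {q : ℝ}

theorem abs_le_toReal_supNorm {f : ℝ → ℝ} (hf : supNorm f ≠ ∞) (x : ℝ) :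
    |f x| ≤ (supNorm f).toReal := by
  have h1 : ‖f x‖ₑ ≤ supNorm f := le_iSup (fun x => ‖f x‖ₑ) x
  have h2 := ENNReal.toReal_mono hf h1
  rwa [toReal_enorm, Real.norm_eq_abs] at h2

/-- The exceptional set is countable, so the fundamental theorem of calculus holds off it; `deriv h`
is integrable on intervals because it is measurable and bounded. -/
theorem PiecewiseContDiff.lipschitz {h : ℝ → ℝ} (hh : PiecewiseContDiff h)
    (hs : supNorm (deriv h) ≠ ∞) (x y : ℝ) :
    |h x - h y| ≤ (supNorm (deriv h)).toReal * |x - y| := by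
  obtain ⟨hc, s, hfin, hd⟩ := hh
  have hcount : s.Countable := by
    have e : s = ⋃ k : ℕ, s ∩ Set.Icc (-(k : ℝ)) k := by
      ext z
      simp only [Set.mem_iUnion, Set.mem_inter_iff, Set.mem_Icc]
      constructor
      · intro hz
        obtain ⟨k, hk⟩ := exists_nat_ge |z|
        exact ⟨k, hz, (abs_le.1 hk).1, (abs_le.1 hk).2⟩
      · rintro ⟨_, hz, _⟩
        exact hz
    rw [e]
    exact Set.countable_iUnion fun k => (hfin _ _).countable
  have hb := abs_le_toReal_supNorm hs
  have hint : IntervalIntegrable (deriv h) volume y x :=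
    (intervalIntegrable_const (c := (supNorm (deriv h)).toReal)).mono_fun
      (measurable_deriv h).aestronglyMeasurable
      (Filter.Eventually.of_forall fun z =>
        (hb z).trans (le_abs_self _))
  have hF := integral_eq_of_hasDerivAt_off_countable h (deriv h) hcount hc.continuousOn
    (fun z hz => ((hd z hz.2).differentiableAt (by norm_num)).hasDerivAt) hint
  rw [← hF, ← Real.norm_eq_abs]
  exact intervalIntegral.norm_integral_le_of_norm_le_const fun z _ => hb z

theorem mean_abs_gradSum_sub_le (hn : 2 ≤ n) (hq : 0 < q) :
    mean q (fun w : evenSignedPerm n => |gradSum w - mean q (gradSum (n := n))|) ≤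
      √(6 * n) + √(52 * n) + 12 := by
  set F : evenSignedPerm n → ℝ := fun w => gradSum w - (2 + monoTriples w + adjCount w) with hF
  have hFb : ∀ w, |F w| ≤ 6 := abs_gradSum_sub_le hn
  have h1 := (mean_abs_sub_le_sqrt hq (monoTriples (n := n))).trans
    (Real.sqrt_le_sqrt (variance_monoTriples_le hn hq))
  have h2 := (mean_abs_sub_le_sqrt hq (adjCount (n := n))).trans
    (Real.sqrt_le_sqrt (variance_adjCount_le hn hq))
  have hm : mean q (gradSum (n := n)) =
      mean q F + (2 + mean q (monoTriples (n := n)) + mean q (adjCount (n := n))) := by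
    rw [← mean_const (n := n) hq 2, ← mean_add, ← mean_add, ← mean_add]
    congr 1; funext w; simp only [hF]; ring
  have hmF : |mean q F| ≤ 6 := (abs_mean_le hq F).trans (mean_le_of_le hq hFb)
  have h3 : mean q (fun w : evenSignedPerm n => |gradSum w - mean q (gradSum (n := n))|) ≤
      mean q (fun w : evenSignedPerm n => (|monoTriples w - mean q (monoTriples (n := n))| +
        |adjCount w - mean q (adjCount (n := n))|) + 12) := by
    refine mean_mono hq fun w => ?_
    have e : gradSum w - mean q (gradSum (n := n)) =
        ((monoTriples w - mean q (monoTriples (n := n))) +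
          (adjCount w - mean q (adjCount (n := n)))) + (F w - mean q F) := by
      rw [hm]; simp only [hF]; ring
    rw [e]
    refine (abs_add_le _ _).trans (add_le_add (abs_add_le _ _) ?_)
    exact (abs_sub _ _).trans (by linarith [hFb w])
  rw [mean_add, mean_add, mean_const hq] at h3
  linarith

/-- Adjacencies are dropped; `(n - 2) / 3 - 4 ≥ 3n / 10` is exactly `n ≥ 140`. -/
theorem le_mean_gradSum (hn : 140 ≤ n) (hq : 0 < q) :
    3 / 10 * (n : ℝ) ≤ mean q (gradSum (n := n)) := by
  have hn2 : 2 ≤ n := by omega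
  have h1 := le_mean_monoTriples (q := q) hn2 hq
  have h2 : mean q (fun w : evenSignedPerm n => -4 + monoTriples w) ≤
      mean q (gradSum (n := n)) := by
    refine mean_mono hq fun w => ?_
    have h := (abs_le.1 (abs_gradSum_sub_le hn2 w)).1
    have h0 : 0 ≤ adjCount w := Finset.sum_nonneg fun i _ => ind_nonneg _ w
    linarith
  rw [mean_add, mean_const hq] at h2
  have h3 : (140 : ℝ) ≤ n := by exact_mod_cast hn
  linarith

theorem descProb_mul_one_sub (hq : 0 < q) :
    descProb q * (1 - descProb q) = (√q / (1 + q)) ^ 2 := by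
  rw [div_pow, Real.sq_sqrt hq.le, descProb]
  field_simp
  ring

/-- Here `√q / (1 + q) = 1 / (q^(-1/2) + q^(1/2))` is the square root of `κ`; this is the source of
the factor `max (q^(-1/2)) (q^(1/2))`. -/
theorem one_le_two_mul_max_mul (hq : 0 < q) :
    1 ≤ 2 * max (√q)⁻¹ (√q) * (√q / (1 + q)) := by
  have hs := Real.sqrt_pos.2 hq
  have hsq := Real.sq_sqrt hq.le
  rw [mul_div_assoc', le_div_iff₀ (by positivity), one_mul]
  have h1 : 1 ≤ max (√q)⁻¹ (√q) * √q := by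
    calc (1 : ℝ) = (√q)⁻¹ * √q := (inv_mul_cancel₀ hs.ne').symm
      _ ≤ _ := mul_le_mul_of_nonneg_right (le_max_left _ _) hs.le
  have h2 : q ≤ max (√q)⁻¹ (√q) * √q := by
    calc q = √q * √q := by rw [← sq, hsq]
      _ ≤ _ := mul_le_mul_of_nonneg_right (le_max_right _ _) hs.le
  linarith

/-- The factor `125 = 5 · 5²` combines the Lipschitz constant `5L` of `f'` with the squared
increment bound 5 for `T`. Then `σ² ≥ (3/5) κ N` and `√(3/5) ≥ 3/4` give `125 · (5/3) · (8/3) =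
5000/9 ≤ 666`. -/
theorem sigma_ratio_le {N κ ρ σ s M : ℝ} (hN : 0 < N) (hs : 0 < s) (hκ : κ = s ^ 2)
    (hM : 1 ≤ 2 * M * s) (hρ : 3 / 10 * N ≤ ρ) (hσ : 0 < σ) (hvar : σ ^ 2 = 2 * κ * ρ) :
    125 * (N * κ / σ ^ 3) ≤ 666 * M / √N := by
  have hN' := Real.sqrt_pos.2 hN
  have hNs := Real.sq_sqrt hN.le
  have h1 : (s * √N) ^ 2 * (3 / 5) ≤ σ ^ 2 := by
    rw [hvar, mul_pow, hNs, hκ]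
    nlinarith [sq_pos_of_pos hs]
  have h2 : 3 / 4 * (s * √N) ≤ σ := by
    refine (abs_le_of_sq_le_sq' ?_ hσ.le).2
    nlinarith [sq_nonneg (s * √N)]
  have h3 : N * κ * (3 / 5) ≤ σ ^ 2 := by rw [hκ]; nlinarith
  rw [mul_div_assoc', div_le_div_iff₀ (by positivity) hN']
  have hM0 : 0 < M := by
    by_contra hc
    nlinarith
  have h4 : √N ≤ 2 * M * (4 / 3 * σ) := by
    calc √N = 1 * √N := (one_mul _).symm
      _ ≤ (2 * M * s) * √N := mul_le_mul_of_nonneg_right hM hN'.le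
      _ = 2 * M * (s * √N) := by ring
      _ ≤ 2 * M * (4 / 3 * σ) := mul_le_mul_of_nonneg_left (by linarith) (by positivity)
  calc 125 * (N * κ) * √N ≤ 125 * (5 / 3 * σ ^ 2) * (2 * M * (4 / 3 * σ)) :=
        mul_le_mul (by linarith) h4 hN'.le (by positivity)
    _ = 5000 / 9 * (M * σ ^ 3) := by ring
    _ ≤ 666 * M * σ ^ 3 := by nlinarith [mul_pos hM0 (pow_pos hσ 3)]

theorem abs_mean_comp_twoDes_le (hn : 140 ≤ n) (hq : 0 < q) {g : ℝ → ℝ} {C L σ : ℝ}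
    (hgc : Continuous g) (hC : ∀ x, |g x| ≤ C) (hL : ∀ x y, |g x - g y| ≤ L * |x - y|)
    (h0 : ∫ t, g t * gaussKernel t = 0) (hσ : 0 ≤ σ)
    (hvar : σ ^ 2 =
      mean q (fun w : evenSignedPerm n => (twoDes w - mean q (twoDes (n := n))) ^ 2)) :
    |mean q (fun w : evenSignedPerm n => g ((twoDes w - mean q (twoDes (n := n))) / σ))| ≤
      (72 * C + 666 * L * max (√q)⁻¹ (√q)) / √n := by
  have hn2 : 2 ≤ n := by omega
  have hN : (140 : ℝ) ≤ n := by exact_mod_cast hn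
  have hN0 : (0 : ℝ) < n := by linarith
  have hs : 0 < √q / (1 + q) := by have := Real.sqrt_pos.2 hq; positivity
  have hκ := descProb_mul_one_sub hq
  have hρ := le_mean_gradSum hn hq
  have hv := hvar
  rw [mean_twoDes_variance hn2 hq] at hv
  have hσ0 : 0 < σ := by
    refine lt_of_le_of_ne hσ fun h => ?_
    rw [← h, hκ] at hv
    have : 0 < 2 * (√q / (1 + q)) ^ 2 * mean q (gradSum (n := n)) := by
      have : 0 < mean q (gradSum (n := n)) := by linarith
      positivity
    linarith
  obtain ⟨f, f', hf, hst, hfC, hfL⟩ := exists_stein_solution hgc hC hL h0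
  have hb := stein_bound hn2 hq hf hfC hfL hσ0 hvar
    (fun i hi w => abs_delta_twoDes_le hn2 hi w)
  simp only [hst] at hb
  refine hb.trans ?_
  have hC0 : 0 ≤ C := (abs_nonneg _).trans (hC 0)
  have hL0 : 0 ≤ L := by
    have := (abs_nonneg _).trans (hL 1 0)
    simpa using this
  have hr := sigma_ratio_le hN0 hs hκ (one_le_two_mul_max_mul hq) hρ hσ0 hv
  have hsn := Real.sqrt_pos.2 hN0
  have hsn2 := Real.sq_sqrt hN0.le
  have hg := mean_abs_gradSum_sub_le (q := q) hn2 hq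
  -- The three estimates below add up to `(5/2 + 29/4 + 21/20) √n = 10.8 √n`, and `10.8 / 0.3 = 36`.
  have hA : mean q (fun w : evenSignedPerm n => |gradSum w - mean q (gradSum (n := n))|) /
      mean q (gradSum (n := n)) ≤ 36 / √n := by
    rw [div_le_div_iff₀ (by linarith) hsn]
    have h6 : √(6 * n) ≤ 5 / 2 * √n := by
      rw [Real.sqrt_le_left (by positivity), mul_pow, hsn2]; linarith
    have h52 : √(52 * n) ≤ 29 / 4 * √n := by
      rw [Real.sqrt_le_left (by positivity), mul_pow, hsn2]; linarith
    have h12 : 12 ≤ 21 / 20 * √n := by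
      have : (80 / 7 : ℝ) ≤ √n := Real.le_sqrt_of_sq_le (by linarith)
      linarith
    nlinarith
  rw [add_div]
  refine add_le_add ?_ ?_
  · calc _ ≤ 2 * C * (36 / √n) := mul_le_mul_of_nonneg_left hA (by positivity)
      _ = _ := by ring
  · calc _ = L * (125 * (n * (descProb q * (1 - descProb q)) / σ ^ 3)) := by ring
      _ ≤ L * (666 * max (√q)⁻¹ (√q) / √n) := mul_le_mul_of_nonneg_left hr hL0
      _ = _ := by ring

theorem integral_mallowsMeasure (hq : 0 < q) (F : evenSignedPerm n → ℝ) :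
    ∫ w, F w ∂(mallowsMeasure (typeDGenerators n) q) = mean q F := by
  have hF : Measurable F := measurable_from_top
  rw [mallowsMeasure, integral_finsetSum_measure]
  · refine Finset.sum_congr rfl fun w _ => ?_
    rw [integral_smul_measure, integral_dirac' _ _ hF.stronglyMeasurable]
    exact congrArg (· * F w) (ENNReal.toReal_ofReal (mprob_pos hq w).le)
  · intro w _
    exact (integrable_dirac' hF.stronglyMeasurable (by simp)).smul_measure ENNReal.ofReal_ne_top

theorem integral_gaussianReal_zero_one (h : ℝ → ℝ) :
    ∫ x, h x ∂(gaussianReal 0 1) = (√(2 * Real.pi))⁻¹ * ∫ t, h t * gaussKernel t := by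
  rw [integral_gaussianReal_eq_integral_smul one_ne_zero, ← integral_const_mul]
  congr 1; funext t
  rw [gaussianPDFReal, gaussKernel, smul_eq_mul]
  simp only [NNReal.coe_one, mul_one, sub_zero]
  rw [show -t ^ 2 / 2 = -(1 / 2) * t ^ 2 by ring]
  ring

theorem abs_mean_sub_integral_gaussian_le (hn : 0 < n) (hq : 0 < q) {h : ℝ → ℝ} {H L σ : ℝ}
    (hc : Continuous h) (hH : ∀ x, |h x| ≤ H) (hL : ∀ x y, |h x - h y| ≤ L * |x - y|)
    (hσ : 0 ≤ σ)
    (hvar : σ ^ 2 =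
      mean q (fun w : evenSignedPerm n => (twoDes w - mean q (twoDes (n := n))) ^ 2)) :
    |mean q (fun w : evenSignedPerm n => h ((twoDes w - mean q (twoDes (n := n))) / σ)) -
        ∫ x, h x ∂(gaussianReal 0 1)| ≤
      (768 * H + 666 * L * max (√q)⁻¹ (√q)) / √n := by
  set c := ∫ x, h x ∂(gaussianReal 0 1) with hcdef
  have hN0 : (0 : ℝ) < n := by exact_mod_cast hn
  have hsn := Real.sqrt_pos.2 hN0
  have hH0 : 0 ≤ H := (abs_nonneg _).trans (hH 0)
  have hL0 : 0 ≤ L := by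
    have := (abs_nonneg _).trans (hL 1 0)
    simpa using this
  have hcH : |c| ≤ H := by
    have := norm_integral_le_of_norm_le_const (μ := gaussianReal 0 1) (f := h) (C := H)
      (Filter.Eventually.of_forall hH)
    simpa using this
  have hM : 0 ≤ 666 * L * max (√q)⁻¹ (√q) := by
    have : 0 ≤ max (√q)⁻¹ (√q) := le_max_of_le_right (Real.sqrt_nonneg q)
    positivity
  have hg : ∀ x, |h x - c| ≤ 2 * H := fun x => (abs_sub _ _).trans (by linarith [hH x])
  have e : mean q (fun w : evenSignedPerm n => h ((twoDes w - mean q (twoDes (n := n))) / σ)) - c =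
      mean q (fun w : evenSignedPerm n =>
        h ((twoDes w - mean q (twoDes (n := n))) / σ) - c) := by
    rw [mean_sub, mean_const hq]
  rw [e]
  -- For small `n` the trivial bound `2H` suffices, as `√n ≤ 12`; it also covers `σ = 0`. For large
  -- `n`, `h - c` is centred and bounded by `2H`, which gives `72 · 2H`.
  by_cases hbig : n < 140
  · refine ((abs_mean_le hq _).trans (mean_le_of_le hq fun w => hg _)).trans ?_
    rw [le_div_iff₀ hsn]
    have h12 : √(n : ℝ) ≤ 12 := by
      rw [Real.sqrt_le_left (by norm_num)]
      have : (n : ℝ) < 140 := by exact_mod_cast hbig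
      linarith
    nlinarith
  · have h0 : ∫ t, (h t - c) * gaussKernel t = 0 := by
      simp only [sub_mul]
      rw [integral_sub (integrable_mul_gaussKernel hc hH) (integrable_gaussKernel.const_mul c),
        integral_const_mul, integral_gaussKernel, hcdef, integral_gaussianReal_zero_one]
      have : √(2 * Real.pi) ≠ 0 := by positivity
      field_simp
      ring
    refine (abs_mean_comp_twoDes_le (by omega) hq (hc.sub continuous_const) hg
      (L := L) (fun x y => by simpa using hL x y) h0 hσ hvar).trans ?_
    exact div_le_div_of_nonneg_right (by linarith) hsn.le

end Assembly

/-- Here `Z` is a standard normal variable, possibly on another probability space, and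
`supNorm (deriv h)` is the supremum of `|h'|` over the points at which `h` is differentiable, as
`deriv h` is `0` elsewhere. -/
theorem mainTheorem3 (n : ℕ) (hn : 30 ≤ n) (q : ℝ) (hq : 0 < q)
    {Ω : Type*} [MeasurableSpace Ω] (P : Measure Ω) [IsProbabilityMeasure P]
    (w : Ω → evenSignedPerm n) (hw : HasLaw w (mallowsMeasure (typeDGenerators n) q) P)
    {Ω' : Type*} [MeasurableSpace Ω'] (P' : Measure Ω') [IsProbabilityMeasure P']
    (Z : Ω' → ℝ) (hZ : HasLaw Z (gaussianReal 0 1) P')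
    (h : ℝ → ℝ) (hh : PiecewiseContDiff h) :
    let T : Ω → ℝ := fun ω => (twoSidedDescent (typeDGenerators n) (w ω) : ℝ)
    let μ : ℝ := ∫ ω, T ω ∂P
    let σ : ℝ := √(variance T P)
    ENNReal.ofReal |(∫ ω, h ((T ω - μ) / σ) ∂P) - ∫ ω, h (Z ω) ∂P'| ≤
      (768 * supNorm h +
          666 * supNorm (deriv h) *
            ENNReal.ofReal (max (q ^ (-(1 / 2) : ℝ)) (q ^ (1 / 2 : ℝ)))) *
        ENNReal.ofReal ((n : ℝ) ^ (-(1 / 2) : ℝ)) := by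
  intro T μ σ
  have hn2 : 2 ≤ n := by omega
  have hT : T = fun ω => twoDes (w ω) := funext fun ω => twoSidedDescent_eq hn2 (w ω)
  have hcomp : ∀ F : evenSignedPerm n → ℝ, ∫ ω, F (w ω) ∂P = mean q F := fun F => by
    rw [← integral_mallowsMeasure hq F]
    exact hw.integral_comp (f := F) (Measurable.aestronglyMeasurable measurable_from_top)
  have hμ : μ = mean q (twoDes (n := n)) := by
    simp only [μ, hT]
    exact hcomp twoDes
  have hTm : AEMeasurable T P := by
    rw [hT]
    exact (measurable_from_top (f := twoDes (n := n))).comp_aemeasurable hw.aemeasurable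
  have hσ : σ ^ 2 =
      mean q (fun w : evenSignedPerm n => (twoDes w - mean q (twoDes (n := n))) ^ 2) := by
    rw [Real.sq_sqrt (variance_nonneg T P), variance_eq_integral hTm, ← hcomp]
    simp only [← hμ, hT, μ]
  have hn0 : (0 : ℝ) < n := by exact_mod_cast (by omega : 0 < n)
  have hr : 0 < (n : ℝ) ^ (-(1 / 2) : ℝ) := Real.rpow_pos_of_pos hn0 _
  have hmax : 0 < max (q ^ (-(1 / 2) : ℝ)) (q ^ (1 / 2 : ℝ)) :=
    lt_max_of_lt_left (Real.rpow_pos_of_pos hq _)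
  by_cases hfin : supNorm h ≠ ∞ ∧ supNorm (deriv h) ≠ ∞
  · obtain ⟨h1, h2⟩ := hfin
    have hmain := abs_mean_sub_integral_gaussian_le (n := n) (by omega) hq hh.1
      (abs_le_toReal_supNorm h1) (hh.lipschitz h2) (Real.sqrt_nonneg _) hσ
    have hZ' : ∫ ω, h (Z ω) ∂P' = ∫ x, h x ∂(gaussianReal 0 1) :=
      hZ.integral_comp hh.1.aestronglyMeasurable
    have hW : ∫ ω, h ((T ω - μ) / σ) ∂P = mean q
        (fun w : evenSignedPerm n => h ((twoDes w - mean q (twoDes (n := n))) / σ)) := by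
      rw [← hcomp, hT, hμ]
    rw [hZ', hW]
    refine (ENNReal.ofReal_le_ofReal hmain).trans (le_of_eq ?_)
    rw [← ENNReal.ofReal_toReal h1, ← ENNReal.ofReal_toReal h2,
      Real.rpow_neg hn0.le, Real.rpow_neg hq.le, ← Real.sqrt_eq_rpow, ← Real.sqrt_eq_rpow,
      div_eq_mul_inv, ENNReal.ofReal_mul (by positivity),
      ENNReal.ofReal_add (by positivity) (by positivity), ENNReal.ofReal_mul (by norm_num),
      ENNReal.ofReal_mul (by positivity), ENNReal.ofReal_mul (by norm_num)]
    norm_num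
  -- If a norm is infinite, so is the right-hand side: all the factors multiplying it are nonzero.
  · have htop : (768 * supNorm h + 666 * supNorm (deriv h) *
        ENNReal.ofReal (max (q ^ (-(1 / 2) : ℝ)) (q ^ (1 / 2 : ℝ)))) *
        ENNReal.ofReal ((n : ℝ) ^ (-(1 / 2) : ℝ)) = ∞ := by
      rw [ENNReal.mul_eq_top]
      refine Or.inr ⟨?_, (ENNReal.ofReal_pos.2 hr).ne'⟩
      rw [ENNReal.add_eq_top]
      by_cases h1 : supNorm h = ∞
      · left; rw [h1]; exact ENNReal.mul_top (by norm_num)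
      · right
        have h2 : supNorm (deriv h) = ∞ := by
          by_contra h2; exact hfin ⟨h1, h2⟩
        rw [h2, ENNReal.mul_top (by norm_num)]
        exact ENNReal.top_mul (ENNReal.ofReal_pos.2 hmax).ne'
    rw [htop]
    exact le_top
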